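/- Let $\mathbb T=\mathbb R/2\pi\mathbb Z$ with Haar measure of total mass $2\pi$, and let $\|\alpha\|$ be the distance of $\alpha\in\mathbb T$ from $0$. A family of integrable functions $K_H:\mathbb T\to[0,\infty)$, $H\ge 1$ real, is called a family of positive summability kernels if $\frac1{2\pi}\int_{\mathbb T}K_H(\alpha)\,d\alpha=1$ for all $H$, and, for every $0<\delta<\pi$, $$T_H(\delta):=\int_{\|\alpha\|>\delta}K_H(\alpha)\,d\alpha\to 0\quad\text{as }H\to\infty.$$ Write $\widehat K_H(n):=\frac1{2\pi}\int_{\mathbb T}K_H(\alpha)e^{-in\alpha}\,d\alpha$ for $n\in\mathbb Z$. For $m\ge 1$, $f:\mathbb Z^m\to\mathbb C$, $\mathbf q\in(\mathbb Z\setminus\{0\})^m$ and real $x_1,\dots,x_m\ge1$ put $$E_f(\mathbf x;\mathbf q):=\sup_{\mathbf b\in\prod_{k=1}^m\mathbb Z/q_k\mathbb Z}\ \sup_{\substack{\mathbf v\in\mathbb R^m\\ |v_k|\le x_k\,\forall k}}\Bigg|\sum_{\substack{\mathbf t\in\mathbb Z^m\\ -x_k\le t_k\le v_k\,\forall k}}f(\mathbf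 t)\,e^{2\pi i\sum_{k=1}^m b_kt_k/q_k}\Bigg|.$$ For positive integers $d_1,\dots,d_m$ and $C\ge 0$ put $d:=d_1+\dots+d_m$, $\mathcal D:=\max\{d_1,\dots,d_m\}$, $$\gamma_0:=\sum_{j=1}^m d_j\bigl(1+C(d_j+2)\bigr),\qquad \gamma_1:=\sum_{j=1}^m 2^{2C(d_j+2)+1}.$$ For real $H\geq 1$ let $\mathcal F_{\mathbb Z}(H)$ be the (finite) set of tuples $\mathbf F=(F_1,\dots,F_m)$ of binary forms $F_j=\sum_{k=0}^{d_j}c_{k,j}t_1^kt_2^{d_j-k}$ whose coefficients $c_{k,j}$ are integers in $[-H,H]$ (the zero form is allowed). Let $\tau$ be the divisor function. **Theorem.** Let $m,d_1,\dots,d_m$ be positive integers, $B,\beta_0,c_0>0$, $C\ge0$ and $\beta>1$. There is a constant $A>0$, depending only on $m,d_1,\dots,d_m,B,C,c_0,\beta,\beta_0$, such that the following holds. Let $(K_H)_{H\ge1}$ be positive summability kernels such that for all $H\ge 1$ all the Fourier coefficients $\widehat K_H(n)$, $n\in\mathbb Z$, are non-negative real numbers with $$\widehat K_H(n)\ge c_0\,\mathbf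 1_{[-H,H]}(n),\qquad \widehat K_H(n)\le\beta_0\Bigl(\frac{H}{1+|n|}\Bigr)^{\beta},$$ and such that $K_H(\alpha)=\sum_{n\in\mathbb Z}\widehat K_H(n)e^{i\alpha n}$ for all $\alpha\in\mathbb T$. Let $f:\mathbb Z^m\to\mathbb C$ satisfy $|f(\mathbf n)|\le B\prod_{1\le j\le m,\ n_j\ne0}\tau(|n_j|)^C$ for all $\mathbf n\in\mathbb Z^m$ (an empty product is $1$). Let $\delta\in(0,1)$, let $\xi_0,x,H$ be real numbers with $1\le\xi_0\le x\le H$ and $x\ge 2$, and let $a:\mathbb Z^2\to\{z\in\mathbb C:|z|\le1\}$. Then \begin{align*} &\frac1{\#\mathcal F_{\mathbb Z}(H)}\sum_{\mathbf F\in\mathcal F_{\mathbb Z}(H)}\Bigg|\sum_{\mathbf n\in\mathbb Z^2\cap[-x,x]^2}a(\mathbf n)f(F_1(\mathbf n),\dots,F_m(\mathbf n))\Bigg|^2\\ &\le A\Bigg[\Bigg\{x^{2d}(\log H)^{m2^{C+1}}T_H(\delta)+\frac{(\log H)^{\gamma_1}(\log x)^{2^{2(1+2\gamma_0)}}}{\xi_0^{1/(2\mathcal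 D)}}\Bigg\}x^4\\ &\qquad+\Bigg(\frac{\max\{1,\delta\xi_0H\}}{H}\Bigg)^{2m}\sum_{\substack{\mathbf n,\mathbf l\in\mathbb Z^2,\ n_2l_1\ne\pm n_1l_2\\ x/\xi_0^{1/2}<|n_i|,|l_i|\le x\ (i=1,2)}}E_f\Bigl(\bigl((1+d_j)x^{d_j}H\bigr)_{j=1}^m;\bigl((n_2l_1)^{d_j}-(n_1l_2)^{d_j}\bigr)_{j=1}^m\Bigr)^2\Bigg]. \end{align*} -/

import Mathlib

namespace RandomForms

open MeasureTheory Filter Topology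

noncomputable section

instance fact_two_pi_pos : Fact (0 < 2 * Real.pi) := ⟨Real.two_pi_pos⟩

/-- The circle `ℝ / 2πℤ`. Its `volume` has total mass `2π`, and `‖α‖` is the distance of `α`
from `0`. -/
abbrev Circ : Type := AddCircle (2 * Real.pi)

/-- `T_H(δ)`: the integral of `K_H` over `‖α‖ > δ`. -/
def kernelTail (K : ℝ → Circ → ℝ) (H δ : ℝ) : ℝ :=
  ∫ α in {α : Circ | δ < ‖α‖}, K H α

/-- Positive summability kernels, indexed by the real parameter `H ≥ 1`. -/
structure IsPositiveSummabilityKernel (K : ℝ → Circ → ℝ) : Prop where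
  nonneg : ∀ H : ℝ, 1 ≤ H → ∀ α : Circ, 0 ≤ K H α
  integrable : ∀ H : ℝ, 1 ≤ H → Integrable (K H) volume
  normalised : ∀ H : ℝ, 1 ≤ H → 1 / (2 * Real.pi) * ∫ α : Circ, K H α = 1
  concentration : ∀ δ : ℝ, 0 < δ → δ < Real.pi →
    Tendsto (fun H : ℝ => kernelTail K H δ) atTop (𝓝 0)

/-- The Fourier coefficient of `K_H` at `n`, that is `(1 / 2π) ∫ K_H(α) e^{-inα} dα`. -/
def kernelCoeff (K : ℝ → Circ → ℝ) (H : ℝ) (n : ℤ) : ℂ :=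
  fourierCoeff (fun α : Circ => (K H α : ℂ)) n

/-- The Fourier coefficients of `K_H` are non-negative reals, and at least `c₀` for `|n| ≤ H`. -/
def CoeffLowerBound (K : ℝ → Circ → ℝ) (c₀ : ℝ) : Prop :=
  ∀ H : ℝ, 1 ≤ H → ∀ n : ℤ,
    (kernelCoeff K H n).im = 0 ∧ 0 ≤ (kernelCoeff K H n).re ∧
      (|(n : ℝ)| ≤ H → c₀ ≤ (kernelCoeff K H n).re)

/-- Decay of the (real) Fourier coefficients of `K_H`. -/
def CoeffDecay (K : ℝ → Circ → ℝ) (β₀ β : ℝ) : Prop :=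
  ∀ H : ℝ, 1 ≤ H → ∀ n : ℤ,
    (kernelCoeff K H n).re ≤ β₀ * (H / (1 + |(n : ℝ)|)) ^ β

/-- `K_H` is everywhere the sum of its Fourier series; `fourier n α` is `e^{inα}`. -/
def FourierInversion (K : ℝ → Circ → ℝ) : Prop :=
  ∀ H : ℝ, 1 ≤ H → ∀ α : Circ,
    HasSum (fun n : ℤ => kernelCoeff K H n * fourier n α) (K H α : ℂ)

/-- `|f(n)| ≤ B ∏_{n_j ≠ 0} τ(|n_j|)^C` for all `n ∈ ℤ^m`, where `τ` is the divisor function. -/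
def DivisorBounded {m : ℕ} (B C : ℝ) (f : (Fin m → ℤ) → ℂ) : Prop :=
  ∀ n : Fin m → ℤ,
    ‖f n‖ ≤ B * ∏ j with n j ≠ 0, (((n j).natAbs.divisors.card : ℕ) : ℝ) ^ C

/-- `E_f(X; q)`. The summand depends on `b` only through the classes of `b_k` modulo `q_k`, so that
`b` runs over integer vectors representing `∏ ℤ / q_k ℤ`. -/
def expSumSup {m : ℕ} (f : (Fin m → ℤ) → ℂ) (X : Fin m → ℝ) (q : Fin m → ℤ) : ℝ :=
  sSup {s : ℝ | ∃ (b : Fin m → ℤ) (v : Fin m → ℝ), (∀ k, |v k| ≤ X k) ∧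
    s = ‖∑ t ∈ Fintype.piFinset (fun k => Finset.Icc ⌈-X k⌉ ⌊v k⌋),
      f t * Complex.exp (2 * Real.pi * Complex.I * ∑ k, (b k : ℂ) * (t k : ℂ) / (q k : ℂ))‖}

/-- The tuples of integral binary forms of degrees `d_1, …, d_m` with all coefficients in
`[-H, H]`, where the form `∑ c_k t₁^k t₂^(d_j - k)` is given by its coefficients
`c_0, …, c_{d_j}`. -/
def formBox {m : ℕ} (d : Fin m → ℕ) (H : ℝ) : Finset ((j : Fin m) → Fin (d j + 1) → ℤ) :=
  Fintype.piFinset fun _ => Fintype.piFinset fun _ => Finset.Icc (-⌊H⌋) ⌊H⌋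

/-- The value at `n` of the binary form of degree `e` with coefficients `c`. -/
def evalForm {e : ℕ} (c : Fin (e + 1) → ℤ) (n : ℤ × ℤ) : ℤ :=
  ∑ k : Fin (e + 1), c k * n.1 ^ (k : ℕ) * n.2 ^ (e - (k : ℕ))

/-- `ℤ² ∩ [-x, x]²`. -/
def intBox (x : ℝ) : Finset (ℤ × ℤ) :=
  Finset.Icc (-⌊x⌋) ⌊x⌋ ×ˢ Finset.Icc (-⌊x⌋) ⌊x⌋

/-- The average over the tuples `F` of forms of
`|∑_{n ∈ ℤ² ∩ [-x, x]²} a(n) f(F_1(n), …, F_m(n))|²`. -/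
def secondMoment {m : ℕ} (d : Fin m → ℕ) (f : (Fin m → ℤ) → ℂ) (a : ℤ × ℤ → ℂ) (x H : ℝ) : ℝ :=
  1 / ((formBox d H).card : ℝ) *
    ∑ F ∈ formBox d H, ‖∑ n ∈ intBox x, a n * f (fun j => evalForm (F j) n)‖ ^ 2

/-- `γ₀ = ∑_j d_j (1 + C (d_j + 2))`. -/
def gammaZero {m : ℕ} (d : Fin m → ℕ) (C : ℝ) : ℝ :=
  ∑ j, (d j : ℝ) * (1 + C * ((d j : ℝ) + 2))

/-- `γ₁ = ∑_j 2^(2 C (d_j + 2) + 1)`. -/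
def gammaOne {m : ℕ} (d : Fin m → ℕ) (C : ℝ) : ℝ :=
  ∑ j, (2 : ℝ) ^ (2 * C * ((d j : ℝ) + 2) + 1)

/-- `d = d_1 + ⋯ + d_m`. -/
def totalDeg {m : ℕ} (d : Fin m → ℕ) : ℕ := ∑ j, d j

/-- `max {d_1, …, d_m}`. -/
def maxDeg {m : ℕ} (d : Fin m → ℕ) : ℕ := Finset.univ.sup d

open Classical in
/-- The pairs `(n, l)` of integer vectors with `n₂ l₁ ≠ ± n₁ l₂` and
`x / ξ₀^(1/2) < |n_i|, |l_i| ≤ x`. -/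
def majorPairs (x ξ₀ : ℝ) : Finset ((ℤ × ℤ) × (ℤ × ℤ)) :=
  (intBox x ×ˢ intBox x).filter fun p =>
    p.1.2 * p.2.1 ≠ p.1.1 * p.2.2 ∧ p.1.2 * p.2.1 ≠ -(p.1.1 * p.2.2) ∧
    x / ξ₀ ^ (1 / 2 : ℝ) < |(p.1.1 : ℝ)| ∧ x / ξ₀ ^ (1 / 2 : ℝ) < |(p.1.2 : ℝ)| ∧
    x / ξ₀ ^ (1 / 2 : ℝ) < |(p.2.1 : ℝ)| ∧ x / ξ₀ ^ (1 / 2 : ℝ) < |(p.2.2 : ℝ)|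

/-- The sum of `E_f(((1 + d_j) x^{d_j} H)_j; ((n₂ l₁)^{d_j} - (n₁ l₂)^{d_j})_j)²` over the pairs
`(n, l)` above. -/
def majorSum {m : ℕ} (d : Fin m → ℕ) (f : (Fin m → ℤ) → ℂ) (x ξ₀ H : ℝ) : ℝ :=
  ∑ p ∈ majorPairs x ξ₀,
    expSumSup f (fun j => (1 + (d j : ℝ)) * x ^ d j * H)
      (fun j => (p.1.2 * p.2.1) ^ d j - (p.1.1 * p.2.2) ^ d j) ^ 2

end

end RandomForms

namespace RandomForms

open MeasureTheory Filter Topology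

/-! Expanding the square turns the second moment into a sum over pairs `(n, l)` of correlations
between `f(F(n))` and `f(F(l))`. The average over the box of forms is first majorised by an integral
against a product measure in which each coefficient `c` has mass `K̂_H(c)`, at least `c₀` on `[-H,
H]`; and `f` is truncated to a box containing every value that occurs, so that its exponential sum
`S` is finite.

Orthogonality writes the product of `f` at two points as an integral of `S(θ)` times the conjugate
of `S(θ')` against a character whose exponent is linear in the coefficients of `F`. Integrating each
coefficient then produces, for every `j`, the product of `K_H` at `d_j + 1` linear forms in `(θ_j,
θ'_j)` (`integral_truncate_mul_conj`). The forms of the first and last coefficients are kept; the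
others are bounded by `sup K_H ≪ H`. The two kept forms have determinant `± q_j`, where `q_j =
(n₂l₁)^{d_j} - (n₁l₂)^{d_j}`. If `q_j ≠ 0` they define a surjective endomorphism of the torus, which
preserves Haar measure, so the two kernels behave independently. Where some argument exceeds `δ` the
kernels have small mass and `S` is bounded by the sum of `|f|`. Where all arguments are at most `δ`,
Cramer's rule puts `q_j θ_j` near `0`, hence `θ_j` near a rational multiple of `2π` with denominator
`q_j`, and partial summation bounds `S` by `E_f` (`norm_pair_integral_le`,
`norm_correlation_le_of_det`).

This is efficient when `|q_j| ≥ x^{2d_j}/ξ₀`. The other pairs, together with those having a small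
coordinate, are few, but need a mean square bound for `f(F(n))`. For this, `τ` of a value is
majorised by a sum over its small divisors (`exists_dvd_pow_le_card_divisors_le`), and for primitive
`n` the forms with `q ∣ F(n)` have mass `≪ H^{e+1}/q` (`coeffMeasure_dvd_le`). A common factor `g`
of the coordinates costs a power of `τ(g)`, which is averaged while the exceptional pairs are
counted (`sum_exceptional_gcdWeight_le`). -/

noncomputable section

/-! ### Powers of the divisor function and their averages -/

/-- The `M`-fold divisor function: the number of ways to write `n` as an ordered product of `M`
positive integers. -/
def kDiv (M n : ℕ) : ℕ := (ArithmeticFunction.zeta ^ M) n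

theorem kDiv_one (M : ℕ) : kDiv M 1 = 1 :=
  (ArithmeticFunction.isMultiplicative_zeta.pow (k := M)).1

theorem kDiv_succ (M n : ℕ) : kDiv (M + 1) n = ∑ i ∈ n.divisors, kDiv M i := by
  rw [kDiv, pow_succ, ArithmeticFunction.mul_zeta_apply]; rfl

theorem kDiv_mul {M a b : ℕ} (h : a.Coprime b) : kDiv M (a * b) = kDiv M a * kDiv M b :=
  (ArithmeticFunction.isMultiplicative_zeta.pow (k := M)).map_mul_of_coprime h

theorem kDiv_prime_pow (M : ℕ) {p : ℕ} (hp : p.Prime) (j : ℕ) :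
    kDiv M (p ^ j) = M.multichoose j := by
  induction M generalizing j with
  | zero =>
    rcases j with _ | j
    · simp [kDiv]
    · simp [kDiv, hp.ne_one]
  | succ M ih =>
    rw [kDiv_succ, Nat.sum_divisors_prime_pow hp]
    simp_rw [ih]
    rw [Nat.sum_range_multichoose, Nat.multichoose_eq]
    rw [show M + 1 + j - 1 = j + M by omega, Nat.choose_symm_add]

/-- For `C ≥ 1` the convex function `(1 + t)^C` lies below its chord over `[0, 1]`, of slope `2^C -
1`. For `C ≤ 1` it lies below `1 + t`, which is why `M ≥ 2` is needed unless `C = 0`. -/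
theorem one_add_rpow_le {C t M : ℝ} (hC : 0 ≤ C) (ht : 0 ≤ t) (ht1 : t ≤ 1)
    (hM : (2 : ℝ) ^ C ≤ M) (hM2 : C = 0 ∨ 2 ≤ M ) : (1 + t) ^ C ≤ 1 + (M - 1) * t := by
  rcases le_total 1 C with h | h
  · have := (convexOn_rpow h).2 (show (1 : ℝ) ∈ Set.Ici 0 by simp)
      (show (2 : ℝ) ∈ Set.Ici 0 by simp) (show 0 ≤ 1 - t by linarith) ht (by ring)
    simp only [smul_eq_mul, Real.one_rpow] at this
    rw [show (1 - t) * 1 + t * 2 = 1 + t by ring] at this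
    nlinarith
  · rcases hM2 with rfl | h2
    · have : 1 ≤ M := by simpa using hM
      simpa using mul_nonneg (by linarith) ht
    · have : (1 + t) ^ C ≤ (1 + t) ^ (1 : ℝ) :=
        Real.rpow_le_rpow_of_exponent_le (by linarith) h
      rw [Real.rpow_one] at this
      nlinarith

/-- Compare consecutive ratios: the left side grows by `(1 + 1/(j+1))^C`, the right side by `1 +
(M-1)/(j+1)`. -/
theorem rpow_le_multichoose {C : ℝ} (hC : 0 ≤ C) {M : ℕ} (hM : (2 : ℝ) ^ C ≤ M) (j : ℕ) :
    ((j : ℝ) + 1) ^ C ≤ M.multichoose j := by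
  have hM1 : (1 : ℝ) ≤ M := (Real.one_le_rpow (by norm_num) hC).trans hM
  have hM2 : C = 0 ∨ (2 : ℝ) ≤ M := by
    rcases hC.eq_or_lt with h | h
    · exact Or.inl h.symm
    · right
      have : (1 : ℝ) < M := (Real.one_lt_rpow (by norm_num) h).trans_le hM
      exact_mod_cast (by exact_mod_cast this : 1 < M)
  induction j with
  | zero => simp
  | succ j ih =>
    obtain ⟨K, rfl⟩ : ∃ K, M = K + 1 := ⟨M - 1, by
      have : 1 ≤ M := by exact_mod_cast hM1
      omega⟩
    have hrec : ((K + 1).multichoose (j + 1) : ℝ) * (j + 1)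
        = (K + j + 1) * (K + 1).multichoose j := by
      have := Nat.add_one_mul_choose_eq (K + j) j
      rw [Nat.multichoose_eq, Nat.multichoose_eq, show K + 1 + (j + 1) - 1 = K + j + 1 by omega,
        show K + 1 + j - 1 = K + j by omega]
      exact_mod_cast this.symm
    have hj : (0 : ℝ) < (j : ℝ) + 1 := by positivity
    have h1 := one_add_rpow_le hC (t := 1 / ((j : ℝ) + 1)) (by positivity)
      (by rw [div_le_one hj]; linarith [(Nat.cast_nonneg j : (0 : ℝ) ≤ j)]) hM hM2
    have h2 : ((j + 1 : ℕ) : ℝ) + 1 = (1 + 1 / ((j : ℝ) + 1)) * (j + 1) := by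
      push_cast; field_simp
    rw [h2, Real.mul_rpow (by positivity) hj.le]
    have h3 : ((K + 1).multichoose (j + 1) : ℝ)
        = (1 + (((K + 1 : ℕ) : ℝ) - 1) * (1 / ((j : ℝ) + 1))) * (K + 1).multichoose j := by
      push_cast
      field_simp
      linarith
    rw [h3]
    gcongr


/-- Both sides are multiplicative, so prime powers suffice. A real power of `τ` is thus traded for
an arithmetic function of integral order, with an exact recursion. -/
theorem card_divisors_rpow_le {C : ℝ} (hC : 0 ≤ C) {M : ℕ} (hM : (2 : ℝ) ^ C ≤ M) {n : ℕ}
    (hn : n ≠ 0) : ((n.divisors.card : ℕ) : ℝ) ^ C ≤ kDiv M n := by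
  induction n using Nat.recOnPosPrimePosCoprime with
  | zero => exact absurd rfl hn
  | one => simp [kDiv_one]
  | prime_pow p k hp hk =>
    rw [kDiv_prime_pow M hp, Nat.divisors_prime_pow hp]
    simpa using rpow_le_multichoose hC hM k
  | coprime a b ha hb hab iha ihb =>
    rw [hab.card_divisors_mul, kDiv_mul hab]
    push_cast
    rw [Real.mul_rpow (by positivity) (by positivity)]
    exact mul_le_mul (iha (by omega)) (ihb (by omega)) (by positivity) (by positivity)

theorem sum_divisors_comm (F : ℕ → ℕ → ℝ) (N : ℕ) :
    ∑ n ∈ Finset.Ioc 0 N, ∑ d ∈ n.divisors, F d n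
      = ∑ d ∈ Finset.Ioc 0 N, ∑ k ∈ Finset.Ioc 0 (N / d), F d (d * k) := by
  rw [Finset.sum_sigma', Finset.sum_sigma']
  refine Finset.sum_bij' (fun x _ => ⟨x.2, x.1 / x.2⟩) (fun x _ => ⟨x.1 * x.2, x.1⟩) ?_ ?_ ?_ ?_ ?_
  · rintro ⟨n, d⟩ h
    simp only [Finset.mem_sigma, Finset.mem_Ioc, Nat.mem_divisors] at h ⊢
    obtain ⟨⟨h1, h2⟩, ⟨k, rfl⟩, h4⟩ := h
    have hd : 0 < d := Nat.pos_of_mul_pos_right h1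
    have hk : 0 < k := Nat.pos_of_mul_pos_left h1
    rw [Nat.mul_div_cancel_left _ hd, Nat.le_div_iff_mul_le hd]
    exact ⟨⟨hd, (Nat.le_mul_of_pos_right d hk).trans h2⟩, hk, by linarith [mul_comm d k]⟩
  · rintro ⟨d, k⟩ h
    simp only [Finset.mem_sigma, Finset.mem_Ioc, Nat.mem_divisors] at h ⊢
    obtain ⟨⟨h1, h2⟩, h3, h4⟩ := h
    rw [Nat.le_div_iff_mul_le h1] at h4
    exact ⟨⟨Nat.mul_pos h1 h3, by linarith [mul_comm d k]⟩, ⟨k, rfl⟩, (Nat.mul_pos h1 h3).ne'⟩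
  · rintro ⟨n, d⟩ h
    simp only [Finset.mem_sigma, Finset.mem_Ioc, Nat.mem_divisors] at h
    simp [Nat.mul_div_cancel' h.2.1]
  · rintro ⟨d, k⟩ h
    simp only [Finset.mem_sigma, Finset.mem_Ioc] at h
    simp [Nat.mul_div_cancel_left _ h.1.1]
  · rintro ⟨n, d⟩ h
    simp only [Finset.mem_sigma, Finset.mem_Ioc, Nat.mem_divisors] at h
    simp [Nat.mul_div_cancel' h.2.1]

theorem one_le_one_add_log (N : ℕ) : 1 ≤ 1 + Real.log N := by
  linarith [Real.log_natCast_nonneg N]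

theorem sum_inv_le_log (N : ℕ) : ∑ n ∈ Finset.Ioc 0 N, (n : ℝ)⁻¹ ≤ 1 + Real.log N := by
  have := harmonic_le_one_add_log N
  rw [harmonic_eq_sum_Icc] at this
  push_cast at this
  exact this

/-- Each of the `M` factors contributes one harmonic sum. -/
theorem sum_kDiv_div_le (M N : ℕ) :
    ∑ n ∈ Finset.Ioc 0 N, (kDiv M n : ℝ) / n ≤ (1 + Real.log N) ^ M := by
  induction M with
  | zero =>
    rw [pow_zero]
    calc ∑ n ∈ Finset.Ioc 0 N, (kDiv 0 n : ℝ) / n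
        ≤ ∑ n ∈ Finset.Ioc 0 N, if n = 1 then 1 else 0 := by
          refine Finset.sum_le_sum fun n _ => ?_
          simp only [kDiv, pow_zero, ArithmeticFunction.one_apply]
          split_ifs with h <;> simp [h]
      _ ≤ 1 := by rw [Finset.sum_ite_eq']; split_ifs <;> norm_num
  | succ M ih =>
    calc ∑ n ∈ Finset.Ioc 0 N, (kDiv (M + 1) n : ℝ) / n
        = ∑ n ∈ Finset.Ioc 0 N, ∑ d ∈ n.divisors, (kDiv M d : ℝ) / n := by
          refine Finset.sum_congr rfl fun n _ => ?_
          rw [kDiv_succ, Nat.cast_sum, Finset.sum_div]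
      _ = ∑ d ∈ Finset.Ioc 0 N, (kDiv M d : ℝ) / d * ∑ k ∈ Finset.Ioc 0 (N / d), (k : ℝ)⁻¹ := by
          rw [sum_divisors_comm (fun d n => (kDiv M d : ℝ) / n)]
          refine Finset.sum_congr rfl fun d _ => ?_
          rw [Finset.mul_sum]
          refine Finset.sum_congr rfl fun k _ => ?_
          push_cast
          rw [div_mul_eq_div_div, div_eq_mul_inv]
      _ ≤ ∑ d ∈ Finset.Ioc 0 N, (kDiv M d : ℝ) / d * (1 + Real.log N) := by
          refine Finset.sum_le_sum fun d _ => ?_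
          refine mul_le_mul_of_nonneg_left ?_ (by positivity)
          refine le_trans ?_ (sum_inv_le_log N)
          exact Finset.sum_le_sum_of_subset_of_nonneg
            (Finset.Ioc_subset_Ioc_right (Nat.div_le_self _ _)) fun _ _ _ => by positivity
      _ ≤ (1 + Real.log N) ^ (M + 1) := by
          rw [← Finset.sum_mul, pow_succ]
          gcongr

/-- One factor is summed trivially, with `⌊N/d⌋ ≤ N/d`, so only `M` logarithms are lost for order `M
+ 1`. -/
theorem sum_kDiv_le (M N : ℕ) :
    ∑ n ∈ Finset.Ioc 0 N, (kDiv (M + 1) n : ℝ) ≤ N * (1 + Real.log N) ^ M := by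
  have h : ∑ n ∈ Finset.Ioc 0 N, (kDiv (M + 1) n : ℝ)
      = ∑ d ∈ Finset.Ioc 0 N, (kDiv M d : ℝ) * ((N / d : ℕ) : ℝ) := by
    have := ArithmeticFunction.sum_Ioc_mul_zeta_eq_sum (ArithmeticFunction.zeta ^ M) N
    rw [← Nat.cast_sum]
    simp only [kDiv, pow_succ]
    rw [ArithmeticFunction.natCoe_nat] at this
    rw [this]
    push_cast
    rfl
  rw [h]
  calc _ ≤ ∑ d ∈ Finset.Ioc 0 N, N * ((kDiv M d : ℝ) / d) := by
        refine Finset.sum_le_sum fun d _ => ?_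
        calc (kDiv M d : ℝ) * ((N / d : ℕ) : ℝ) ≤ kDiv M d * (N / d : ℝ) := by
              gcongr; exact Nat.cast_div_le
          _ = _ := by ring
    _ ≤ _ := by rw [← Finset.mul_sum]; gcongr; exact sum_kDiv_div_le M N

/-! ### A small divisor controlling the number of divisors -/

/-- As long as `s²` indices remain, the pigeonhole principle gives `s` of them with the same
exponent; they are discarded except for the one of least `w`, whose `s`-th powers account for the
whole group. The last fewer than `s²` indices cost at most `s^(s²)`. -/
theorem exists_subset_pow_prod_le {ι : Type*} [DecidableEq ι] (s : ℕ) (hs : 1 ≤ s) (e w : ι → ℕ)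
    (n : ℕ) (P : Finset ι) (hP : P.card = n) (he : ∀ i ∈ P, e i < s) (hw : ∀ i ∈ P, 1 ≤ w i) :
    ∃ T ⊆ P, (∏ i ∈ T, w i) ^ s ≤ ∏ i ∈ P, w i ∧
      ∏ i ∈ P, (e i + 1) ≤ s ^ (s * s) * (∏ i ∈ T, (e i + 1)) ^ s := by
  induction n using Nat.strong_induction_on generalizing P with
  | _ n ih =>
    rcases le_or_gt (s * s) P.card with hc | hc
    · obtain ⟨r, -, hr⟩ := Finset.exists_le_card_fiber_of_mul_le_card_of_maps_to
        (s := P) (t := Finset.range s) (f := e) (n := s)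
        (fun i hi => Finset.mem_range.2 (he i hi)) ⟨0, Finset.mem_range.2 (by omega)⟩
        (by simpa using hc)
      obtain ⟨S, hSsub, hScard⟩ := Finset.exists_subset_card_eq hr
      have hSP : S ⊆ P := hSsub.trans (Finset.filter_subset _ _)
      have hSe : ∀ i ∈ S, e i = r := fun i hi => (Finset.mem_filter.1 (hSsub hi)).2
      obtain ⟨i0, hi0, hmin⟩ := S.exists_min_image w (Finset.card_pos.1 (by omega))
      have hcard : (P \ S).card = n - s := by rw [Finset.card_sdiff_of_subset hSP, hP, hScard]
      have hle : s ≤ n := by rw [← hP, ← hScard]; exact Finset.card_le_card hSP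
      obtain ⟨T, hT, hT1, hT2⟩ := ih (n - s) (by omega) (P \ S) hcard
        (fun i hi => he i (Finset.sdiff_subset hi)) (fun i hi => hw i (Finset.sdiff_subset hi))
      have hi0T : i0 ∉ T := fun h => (Finset.mem_sdiff.1 (hT h)).2 hi0
      refine ⟨insert i0 T, ?_, ?_, ?_⟩
      · exact Finset.insert_subset (hSP hi0) (hT.trans Finset.sdiff_subset)
      · rw [Finset.prod_insert hi0T, mul_pow, ← Finset.prod_sdiff hSP, mul_comm]
        refine Nat.mul_le_mul hT1 ?_
        rw [← hScard]
        exact Finset.pow_card_le_prod S w (w i0) hmin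
      · rw [Finset.prod_insert hi0T, mul_pow, ← Finset.prod_sdiff hSP]
        have : ∏ i ∈ S, (e i + 1) = (e i0 + 1) ^ s := by
          rw [Finset.prod_congr rfl (fun i hi => by rw [hSe i hi, ← hSe i0 hi0]),
            Finset.prod_const, hScard]
        rw [this]
        calc _ ≤ s ^ (s * s) * (∏ i ∈ T, (e i + 1)) ^ s * (e i0 + 1) ^ s :=
              Nat.mul_le_mul_right _ hT2
          _ = _ := by ring
    · refine ⟨∅, by simp, ?_, ?_⟩
      · simpa using Finset.one_le_prod' hw
      · simp only [Finset.prod_empty, one_pow, mul_one]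
        calc ∏ i ∈ P, (e i + 1) ≤ s ^ P.card := Finset.prod_le_pow_card _ _ _ he
          _ ≤ s ^ (s * s) := Nat.pow_le_pow_right hs hc.le

/-- With `a = e / s ≥ 1` one has `e + 1 ≤ s (a + 1)`, and `s ≤ 2^(s-1) ≤ (a + 1)^(s-1)`. -/
theorem add_one_le_pow_div (s e : ℕ) (hs : 2 ≤ s) (he : s ≤ e) : e + 1 ≤ (e / s + 1) ^ s := by
  have ha : 1 ≤ e / s := (Nat.one_le_div_iff (by omega)).2 he
  have hlt : e < s * (e / s) + s := by
    have := Nat.lt_mul_div_succ e (show 0 < s by omega)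
    linarith
  set a := e / s
  have key : ∀ s : ℕ, 2 ≤ s → s * a + s ≤ (a + 1) ^ s := by
    intro s hs
    induction s, hs using Nat.le_induction with
    | base => nlinarith
    | succ k hk ih =>
      rw [pow_succ]
      calc (k + 1) * a + (k + 1) = (k + 1) * (a + 1) := by ring
        _ ≤ (k * a + k) * (a + 1) := Nat.mul_le_mul_right _ (by nlinarith)
        _ ≤ _ := Nat.mul_le_mul_right _ ih
  have := key s hs
  omega

/-- In the factorisation of `N`, exponents `e ≥ s` are replaced by `⌊e/s⌋`. Among the primes with
exponent below `s`, a subset is selected by `exists_subset_pow_prod_le` and kept with full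
exponents. -/
theorem exists_dvd_pow_le_card_divisors_le (s : ℕ) (hs : 2 ≤ s) (N : ℕ) (hN : N ≠ 0) :
    ∃ q, q ∣ N ∧ q ^ s ≤ N ∧
      N.divisors.card ≤ s ^ (s * s) * q.divisors.card ^ s := by
  classical
  set e : ℕ → ℕ := fun p => N.factorization p
  set P := N.primeFactors.filter fun p => e p < s
  have hpp : ∀ p ∈ N.primeFactors, p.Prime := fun p hp => Nat.prime_of_mem_primeFactors hp
  obtain ⟨T, hTP, hT1, hT2⟩ := exists_subset_pow_prod_le s (by omega) e (fun p => p ^ e p) _ P rfl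
    (fun i hi => (Finset.mem_filter.1 hi).2)
    (fun i hi => Nat.one_le_pow _ _ (hpp i (Finset.mem_filter.1 hi).1).pos)
  set b : ℕ → ℕ := fun p => if e p < s then (if p ∈ T then e p else 0) else e p / s
  have hb : ∀ p, b p ≤ e p := by
    intro p; simp only [b]; split_ifs
    exacts [le_rfl, Nat.zero_le _, Nat.div_le_self _ _]
  have hcard : ∀ c : ℕ → ℕ, (∏ p ∈ N.primeFactors, p ^ c p).divisors.card
      = ∏ p ∈ N.primeFactors, (c p + 1) := by
    intro c
    rw [← ArithmeticFunction.sigma_zero_apply,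
      ArithmeticFunction.isMultiplicative_sigma.map_prod]
    · refine Finset.prod_congr rfl fun p hp => ?_
      rw [ArithmeticFunction.sigma_zero_apply_prime_pow (hpp p hp)]
    · intro p hp q hq hpq
      exact Nat.coprime_pow_primes _ _ (hpp p hp) (hpp q hq) hpq
  have hNe : ∏ p ∈ N.primeFactors, p ^ e p = N := Nat.prod_factorization_pow_eq_self hN
  have hP1 : ∀ g : ℕ → ℕ, ∏ p ∈ P, (if p ∈ T then g p else 1) = ∏ p ∈ T, g p := by
    intro g
    rw [← Finset.prod_filter, Finset.filter_mem_eq_inter, Finset.inter_eq_right.2 hTP]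
  have hsplit : ∀ g : ℕ → ℕ, ∏ p ∈ N.primeFactors, g p
      = (∏ p ∈ P, g p) * ∏ p ∈ N.primeFactors.filter (fun p => ¬ e p < s), g p := by
    intro g; rw [Finset.prod_filter_mul_prod_filter_not]
  have hbP : ∀ p ∈ P, b p = if p ∈ T then e p else 0 := by
    intro p hp; simp only [b, if_pos (Finset.mem_filter.1 hp).2]
  refine ⟨∏ p ∈ N.primeFactors, p ^ b p, ?_, ?_, ?_⟩
  · conv_rhs => rw [← hNe]
    exact Finset.prod_dvd_prod_of_dvd _ _ fun p _ => pow_dvd_pow _ (hb p)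
  · conv_rhs => rw [← hNe]
    rw [hsplit, hsplit, mul_pow]
    refine Nat.mul_le_mul ?_ ?_
    · refine le_trans (le_of_eq ?_) hT1
      congr 1
      rw [← hP1]
      refine Finset.prod_congr rfl fun p hp => ?_
      rw [hbP p hp]; split_ifs <;> simp
    · rw [← Finset.prod_pow]
      refine Finset.prod_le_prod' fun p hp => ?_
      rw [← pow_mul]
      refine Nat.pow_le_pow_right (hpp p (Finset.mem_filter.1 hp).1).pos ?_
      simp only [b, if_neg (Finset.mem_filter.1 hp).2]
      exact Nat.div_mul_le_self _ _
  · conv_lhs => rw [← hNe]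
    rw [hcard, hcard, hsplit, hsplit, mul_pow, ← mul_assoc]
    refine Nat.mul_le_mul ?_ ?_
    · refine hT2.trans (le_of_eq ?_)
      congr 2
      rw [← hP1]
      refine Finset.prod_congr rfl fun p hp => ?_
      rw [hbP p hp]; split_ifs <;> simp
    · rw [← Finset.prod_pow]
      refine Finset.prod_le_prod' fun p hp => ?_
      have h := (Finset.mem_filter.1 hp).2
      simp only [b, if_neg h]
      exact add_one_le_pow_div s _ hs (not_lt.1 h)

end

/-! ### Residue classes under the coefficient weights -/

noncomputable section

theorem card_modEq_le {u v : ℝ} {q : ℕ} (hq : 0 < q) (huv : u ≤ v) (r : ℤ) :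
    (((Finset.Icc ⌈u⌉ ⌊v⌋).filter fun c => c ≡ r [ZMOD q]).card : ℝ) ≤ (v - u) / q + 2 := by
  have hq' : (0 : ℝ) < q := by exact_mod_cast hq
  have hI : Finset.Icc ⌈u⌉ ⌊v⌋ = Finset.Ioc (⌈u⌉ - 1) ⌊v⌋ := by
    ext c; simp only [Finset.mem_Icc, Finset.mem_Ioc]; omega
  have h := Int.Ioc_filter_modEq_card (⌈u⌉ - 1) ⌊v⌋ (r := (q : ℤ)) (by exact_mod_cast hq) r
  rw [hI, ← Int.cast_natCast, h]
  push_cast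
  refine max_le ?_ (by have : 0 ≤ (v - u) / q := div_nonneg (by linarith) hq'.le
                       linarith)
  have h1 : ((⌊(((⌊v⌋ : ℤ) : ℚ) - r) / (q : ℚ)⌋ : ℤ) : ℝ) ≤ ((⌊v⌋ : ℝ) - r) / q := by
    have := Int.floor_le ((((⌊v⌋ : ℤ) : ℚ) - r) / (q : ℚ))
    exact_mod_cast this
  have h2 : (((⌈u⌉ : ℝ) - 1) - r) / q - 1
      < ((⌊((((⌈u⌉ : ℤ) : ℚ) - 1) - r) / (q : ℚ)⌋ : ℤ) : ℝ) := by
    have := Int.sub_one_lt_floor (((((⌈u⌉ : ℤ) : ℚ) - 1) - r) / (q : ℚ))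
    exact_mod_cast this
  have h3 : ((⌊v⌋ : ℝ) - r) / q - (((⌈u⌉ : ℝ) - 1) - r) / q ≤ (v - u) / q + 1 / q := by
    rw [← sub_div, ← add_div]
    gcongr
    linarith [Int.floor_le v, Int.le_ceil u]
  have h4 : (1 : ℝ) / q ≤ 1 := by
    rw [div_le_one hq']; exact_mod_cast hq
  linarith

/-- Weights on `ℤ` dominated by `min(1, β₀ (H / (1 + |n|))^β)`. -/
structure IsWeight (k : ℤ → ℝ) (H β₀ β : ℝ) : Prop where
  nonneg : ∀ n, 0 ≤ k n
  le_one : ∀ n, k n ≤ 1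
  decay : ∀ n : ℤ, k n ≤ β₀ * (H / (1 + |(n : ℝ)|)) ^ β

/-- The measure on `ℤ` with mass `k n` at `n`. -/
def wMeasure (k : ℤ → ℝ) : Measure ℤ := Measure.count.withDensity fun n => ENNReal.ofReal (k n)

theorem wMeasure_singleton (k : ℤ → ℝ) (n : ℤ) : wMeasure k {n} = ENNReal.ofReal (k n) := by
  rw [wMeasure, withDensity_apply _ (measurableSet_singleton n)]
  simp

/-- Cut `ℤ` into blocks `iH ≤ |n| ≤ (i+1)H`. Each meets the class in `≪ H/q + 2` points, which is `≪
H/q` because `q ≤ cH`, and the weight there is `≪ i^(-β)`, summable since `β > 1`. -/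
theorem exists_wMeasure_modEq_le (β₀ β c : ℝ) (hβ₀ : 0 < β₀) (hβ : 1 < β) (hc : 1 ≤ c) :
    ∃ L : ℝ, 1 ≤ L ∧ ∀ (k : ℤ → ℝ) (H : ℝ), 1 ≤ H → IsWeight k H β₀ β →
      ∀ (q : ℕ) (r : ℤ), 0 < q → (q : ℝ) ≤ c * H →
        wMeasure k {n | n ≡ r [ZMOD q]} ≤ ENNReal.ofReal (L * H / q) := by
  set Φ : ℕ → ℝ := fun i => if i = 0 then 1 else β₀ * ((i : ℝ) ^ β)⁻¹
  have hΦ0 : ∀ i, 0 ≤ Φ i := by intro i; simp only [Φ]; split_ifs <;> positivity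
  have hΦs : Summable Φ := by
    have h1 : Summable fun i : ℕ => β₀ * ((i : ℝ) ^ β)⁻¹ :=
      (Real.summable_nat_rpow_inv.2 hβ).mul_left _
    refine h1.congr_cofinite ?_
    have : ({0}ᶜ : Set ℕ) ∈ cofinite := by simp
    filter_upwards [this] with i hi
    have : i ≠ 0 := hi
    simp [Φ, this]
  refine ⟨2 * (1 + 2 * c) * ∑' i, Φ i, ?_, ?_⟩
  · have : Φ 0 ≤ ∑' i, Φ i := hΦs.le_tsum 0 fun i _ => hΦ0 i
    simp only [Φ, if_true] at this
    nlinarith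
  intro k H hH hk q r hq hqH
  have hq' : (0 : ℝ) < q := by exact_mod_cast hq
  have hH0 : 0 < H := by linarith
  set S : ℕ → Finset ℤ := fun i =>
    (Finset.Icc ⌈(i : ℝ) * H⌉ ⌊((i : ℝ) + 1) * H⌋).filter (fun n => n ≡ r [ZMOD q]) ∪
    (Finset.Icc ⌈-(((i : ℝ) + 1) * H)⌉ ⌊-((i : ℝ) * H)⌋).filter (fun n => n ≡ r [ZMOD q])
  have hcov : {n : ℤ | n ≡ r [ZMOD q]} ⊆ ⋃ i, (S i : Set ℤ) := by
    intro n hn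
    have hn' : n ≡ r [ZMOD q] := hn
    refine Set.mem_iUnion.2 ⟨⌊|(n : ℝ)| / H⌋₊, ?_⟩
    have h1 := Nat.floor_le (show 0 ≤ |(n : ℝ)| / H by positivity)
    have h2 := Nat.lt_floor_add_one (|(n : ℝ)| / H)
    rw [le_div_iff₀ hH0] at h1
    rw [div_lt_iff₀ hH0] at h2
    simp only [S, Finset.coe_union, Set.mem_union, Finset.mem_coe, Finset.mem_filter,
      Finset.mem_Icc, Int.ceil_le, Int.le_floor]
    rcases le_total 0 (n : ℝ) with h | h
    · rw [abs_of_nonneg h] at *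
      exact Or.inl ⟨⟨h1, h2.le⟩, hn'⟩
    · rw [abs_of_nonpos h] at *
      exact Or.inr ⟨⟨by linarith, by linarith⟩, hn'⟩
  have hScard : ∀ i, ((S i).card : ℝ) ≤ 2 * (H / q + 2) := by
    intro i
    have h1 := card_modEq_le (u := (i : ℝ) * H) (v := ((i : ℝ) + 1) * H) hq (by nlinarith) r
    have h2 := card_modEq_le (u := -(((i : ℝ) + 1) * H)) (v := -((i : ℝ) * H)) hq (by nlinarith) r
    refine (Nat.cast_le.2 (Finset.card_union_le _ _)).trans ?_
    push_cast
    refine (add_le_add h1 h2).trans (le_of_eq ?_)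
    ring
  have hSk : ∀ i, ∀ n ∈ S i, k n ≤ Φ i := by
    intro i n hn
    simp only [Φ]
    split_ifs with hi
    · exact hk.le_one n
    · refine (hk.decay n).trans ?_
      have hi' : (0 : ℝ) < i := by exact_mod_cast Nat.pos_of_ne_zero hi
      have habs : (i : ℝ) * H ≤ |(n : ℝ)| := by
        simp only [S, Finset.mem_union, Finset.mem_filter,
          Finset.mem_Icc, Int.ceil_le, Int.le_floor] at hn
        rcases hn with hn | hn
        · exact hn.1.1.trans (le_abs_self _)
        · linarith [hn.1.2, neg_le_abs (n : ℝ)]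
      rw [← Real.inv_rpow hi'.le]
      gcongr
      rw [div_le_iff₀ (by positivity)]
      calc H = (i : ℝ)⁻¹ * (i * H) := by field_simp
        _ ≤ _ := by gcongr; linarith
  have hS : ∀ i, wMeasure k (S i) ≤ ENNReal.ofReal (2 * (H / q + 2) * Φ i) := by
    intro i
    rw [← sum_measure_singleton]
    simp_rw [wMeasure_singleton]
    rw [← ENNReal.ofReal_sum_of_nonneg fun n _ => hk.nonneg n]
    refine ENNReal.ofReal_le_ofReal ?_
    calc ∑ n ∈ S i, k n ≤ (S i).card • Φ i := Finset.sum_le_card_nsmul _ _ _ (hSk i)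
      _ = (S i).card * Φ i := by rw [nsmul_eq_mul]
      _ ≤ _ := mul_le_mul_of_nonneg_right (hScard i) (hΦ0 i)
  calc wMeasure k {n | n ≡ r [ZMOD q]} ≤ wMeasure k (⋃ i, (S i : Set ℤ)) := measure_mono hcov
    _ ≤ ∑' i, wMeasure k (S i) := measure_iUnion_le _
    _ ≤ ∑' i, ENNReal.ofReal (2 * (H / q + 2) * Φ i) := ENNReal.tsum_le_tsum hS
    _ = ENNReal.ofReal (∑' i, 2 * (H / q + 2) * Φ i) :=
        (ENNReal.ofReal_tsum_of_nonneg
          (fun i => mul_nonneg (by positivity) (hΦ0 i)) (hΦs.mul_left _)).symm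
    _ ≤ _ := by
        refine ENNReal.ofReal_le_ofReal ?_
        rw [tsum_mul_left]
        have h1 : (1 : ℝ) ≤ c * H / q := by rw [le_div_iff₀ hq']; linarith
        have h0 : 0 ≤ ∑' i, Φ i := tsum_nonneg hΦ0
        have h2 : 2 * (H / q + 2) ≤ 2 * (1 + 2 * c) * H / q := by
          have : 2 * (1 + 2 * c) * H / q = 2 * (H / q) + 4 * (c * H / q) := by ring
          linarith
        calc 2 * (H / q + 2) * ∑' i, Φ i ≤ (2 * (1 + 2 * c) * H / q) * ∑' i, Φ i := by gcongr
          _ = _ := by ring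

/-- The product measure on the coefficient vectors of binary forms of degree `e`. -/
def coeffMeasure (k : ℤ → ℝ) (e : ℕ) : Measure (Fin (e + 1) → ℤ) :=
  Measure.pi fun _ => wMeasure k

/-- Evaluation of a form modulo `q`. -/
def evalMod (q e : ℕ) (a b : ℤ) : (Fin (e + 1) → ZMod q) →+ ZMod q where
  toFun r := ∑ k : Fin (e + 1), r k * (a : ZMod q) ^ (k : ℕ) * (b : ZMod q) ^ (e - (k : ℕ))
  map_zero' := by simp
  map_add' r s := by
    rw [← Finset.sum_add_distrib]
    exact Finset.sum_congr rfl fun k _ => by simp only [Pi.add_apply]; ring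

theorem evalMod_single (q e : ℕ) (a b : ℤ) (i : Fin (e + 1)) (y : ZMod q) :
    evalMod q e a b (Pi.single i y) = y * (a : ZMod q) ^ (i : ℕ) * (b : ZMod q) ^ (e - (i : ℕ)) := by
  change ∑ k : Fin (e + 1), _ = _
  rw [Finset.sum_eq_single i]
  · simp
  · intro k _ hk; simp [Pi.single_eq_of_ne hk]
  · simp

/-- The extreme coefficients suffice, by a Bézout relation between `a^e` and `b^e`. -/
theorem evalMod_surjective (q e : ℕ) {a b : ℤ} (hab : IsCoprime a b) :
    Function.Surjective (evalMod q e a b) := by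
  intro z
  obtain ⟨u, v, huv⟩ := hab.pow (m := e) (n := e)
  refine ⟨Pi.single (Fin.last e) (z * u) + Pi.single 0 (z * v), ?_⟩
  rw [map_add, evalMod_single, evalMod_single]
  have : (u : ZMod q) * (a : ZMod q) ^ e + v * (b : ZMod q) ^ e = 1 := by
    exact_mod_cast congrArg (Int.cast : ℤ → ZMod q) huv
  simp only [Fin.val_last, Nat.sub_self, pow_zero, mul_one, Fin.val_zero, Nat.sub_zero]
  linear_combination z * this

theorem card_ker_evalMod (q e : ℕ) (hq : 0 < q) {a b : ℤ} (hab : IsCoprime a b) :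
    Nat.card (evalMod q e a b).ker = q ^ e := by
  have : NeZero q := ⟨hq.ne'⟩
  have h := AddSubgroup.card_mul_index (evalMod q e a b).ker
  rw [AddSubgroup.index_ker, AddMonoidHom.range_eq_top.2 (evalMod_surjective q e hab),
    AddSubgroup.card_top, Nat.card_zmod, Nat.card_fun, Nat.card_zmod, Nat.card_fin, pow_succ] at h
  exact Nat.eq_of_mul_eq_mul_right hq h

/-- The condition confines the coefficients to the `q^e` vectors of the kernel of evaluation modulo
`q`. Each of these residue vectors has mass at most `(LH/q)^(e+1)`, so a factor `1/q` survives. -/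
theorem coeffMeasure_dvd_le {k : ℤ → ℝ} {H L : ℝ} {q e : ℕ} (hq : 0 < q)
    (hH : 1 ≤ H) (hL : 1 ≤ L) [SigmaFinite (wMeasure k)]
    (hk : ∀ r : ℤ, wMeasure k {n | n ≡ r [ZMOD q]} ≤ ENNReal.ofReal (L * H / q))
    {a b : ℤ} (hab : IsCoprime a b) :
    coeffMeasure k e {c | (q : ℤ) ∣ evalForm c (a, b)} ≤ ENNReal.ofReal ((L * H) ^ (e + 1) / q) := by
  classical
  have : NeZero q := ⟨hq.ne'⟩
  have hq' : (0 : ℝ) < q := by exact_mod_cast hq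
  set R : Finset (Fin (e + 1) → ZMod q) := Finset.univ.filter fun r => evalMod q e a b r = 0
  have hR : R.card = q ^ e := by
    rw [← card_ker_evalMod q e hq hab, Nat.card_eq_fintype_card, Fintype.card_subtype]
    congr 1
    ext r
    simp [R, AddMonoidHom.mem_ker]
  have hcov : {c : Fin (e + 1) → ℤ | (q : ℤ) ∣ evalForm c (a, b)} ⊆
      ⋃ r ∈ R, Set.univ.pi fun i => {n : ℤ | n ≡ (r i).cast [ZMOD q]} := by
    intro c hc
    simp only [Set.mem_iUnion, Set.mem_pi, Set.mem_univ, true_implies, Set.mem_ofPred_eq]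
    refine ⟨fun i => (c i : ZMod q), ?_, fun i => ?_⟩
    · simp only [R, Finset.mem_filter, Finset.mem_univ, true_and]
      have := (ZMod.intCast_zmod_eq_zero_iff_dvd _ _).2 hc
      simp only [evalForm] at this
      push_cast at this
      exact this
    · rw [← ZMod.intCast_eq_intCast_iff, ZMod.intCast_zmod_cast]
  calc _ ≤ coeffMeasure k e (⋃ r ∈ R, Set.univ.pi fun i => {n : ℤ | n ≡ (r i).cast [ZMOD q]}) :=
        measure_mono hcov
    _ ≤ ∑ r ∈ R, coeffMeasure k e (Set.univ.pi fun i => {n : ℤ | n ≡ (r i).cast [ZMOD q]}) :=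
        measure_biUnion_finset_le _ _
    _ ≤ ∑ r ∈ R, ENNReal.ofReal (L * H / q) ^ (e + 1) := by
        refine Finset.sum_le_sum fun r _ => ?_
        rw [coeffMeasure, Measure.pi_pi]
        exact (Finset.prod_le_prod' fun i _ => hk _).trans (by simp)
    _ = ENNReal.ofReal ((L * H) ^ (e + 1) / q) := by
        rw [Finset.sum_const, hR, nsmul_eq_mul, ← ENNReal.ofReal_pow (by positivity),
          ← ENNReal.ofReal_natCast, ← ENNReal.ofReal_mul (by positivity)]
        congr 1
        push_cast
        rw [div_pow, pow_succ (q : ℝ)]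
        field_simp

end

/-! ### Mean square of the divisor weight of a random value -/

noncomputable section

/-- `log H` may be less than `1`, so raising its exponent costs a constant; `H ≥ 2` keeps it away
from `0`. -/
theorem exists_log_pow_le (a γ : ℝ) (h : a ≤ γ) :
    ∃ K : ℝ, 0 < K ∧ ∀ H : ℝ, 2 ≤ H → Real.log H ^ a ≤ K * Real.log H ^ γ := by
  have h2 : 0 < Real.log 2 := Real.log_pos (by norm_num)
  refine ⟨Real.log 2 ^ (a - γ), by positivity, fun H hH => ?_⟩
  have hl : Real.log 2 ≤ Real.log H := Real.log_le_log (by norm_num) hH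
  have hl0 : 0 < Real.log H := h2.trans_le hl
  have := Real.rpow_le_rpow_of_nonpos h2 hl (show a - γ ≤ 0 by linarith)
  calc Real.log H ^ a = Real.log H ^ (a - γ) * Real.log H ^ γ := by
        rw [← Real.rpow_add hl0]; ring_nf
    _ ≤ _ := by gcongr

theorem exists_one_add_log_pow_le (c : ℝ) (hc : 1 ≤ c) (M : ℕ) (γ : ℝ) (h : (M : ℝ) ≤ γ) :
    ∃ K : ℝ, 0 < K ∧ ∀ H : ℝ, 2 ≤ H → (1 + Real.log (c * H)) ^ M ≤ K * Real.log H ^ γ := by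
  have h2 : 0 < Real.log 2 := Real.log_pos (by norm_num)
  have hc0 : 0 ≤ Real.log c := Real.log_nonneg hc
  obtain ⟨K, hK, hK'⟩ := exists_log_pow_le M γ h
  refine ⟨(1 + (1 + Real.log c) / Real.log 2) ^ M * K, by positivity, fun H hH => ?_⟩
  have hl : Real.log 2 ≤ Real.log H := Real.log_le_log (by norm_num) hH
  have hl0 : 0 < Real.log H := h2.trans_le hl
  have h1 : 1 + Real.log (c * H) ≤ (1 + (1 + Real.log c) / Real.log 2) * Real.log H := by
    rw [Real.log_mul (by positivity) (by positivity)]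
    have : 1 + Real.log c ≤ (1 + Real.log c) / Real.log 2 * Real.log H := by
      rw [div_mul_eq_mul_div, le_div_iff₀ h2]; gcongr
    linarith
  have h0 : 0 ≤ 1 + Real.log (c * H) := by
    have := Real.log_nonneg (show 1 ≤ c * H by nlinarith)
    linarith
  calc (1 + Real.log (c * H)) ^ M
      ≤ ((1 + (1 + Real.log c) / Real.log 2) * Real.log H) ^ M := by gcongr
    _ = (1 + (1 + Real.log c) / Real.log 2) ^ M * Real.log H ^ (M : ℝ) := by
        rw [mul_pow, Real.rpow_natCast]
    _ ≤ (1 + (1 + Real.log c) / Real.log 2) ^ M * (K * Real.log H ^ γ) := by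
        gcongr; exact hK' H hH
    _ = _ := by ring

/-- `τ(|v|)^C`, with the value `1` at `v = 0`. -/
def divWeight (C : ℝ) (v : ℤ) : ℝ := if v = 0 then 1 else ((v.natAbs.divisors.card : ℕ) : ℝ) ^ C

theorem one_le_card_divisors {n : ℕ} (hn : n ≠ 0) : 1 ≤ n.divisors.card :=
  Finset.card_pos.2 (Nat.nonempty_divisors.2 hn)

theorem one_le_divWeight {C : ℝ} (hC : 0 ≤ C) (v : ℤ) : 1 ≤ divWeight C v := by
  rw [divWeight]
  split_ifs with h
  · exact le_rfl
  · exact Real.one_le_rpow (by exact_mod_cast one_le_card_divisors (Int.natAbs_ne_zero.2 h)) hC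

theorem card_divisors_mul_le (a b : ℕ) :
    (a * b).divisors.card ≤ a.divisors.card * b.divisors.card := by
  rw [Nat.divisors_mul]; exact Finset.card_mul_le

theorem card_divisors_pow_le (a e : ℕ) : (a ^ e).divisors.card ≤ a.divisors.card ^ e := by
  induction e with
  | zero => simp
  | succ e ih =>
    rw [pow_succ, pow_succ]
    exact (card_divisors_mul_le _ _).trans (Nat.mul_le_mul_right _ ih)

/-- The size condition on `v` forces the divisor `q` with `q^s ≤ |v|` from
`exists_dvd_pow_le_card_divisors_le` to satisfy `q ≤ Q`, and `τ(q)^(2Cs)` is at most `kDiv M q`.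
Extending to all divisors `q ≤ Q` makes the bound linear in divisibility events. For `v = 0` the
term `q = 1` suffices. -/
theorem divWeight_sq_le {C : ℝ} (hC : 0 ≤ C) {s : ℕ} (hs : 2 ≤ s) {M : ℕ}
    (hM : (2 : ℝ) ^ (2 * C * s) ≤ M) {g : ℕ} (hg : g ≠ 0) (e : ℕ) (v : ℤ) {Q : ℕ} (hQ : 1 ≤ Q)
    (hv : v.natAbs < (Q + 1) ^ s) :
    divWeight C ((g : ℤ) ^ e * v) ^ 2 ≤ ((s ^ (s * s) : ℕ) : ℝ) ^ (2 * C) *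
      (g.divisors.card : ℝ) ^ (2 * C * e) *
        ∑ q ∈ Finset.Ioc 0 Q, if (q : ℤ) ∣ v then (kDiv M q : ℝ) else 0 := by
  have hs1 : (1 : ℝ) ≤ ((s ^ (s * s) : ℕ) : ℝ) := by
    exact_mod_cast Nat.one_le_pow _ _ (by omega)
  have hg1 : (1 : ℝ) ≤ (g.divisors.card : ℝ) := by exact_mod_cast one_le_card_divisors hg
  have hK1 : 1 ≤ ((s ^ (s * s) : ℕ) : ℝ) ^ (2 * C) := Real.one_le_rpow hs1 (by positivity)
  have hK2 : 1 ≤ (g.divisors.card : ℝ) ^ (2 * C * e) := Real.one_le_rpow hg1 (by positivity)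
  have hterm : ∀ q ∈ Finset.Ioc 0 Q, 0 ≤ if (q : ℤ) ∣ v then (kDiv M q : ℝ) else 0 := by
    intro q _; split_ifs <;> positivity
  rcases eq_or_ne v 0 with rfl | hv0
  · rw [mul_zero, divWeight, if_pos rfl, one_pow]
    have h1 : (1 : ℝ) ≤ ∑ q ∈ Finset.Ioc 0 Q, if (q : ℤ) ∣ 0 then (kDiv M q : ℝ) else 0 := by
      refine le_trans ?_ (Finset.single_le_sum hterm
        (show 1 ∈ Finset.Ioc 0 Q from Finset.mem_Ioc.2 ⟨one_pos, hQ⟩))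
      simp [kDiv_one]
    exact one_le_mul_of_one_le_of_one_le (one_le_mul_of_one_le_of_one_le hK1 hK2) h1
  · have hn0 : v.natAbs ≠ 0 := Int.natAbs_ne_zero.2 hv0
    obtain ⟨q, hqd, hqs, hqτ⟩ := exists_dvd_pow_le_card_divisors_le s hs v.natAbs hn0
    have hq0 : q ≠ 0 := fun h => hn0 (by simpa [h] using hqd)
    have hqQ : q ≤ Q := by
      by_contra hlt
      have : (Q + 1) ^ s ≤ q ^ s := Nat.pow_le_pow_left (by omega) s
      omega
    have hτ : ((((g : ℤ) ^ e * v).natAbs.divisors.card : ℕ) : ℝ) ≤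
        (g.divisors.card : ℝ) ^ e * (((s ^ (s * s) : ℕ) : ℝ) * (q.divisors.card : ℝ) ^ s) := by
      rw [Int.natAbs_mul, Int.natAbs_pow, Int.natAbs_natCast]
      exact_mod_cast (card_divisors_mul_le _ _).trans
        (Nat.mul_le_mul (card_divisors_pow_le g e) hqτ)
    rw [divWeight, if_neg (mul_ne_zero (pow_ne_zero _ (by exact_mod_cast hg)) hv0)]
    calc (((((g : ℤ) ^ e * v).natAbs.divisors.card : ℕ) : ℝ) ^ C) ^ 2
        = ((((g : ℤ) ^ e * v).natAbs.divisors.card : ℕ) : ℝ) ^ (2 * C) := by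
          rw [← Real.rpow_natCast, ← Real.rpow_mul (by positivity)]; congr 1; push_cast; ring
      _ ≤ ((g.divisors.card : ℝ) ^ e * (((s ^ (s * s) : ℕ) : ℝ) * (q.divisors.card : ℝ) ^ s))
            ^ (2 * C) := Real.rpow_le_rpow (by positivity) hτ (by positivity)
      _ = ((s ^ (s * s) : ℕ) : ℝ) ^ (2 * C) * (g.divisors.card : ℝ) ^ (2 * C * e) *
            (q.divisors.card : ℝ) ^ (2 * C * s) := by
          rw [Real.mul_rpow (by positivity) (by positivity),
            Real.mul_rpow (by positivity) (by positivity),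
            ← Real.rpow_natCast (g.divisors.card : ℝ), ← Real.rpow_natCast (q.divisors.card : ℝ),
            ← Real.rpow_mul (by positivity), ← Real.rpow_mul (by positivity),
            mul_comm (e : ℝ), mul_comm (s : ℝ)]
          ring
      _ ≤ _ := by
          refine mul_le_mul_of_nonneg_left ?_ (by positivity)
          refine (card_divisors_rpow_le (by positivity) hM hq0).trans ?_
          refine le_trans (le_of_eq ?_) (Finset.single_le_sum hterm
            (show q ∈ Finset.Ioc 0 Q from Finset.mem_Ioc.2 ⟨Nat.pos_of_ne_zero hq0, hqQ⟩))
          rw [if_pos (Int.natCast_dvd.2 hqd)]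

theorem evalForm_smul {e : ℕ} (c : Fin (e + 1) → ℤ) (g a b : ℤ) :
    evalForm c (g * a, g * b) = g ^ e * evalForm c (a, b) := by
  simp only [evalForm, Finset.mul_sum]
  refine Finset.sum_congr rfl fun k _ => ?_
  have : g ^ e = g ^ (k : ℕ) * g ^ (e - (k : ℕ)) := by
    rw [← pow_add]; congr 1; have := k.2; omega
  rw [this, mul_pow, mul_pow]; ring

theorem evalForm_zero {e : ℕ} (he : 1 ≤ e) (c : Fin (e + 1) → ℤ) : evalForm c (0, 0) = 0 := by
  refine Finset.sum_eq_zero fun k _ => ?_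
  rcases Nat.eq_zero_or_pos (k : ℕ) with h | h
  · simp [h, zero_pow (show e ≠ 0 by omega)]
  · simp [zero_pow h.ne']

/-- The square of the divisor weight of the value of a form, truncated at `X`. -/
def truncSq (C X : ℝ) (v : ℤ) : ℝ := if |(v : ℝ)| ≤ X then divWeight C v ^ 2 else 0

theorem truncSq_nonneg (C X : ℝ) (v : ℤ) : 0 ≤ truncSq C X v := by
  rw [truncSq]; split_ifs <;> positivity

theorem setOf_modEq_one (r : ℤ) : {n : ℤ | n ≡ r [ZMOD ((1 : ℕ) : ℤ)]} = Set.univ := by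
  ext n; simp [Int.modEq_one]

/-- Integrate `divWeight_sq_le` over the forms: `q ∣ F(a, b)` has mass at most `(LH)^(e+1)/q`, and
the sum of `kDiv M q / q` over `q ≤ Q` is a power of a logarithm. -/
theorem exists_integral_truncSq_le (β₀ β C : ℝ) (hβ₀ : 0 < β₀) (hβ : 1 < β) (hC : 0 ≤ C)
    (e : ℕ) (he : 1 ≤ e) :
    ∃ A : ℝ, 0 < A ∧ ∀ (k : ℤ → ℝ) (x H : ℝ), 1 ≤ x → x ≤ H → 2 ≤ H → IsWeight k H β₀ β →
      ∀ (g : ℕ) (a b : ℤ), g ≠ 0 → (IsCoprime a b ∨ a = 0 ∧ b = 0) →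
        ∫ c, truncSq C ((1 + e) * x ^ e * H) (evalForm c (g * a, g * b)) ∂coeffMeasure k e
          ≤ A * (H ^ (e + 1) * Real.log H ^ ((2 : ℝ) ^ (2 * C * (e + 2) + 1))
              * (g.divisors.card : ℝ) ^ (2 * C * e)) := by
  obtain ⟨L, hL, hLk⟩ := exists_wMeasure_modEq_le β₀ β (1 + e) hβ₀ hβ
    (by linarith [(Nat.cast_nonneg e : (0 : ℝ) ≤ e)])
  -- Since `x ≤ H`, values up to `(1+e) x^e H` are at most `((1+e)H)^(e+2)`. With this `s` only
  -- divisors `q ≤ (1+e)H` occur, the range in which residue classes are controlled.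
  set s := e + 2
  set M := ⌈(2 : ℝ) ^ (2 * C * s)⌉₊
  have hM : (2 : ℝ) ^ (2 * C * s) ≤ M := Nat.le_ceil _
  have hMγ : (M : ℝ) ≤ (2 : ℝ) ^ (2 * C * (e + 2) + 1) := by
    have h1 : (1 : ℝ) ≤ (2 : ℝ) ^ (2 * C * s) := Real.one_le_rpow (by norm_num) (by positivity)
    have h2 := (Nat.ceil_lt_add_one (show 0 ≤ (2 : ℝ) ^ (2 * C * s) by positivity)).le
    rw [Real.rpow_add (by norm_num), Real.rpow_one]
    have h3 : (2 : ℝ) ^ (2 * C * s) = (2 : ℝ) ^ (2 * C * (e + 2)) := by simp [s]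
    rw [← h3]; linarith
  obtain ⟨K, hK, hKH⟩ := exists_one_add_log_pow_le (1 + e)
    (by linarith [(Nat.cast_nonneg e : (0 : ℝ) ≤ e)]) M _ hMγ
  set D := ((s ^ (s * s) : ℕ) : ℝ) ^ (2 * C)
  have hD : 1 ≤ D := Real.one_le_rpow (by exact_mod_cast Nat.one_le_pow _ _ (by omega))
    (by positivity)
  refine ⟨D * L ^ (e + 1) * K, by positivity, ?_⟩
  intro k x H hx hxH hH hk g a b hg hab
  have hH1 : 1 ≤ H := by linarith
  have he0 : (0 : ℝ) ≤ e := Nat.cast_nonneg e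
  have hfin : IsFiniteMeasure (wMeasure k) := by
    refine ⟨?_⟩
    have h1 := hLk k H hH1 hk 1 0 one_pos (by push_cast; nlinarith)
    rw [setOf_modEq_one] at h1
    exact h1.trans_lt ENNReal.ofReal_lt_top
  have hfin' : IsFiniteMeasure (coeffMeasure k e) := by rw [coeffMeasure]; infer_instance
  set τ := (g.divisors.card : ℝ) ^ (2 * C * e)
  have hτ : 1 ≤ τ :=
    Real.one_le_rpow (by exact_mod_cast one_le_card_divisors hg) (by positivity)
  set Q := ⌊(1 + e) * H⌋₊
  have hQ : 1 ≤ Q := Nat.le_floor (by push_cast; nlinarith)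
  have hQH : (Q : ℝ) ≤ (1 + e) * H := Nat.floor_le (by positivity)
  have hlogQ : (1 + Real.log Q) ^ M ≤ K * Real.log H ^ ((2 : ℝ) ^ (2 * C * (e + 2) + 1)) := by
    refine le_trans ?_ (hKH H hH)
    have : (0 : ℝ) < Q := by exact_mod_cast hQ
    have := one_le_one_add_log Q
    gcongr
  have hone : 1 ≤ (1 + Real.log Q) ^ M := one_le_pow₀ (one_le_one_add_log Q)
  rcases hab with hab | ⟨rfl, rfl⟩
  · have hpt : ∀ c : Fin (e + 1) → ℤ,
        truncSq C ((1 + e) * x ^ e * H) (evalForm c (g * a, g * b)) ≤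
          D * τ * ∑ q ∈ Finset.Ioc 0 Q,
            if (q : ℤ) ∣ evalForm c (a, b) then (kDiv M q : ℝ) else 0 := by
      intro c
      rw [truncSq]
      split_ifs with hle
      · rw [evalForm_smul] at hle ⊢
        refine divWeight_sq_le hC (by omega) hM hg e _ hQ ?_
        have hg1 : (1 : ℝ) ≤ (g : ℝ) ^ e := one_le_pow₀ (by exact_mod_cast Nat.pos_of_ne_zero hg)
        have h1 : ((evalForm c (a, b)).natAbs : ℝ) ≤ (1 + e) * x ^ e * H := by
          push_cast [Nat.cast_natAbs] at hle ⊢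
          rw [abs_mul, abs_of_nonneg (by positivity)] at hle
          refine le_trans ?_ hle
          exact le_mul_of_one_le_left (abs_nonneg _) hg1
        have h2 : (1 + e) * H < Q + 1 := Nat.lt_floor_add_one _
        have h3 : (1 + e) * x ^ e * H ≤ ((1 + e) * H) ^ s := by
          calc (1 + e) * x ^ e * H ≤ ((1 + e) * H) * ((1 + e) * H) ^ e * ((1 + e) * H) := by
                have hb : x ≤ (1 + e) * H := by nlinarith
                have hb' : (1 + (e : ℝ)) ≤ (1 + e) * H := by nlinarith
                have hb'' : H ≤ (1 + (e : ℝ)) * H := by nlinarith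
                gcongr
            _ = _ := by ring
        have h4 : ((1 + e) * H) ^ s < ((Q : ℝ) + 1) ^ s :=
          pow_lt_pow_left₀ h2 (by positivity) (by omega)
        exact_mod_cast (h1.trans h3).trans_lt h4
      · refine mul_nonneg (by positivity) (Finset.sum_nonneg fun q _ => ?_)
        split_ifs <;> positivity
    have hint : ∀ q : ℕ, Integrable (fun c : Fin (e + 1) → ℤ =>
        if (q : ℤ) ∣ evalForm c (a, b) then (kDiv M q : ℝ) else 0) (coeffMeasure k e) := by
      intro q
      refine Integrable.of_bound (C := kDiv M q) (Measurable.of_discrete).aestronglyMeasurable ?_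
      refine Eventually.of_forall fun c => ?_
      split_ifs <;> simp
    calc _ ≤ ∫ c, D * τ * ∑ q ∈ Finset.Ioc 0 Q,
            (if (q : ℤ) ∣ evalForm c (a, b) then (kDiv M q : ℝ) else 0) ∂coeffMeasure k e := by
          refine integral_mono_of_nonneg (Eventually.of_forall fun c => truncSq_nonneg _ _ _)
            ((integrable_finsetSum _ fun q _ => hint q).const_mul _) (Eventually.of_forall hpt)
      _ = D * τ * ∑ q ∈ Finset.Ioc 0 Q, kDiv M q *
            (coeffMeasure k e).real {c | (q : ℤ) ∣ evalForm c (a, b)} := by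
          rw [integral_const_mul, integral_finsetSum _ fun q _ => hint q]
          congr 1
          refine Finset.sum_congr rfl fun q _ => ?_
          have : (fun c : Fin (e + 1) → ℤ =>
              if (q : ℤ) ∣ evalForm c (a, b) then (kDiv M q : ℝ) else 0)
              = Set.indicator {c | (q : ℤ) ∣ evalForm c (a, b)} fun _ => (kDiv M q : ℝ) := by
            ext c; simp [Set.indicator_apply]
          rw [this, integral_indicator_const _ (Set.to_countable _).measurableSet, smul_eq_mul,
            mul_comm]
      _ ≤ D * τ * ∑ q ∈ Finset.Ioc 0 Q, (L * H) ^ (e + 1) * ((kDiv M q : ℝ) / q) := by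
          refine mul_le_mul_of_nonneg_left (Finset.sum_le_sum fun q hq => ?_) (by positivity)
          obtain ⟨hq0, hqQ⟩ := Finset.mem_Ioc.1 hq
          have hqH : (q : ℝ) ≤ (1 + e) * H := le_trans (by exact_mod_cast hqQ) hQH
          have h1 := coeffMeasure_dvd_le (e := e) hq0 hH1 hL (fun r => hLk k H hH1 hk q r hq0 hqH) hab
          have h2 : (coeffMeasure k e).real {c | (q : ℤ) ∣ evalForm c (a, b)}
              ≤ (L * H) ^ (e + 1) / q := ENNReal.toReal_le_of_le_ofReal (by positivity) h1
          calc _ ≤ (kDiv M q : ℝ) * ((L * H) ^ (e + 1) / q) := by gcongr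
            _ = _ := by ring
      _ ≤ D * τ * ((L * H) ^ (e + 1) * (K * Real.log H ^ ((2 : ℝ) ^ (2 * C * (e + 2) + 1)))) := by
          rw [← Finset.mul_sum]
          gcongr
          exact (sum_kDiv_div_le M Q).trans hlogQ
      _ = _ := by rw [mul_pow]; ring
  -- At the zero vector every form vanishes and the weight is `1`, so only the total mass matters.
  · have h1 : (coeffMeasure k e).real Set.univ ≤ (L * H) ^ (e + 1) := by
      have h1 := hLk k H hH1 hk 1 0 one_pos (by push_cast; nlinarith)
      rw [setOf_modEq_one, Nat.cast_one, div_one] at h1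
      refine ENNReal.toReal_le_of_le_ofReal (by positivity) ?_
      rw [coeffMeasure, ← Set.pi_univ Set.univ, Measure.pi_pi,
        ENNReal.ofReal_pow (by positivity)]
      exact (Finset.prod_le_prod' fun i _ => h1).trans (by simp)
    have h2 : ∀ c : Fin (e + 1) → ℤ,
        truncSq C ((1 + e) * x ^ e * H) (evalForm c (g * 0, g * 0)) = 1 := by
      intro c
      rw [mul_zero, evalForm_zero he, truncSq, if_pos (by simp; positivity)]
      simp [divWeight]
    simp_rw [h2]
    rw [integral_const, smul_eq_mul, mul_one]
    refine h1.trans ?_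
    have h3 : 1 ≤ K * Real.log H ^ ((2 : ℝ) ^ (2 * C * (e + 2) + 1)) := hone.trans hlogQ
    calc (L * H) ^ (e + 1) = 1 * (L * H) ^ (e + 1) * 1 * 1 := by ring
      _ ≤ D * (L * H) ^ (e + 1) * (K * Real.log H ^ ((2 : ℝ) ^ (2 * C * (e + 2) + 1))) * τ := by
          gcongr
      _ = _ := by rw [mul_pow]; ring

end

/-! ### Orthogonality and averaging over the forms -/

noncomputable section

/-- The normalised Haar measure of the circle. -/
abbrev haarCirc : Measure Circ := AddCircle.haarAddCircle

/-- The normalised Haar measure of the two-dimensional torus. -/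
abbrev haarTorus : Measure (Circ × Circ) := haarCirc.prod haarCirc

theorem fourier_mul_index (a b : ℤ) (θ : Circ) :
    (fourier (a * b) θ : ℂ) = fourier a (b • θ) := by
  rw [fourier_apply, fourier_apply, mul_smul]

theorem fourier_sub_arg (c : ℤ) (α β : Circ) :
    (fourier c (α - β) : ℂ) = fourier c α * fourier (-c) β := by
  rw [fourier_apply, fourier_apply, fourier_apply, smul_sub, sub_eq_add_neg, AddCircle.toCircle_add,
    neg_smul, Circle.coe_mul]

theorem fourier_sum_index {ι : Type*} (s : Finset ι) (c : ι → ℤ) (θ : Circ) :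
    (fourier (∑ i ∈ s, c i) θ : ℂ) = ∏ i ∈ s, fourier (c i) θ := by
  classical
  induction s using Finset.induction_on with
  | empty => simp
  | insert a s ha ih => rw [Finset.sum_insert ha, Finset.prod_insert ha, fourier_add, ih]

theorem norm_fourier_apply (n : ℤ) (θ : Circ) : ‖(fourier n θ : ℂ)‖ = 1 := by
  rw [fourier_apply]; exact Circle.norm_coe _

theorem integral_fourier_haar (n : ℤ) :
    ∫ θ : Circ, (fourier n θ : ℂ) ∂haarCirc = if n = 0 then 1 else 0 := by
  have h := congrFun (fourierCoeff_fourier (T := 2 * Real.pi) n) 0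
  simp only [fourierCoeff, neg_zero, fourier_zero, one_smul] at h
  rw [h, Pi.single_apply]
  simp [eq_comm]

theorem integral_fourier_torus (a b : ℤ) :
    ∫ ω : Circ × Circ, (fourier a ω.1 * fourier b ω.2 : ℂ) ∂haarTorus
      = if a = 0 ∧ b = 0 then 1 else 0 := by
  rw [integral_prod_mul (fun θ : Circ => (fourier a θ : ℂ)) (fun θ : Circ => (fourier b θ : ℂ)),
    integral_fourier_haar, integral_fourier_haar]
  split_ifs <;> simp_all

variable {m : ℕ}

/-- The integer points of the box `|u_j| ≤ X_j`. -/
def symmBox (X : Fin m → ℝ) : Finset (Fin m → ℤ) :=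
  Fintype.piFinset fun j => Finset.Icc ⌈-X j⌉ ⌊X j⌋

theorem mem_symmBox {X : Fin m → ℝ} {u : Fin m → ℤ} : u ∈ symmBox X ↔ ∀ j, |(u j : ℝ)| ≤ X j := by
  simp [symmBox, Fintype.mem_piFinset, Int.ceil_le, Int.le_floor, abs_le]

open Classical in
/-- The truncation of `f` to a box. -/
def truncate (f : (Fin m → ℤ) → ℂ) (X : Fin m → ℝ) (u : Fin m → ℤ) : ℂ :=
  if u ∈ symmBox X then f u else 0

/-- The exponential sum attached to the truncation of `f`. -/
def expPoly (f : (Fin m → ℤ) → ℂ) (X : Fin m → ℝ) (θ : Fin m → Circ) : ℂ :=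
  ∑ u ∈ symmBox X, f u * ∏ j, (fourier (-(u j)) (θ j) : ℂ)

/-- The character of the torus attached to two integer vectors. -/
def pairChar (N N' : Fin m → ℤ) (ω : Fin m → Circ × Circ) : ℂ :=
  ∏ j, (fourier (N j) (ω j).1 * fourier (-(N' j)) (ω j).2 : ℂ)

theorem norm_pairChar (N N' : Fin m → ℤ) (ω : Fin m → Circ × Circ) : ‖pairChar N N' ω‖ = 1 := by
  simp_rw [pairChar, norm_prod, norm_mul, norm_fourier_apply]
  simp

theorem norm_expPoly_le (f : (Fin m → ℤ) → ℂ) (X : Fin m → ℝ) (θ : Fin m → Circ) :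
    ‖expPoly f X θ‖ ≤ ∑ u ∈ symmBox X, ‖f u‖ := by
  refine (norm_sum_le _ _).trans (le_of_eq (Finset.sum_congr rfl fun u _ => ?_))
  simp_rw [norm_mul, norm_prod, norm_fourier_apply]
  simp

@[fun_prop]
theorem continuous_expPoly (f : (Fin m → ℤ) → ℂ) (X : Fin m → ℝ) : Continuous (expPoly f X) := by
  unfold expPoly; fun_prop

@[fun_prop]
theorem continuous_pairChar (N N' : Fin m → ℤ) : Continuous (pairChar N N') := by
  unfold pairChar; fun_prop

theorem continuous_pair_expPoly (f : (Fin m → ℤ) → ℂ) (X : Fin m → ℝ) :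
    Continuous fun ω : Fin m → Circ × Circ => expPoly f X (fun j => (ω j).1) *
      (starRingEnd ℂ) (expPoly f X fun j => (ω j).2) := by
  have h := continuous_expPoly f X
  have h1 : Continuous fun ω : Fin m → Circ × Circ => expPoly f X (fun j => (ω j).1) :=
    h.comp (by fun_prop)
  have h2 : Continuous fun ω : Fin m → Circ × Circ => expPoly f X (fun j => (ω j).2) :=
    h.comp (by fun_prop)
  exact h1.mul (Complex.continuous_conj.comp h2)

/-- Orthogonality of characters on each factor of the torus picks out `u = N` and `v = N'`. -/
theorem truncate_mul_conj_eq (f : (Fin m → ℤ) → ℂ) (X : Fin m → ℝ) (N N' : Fin m → ℤ) :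
    truncate f X N * (starRingEnd ℂ) (truncate f X N')
      = ∫ ω : Fin m → Circ × Circ, expPoly f X (fun j => (ω j).1) *
          (starRingEnd ℂ) (expPoly f X fun j => (ω j).2) * pairChar N N' ω
          ∂Measure.pi fun _ => haarTorus := by
  classical
  have hexp : ∀ ω : Fin m → Circ × Circ, expPoly f X (fun j => (ω j).1) *
          (starRingEnd ℂ) (expPoly f X fun j => (ω j).2) * pairChar N N' ω
      = ∑ u ∈ symmBox X, ∑ v ∈ symmBox X, f u * (starRingEnd ℂ) (f v) *
          ∏ j, (fourier (N j - u j) (ω j).1 * fourier (v j - N' j) (ω j).2 : ℂ) := by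
    intro ω
    simp only [expPoly, map_sum]
    rw [Finset.sum_mul_sum, Finset.sum_mul]
    refine Finset.sum_congr rfl fun u _ => ?_
    rw [Finset.sum_mul]
    refine Finset.sum_congr rfl fun v _ => ?_
    simp only [pairChar, map_mul, map_prod, sub_eq_add_neg, fourier_add, Finset.prod_mul_distrib,
      ← fourier_neg, neg_neg]
    ring
  simp_rw [hexp]
  have hint : ∀ u v, Integrable (fun ω : Fin m → Circ × Circ => f u * (starRingEnd ℂ) (f v) *
      ∏ j, (fourier (N j - u j) (ω j).1 * fourier (v j - N' j) (ω j).2 : ℂ))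
      (Measure.pi fun _ => haarTorus) := by
    intro u v
    refine Continuous.integrable_of_hasCompactSupport (by fun_prop)
      (HasCompactSupport.of_compactSpace _)
  rw [integral_finsetSum _ fun u _ => integrable_finsetSum _ fun v _ => hint u v]
  simp_rw [integral_finsetSum _ fun v _ => hint _ v, integral_const_mul]
  have hprod : ∀ u v : Fin m → ℤ, ∫ ω : Fin m → Circ × Circ,
      ∏ j, (fourier (N j - u j) (ω j).1 * fourier (v j - N' j) (ω j).2 : ℂ)
        ∂(Measure.pi fun _ => haarTorus) = if u = N ∧ v = N' then 1 else 0 := by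
    intro u v
    rw [integral_fintype_prod_eq_prod
      (fun j (p : Circ × Circ) => (fourier (N j - u j) p.1 * fourier (v j - N' j) p.2 : ℂ))]
    simp_rw [integral_fourier_torus]
    rw [Finset.prod_ite_zero]
    simp only [Finset.mem_univ, true_implies, sub_eq_zero, Finset.prod_const_one]
    congr 1
    simp only [forall_and, funext_iff, eq_comm]
  simp_rw [hprod]
  rw [truncate, truncate]
  simp only [ite_and, mul_ite, mul_one, mul_zero]
  by_cases h1 : N ∈ symmBox X <;> by_cases h2 : N' ∈ symmBox X <;>
    simp [h1, h2, Finset.sum_ite_irrel]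

/-- A non-negative continuous kernel with Fourier coefficients `k`. -/
structure IsKernelOf (K : Circ → ℝ) (k : ℤ → ℝ) : Prop where
  nonneg : ∀ α, 0 ≤ K α
  continuous : Continuous K
  integral_eq_one : ∫ α, K α ∂haarCirc = 1
  series : ∀ α, ∫ n, (fourier n α : ℂ) ∂wMeasure k = K α

/-- A Fourier series with non-negative coefficients is bounded by their sum; this provides `sup K_H
≪ H`. -/
theorem IsKernelOf.le {K : Circ → ℝ} {k : ℤ → ℝ} (hK : IsKernelOf K k)
    [IsFiniteMeasure (wMeasure k)] (α : Circ) :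
    K α ≤ (wMeasure k).real Set.univ := by
  have h := norm_integral_le_of_norm_le_const (μ := wMeasure k) (C := 1)
    (f := fun n : ℤ => (fourier n α : ℂ))
    (Eventually.of_forall fun n => (norm_fourier_apply n α).le)
  rw [hK.series, one_mul, Complex.norm_real, Real.norm_of_nonneg (hK.nonneg α)] at h
  exact h

/-- The linear forms in which the kernels are evaluated. -/
def linArg (a a' : ℤ) (ω : Circ × Circ) : Circ := a • ω.1 - a' • ω.2

@[fun_prop]
theorem continuous_linArg (a a' : ℤ) : Continuous (linArg a a') := by
  unfold linArg; fun_prop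

/-- The coefficient of `c_k` in the value at `n` of a form of degree `e`. -/
def monom (e k : ℕ) (n : ℤ × ℤ) : ℤ := n.1 ^ k * n.2 ^ (e - k)

theorem fourier_evalForm_mul {e : ℕ} (c : Fin (e + 1) → ℤ) (n l : ℤ × ℤ) (ω : Circ × Circ) :
    (fourier (evalForm c n) ω.1 * fourier (-(evalForm c l)) ω.2 : ℂ)
      = ∏ i : Fin (e + 1), (fourier (c i) (linArg (monom e i n) (monom e i l) ω) : ℂ) := by
  simp only [evalForm, ← Finset.sum_neg_distrib, fourier_sum_index, ← Finset.prod_mul_distrib]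
  refine Finset.prod_congr rfl fun i _ => ?_
  rw [linArg, fourier_sub_arg, ← fourier_mul_index, ← fourier_mul_index, monom, monom, mul_assoc,
    mul_assoc, neg_mul]

theorem integral_fourier_evalForm {K : Circ → ℝ} {k : ℤ → ℝ} (hK : IsKernelOf K k)
    [SigmaFinite (wMeasure k)]
    (e : ℕ) (n l : ℤ × ℤ) (ω : Circ × Circ) :
    ∫ c, (fourier (evalForm c n) ω.1 * fourier (-(evalForm c l)) ω.2 : ℂ) ∂coeffMeasure k e
      = ((∏ i : Fin (e + 1), K (linArg (monom e i n) (monom e i l) ω) : ℝ) : ℂ) := by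
  simp_rw [fourier_evalForm_mul]
  rw [coeffMeasure, integral_fintype_prod_eq_prod
    (fun (i : Fin (e + 1)) (x : ℤ) => (fourier x (linArg (monom e i n) (monom e i l) ω) : ℂ))]
  simp_rw [hK.series]
  push_cast
  rfl

/-- The product measure on the coefficient vectors of tuples of binary forms. -/
def tupleMeasure (k : ℤ → ℝ) (d : Fin m → ℕ) : Measure ((j : Fin m) → Fin (d j + 1) → ℤ) :=
  Measure.pi fun j => coeffMeasure k (d j)

instance (k : ℤ → ℝ) (e : ℕ) [IsFiniteMeasure (wMeasure k)] : IsFiniteMeasure (coeffMeasure k e) := by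
  rw [coeffMeasure]; infer_instance

instance (k : ℤ → ℝ) (d : Fin m → ℕ) [IsFiniteMeasure (wMeasure k)] :
    IsFiniteMeasure (tupleMeasure k d) := by
  rw [tupleMeasure]; infer_instance

/-- The values at `n` of a tuple of forms. -/
def evalTuple {d : Fin m → ℕ} (F : (j : Fin m) → Fin (d j + 1) → ℤ) (n : ℤ × ℤ) : Fin m → ℤ :=
  fun j => evalForm (F j) n

theorem integrable_expPoly_pairChar (k : ℤ → ℝ) [IsFiniteMeasure (wMeasure k)]
    (d : Fin m → ℕ) (f : (Fin m → ℤ) → ℂ) (X : Fin m → ℝ) (n l : ℤ × ℤ) :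
    Integrable (fun p : ((j : Fin m) → Fin (d j + 1) → ℤ) × (Fin m → Circ × Circ) =>
      expPoly f X (fun j => (p.2 j).1) * (starRingEnd ℂ) (expPoly f X fun j => (p.2 j).2) *
        pairChar (evalTuple p.1 n) (evalTuple p.1 l) p.2)
      ((tupleMeasure k d).prod (Measure.pi fun _ => haarTorus)) := by
  have hmeas : Measurable (fun p : ((j : Fin m) → Fin (d j + 1) → ℤ) × (Fin m → Circ × Circ) =>
      expPoly f X (fun j => (p.2 j).1) * (starRingEnd ℂ) (expPoly f X fun j => (p.2 j).2) *
        pairChar (evalTuple p.1 n) (evalTuple p.1 l) p.2) := by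
    refine measurable_from_prod_countable_right fun F => ?_
    have h1 := (continuous_pair_expPoly f X).measurable
    have h2 := (continuous_pairChar (evalTuple F n) (evalTuple F l)).measurable
    exact h1.mul h2
  refine Integrable.of_bound (C := (∑ u ∈ symmBox X, ‖f u‖) * ∑ u ∈ symmBox X, ‖f u‖)
    hmeas.aestronglyMeasurable (Eventually.of_forall fun p => ?_)
  rw [norm_mul, norm_mul, norm_pairChar, mul_one, RCLike.norm_conj]
  exact mul_le_mul (norm_expPoly_le _ _ _) (norm_expPoly_le _ _ _) (norm_nonneg _)
    (Finset.sum_nonneg fun _ _ => norm_nonneg _)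

/-- After exchanging the integrals, the character factors over the individual coefficients, because
`F(n)` and `F(l)` are linear in them. Each coefficient integral is then the Fourier series of `K` at
a linear form in the torus variables. -/
theorem integral_truncate_mul_conj {K : Circ → ℝ} {k : ℤ → ℝ} (hK : IsKernelOf K k)
    [IsFiniteMeasure (wMeasure k)] (d : Fin m → ℕ) (f : (Fin m → ℤ) → ℂ) (X : Fin m → ℝ)
    (n l : ℤ × ℤ) :
    ∫ F, truncate f X (evalTuple F n) * (starRingEnd ℂ) (truncate f X (evalTuple F l))
        ∂tupleMeasure k d
      = ∫ ω : Fin m → Circ × Circ, expPoly f X (fun j => (ω j).1) *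
          (starRingEnd ℂ) (expPoly f X fun j => (ω j).2) *
          ((∏ j, ∏ i : Fin (d j + 1),
            K (linArg (monom (d j) i n) (monom (d j) i l) (ω j)) : ℝ) : ℂ)
          ∂Measure.pi fun _ => haarTorus := by
  simp_rw [truncate_mul_conj_eq]
  rw [integral_integral_swap]
  · refine integral_congr_ae (Eventually.of_forall fun ω => ?_)
    simp only
    rw [integral_const_mul]
    congr 1
    simp only [pairChar, evalTuple]
    rw [tupleMeasure, integral_fintype_prod_eq_prod (fun j (c : Fin (d j + 1) → ℤ) =>
      (fourier (evalForm c n) (ω j).1 * fourier (-(evalForm c l)) (ω j).2 : ℂ))]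
    simp_rw [integral_fourier_evalForm hK]
    push_cast
    rfl
  · exact integrable_expPoly_pairChar k d f X n l

theorem exists_zsmul_eq {q : ℤ} (hq : q ≠ 0) (α : Circ) : ∃ β : Circ, q • β = α := by
  induction α using QuotientAddGroup.induction_on with
  | H t =>
    refine ⟨((t / q : ℝ) : Circ), ?_⟩
    have : (q : ℝ) ≠ 0 := by exact_mod_cast hq
    rw [← AddCircle.coe_zsmul, zsmul_eq_mul, mul_div_cancel₀ _ this]

/-- The endomorphism of the torus given by two linear forms. -/
def torusHom (a a' b b' : ℤ) : Circ × Circ →+ Circ × Circ where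
  toFun ω := (linArg a a' ω, linArg b b' ω)
  map_zero' := by simp [linArg]
  map_add' ω ω' := by
    simp only [linArg, Prod.fst_add, Prod.snd_add, smul_add, Prod.mk_add_mk]
    congr 1 <;> abel

/-- A surjective continuous endomorphism of a compact group preserves Haar measure. Surjectivity
comes from the adjugate matrix, after dividing the target point by the determinant in the divisible
group `Circ`. -/
theorem measurePreserving_torusHom {a a' b b' : ℤ} (h : a' * b - a * b' ≠ 0) :
    MeasurePreserving (torusHom a a' b b') haarTorus haarTorus := by
  refine AddMonoidHom.measurePreserving ?_ ?_ rfl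
  · exact (continuous_linArg a a').prodMk (continuous_linArg b b')
  · rintro ⟨α, β⟩
    obtain ⟨α, rfl⟩ := exists_zsmul_eq h α
    obtain ⟨β, rfl⟩ := exists_zsmul_eq h β
    refine ⟨(-b' • α + a' • β, -b • α + a • β), ?_⟩
    simp only [torusHom, linArg, AddMonoidHom.coe_mk, ZeroHom.coe_mk, smul_add, smul_smul]
    ext
    · simp only
      have : (a' * b - a * b') • α = (a * -b') • α - (a' * -b) • α := by
        rw [← sub_smul]; congr 1; ring
      rw [this, mul_comm a a']; abel
    · simp only
      have : (a' * b - a * b') • β = (b * a') • β - (b' * a) • β := by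
        rw [← sub_smul]; congr 1; ring
      rw [this, mul_neg, mul_neg, mul_comm b b']; abel

end

/-! ### The correlation of one pair: tails, rational points, partial summation -/

noncomputable section

variable {m : ℕ}

theorem integral_comp_torusHom {a a' b b' : ℤ} (h : a' * b - a * b' ≠ 0) {g : Circ × Circ → ℝ}
    (hg : Measurable g) :
    ∫ ω, g (linArg a a' ω, linArg b b' ω) ∂haarTorus = ∫ p, g p ∂haarTorus := by
  have hmp := measurePreserving_torusHom h
  conv_rhs => rw [← hmp.map_eq]
  rw [integral_map hmp.measurable.aemeasurable hg.aestronglyMeasurable]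
  rfl

/-- The mass of a kernel off an arc, for the normalised measure. -/
def tailMass (K : Circ → ℝ) (δ : ℝ) : ℝ := ∫ α, Set.indicator {α | δ < ‖α‖} K α ∂haarCirc

theorem tailMass_nonneg {K : Circ → ℝ} (hK : ∀ α, 0 ≤ K α) (δ : ℝ) : 0 ≤ tailMass K δ :=
  integral_nonneg fun _ => Set.indicator_nonneg (fun α _ => hK α) _

theorem measurableSet_norm_lt (δ : ℝ) : MeasurableSet {α : Circ | δ < ‖α‖} :=
  measurableSet_lt measurable_const measurable_norm

section pair

variable {K : Circ → ℝ} {k : ℤ → ℝ} (e : ℕ) (n l : ℤ × ℤ)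

/-- The linear form attached to the first coefficient. -/
def lowArg (ω : Circ × Circ) : Circ := linArg (monom e 0 n) (monom e 0 l) ω

/-- The linear form attached to the last coefficient. -/
def highArg (ω : Circ × Circ) : Circ := linArg (monom e e n) (monom e e l) ω

theorem continuous_lowArg : Continuous (lowArg e n l) := continuous_linArg _ _

theorem continuous_highArg : Continuous (highArg e n l) := continuous_linArg _ _

/-- The determinant of the two linear forms. -/
def pairDet : ℤ := (n.2 * l.1) ^ e - (n.1 * l.2) ^ e

variable {e n l}

theorem det_ne_zero (hq : pairDet e n l ≠ 0) :
    monom e 0 l * monom e e n - monom e 0 n * monom e e l ≠ 0 := by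
  intro h
  apply hq
  simp only [monom, pow_zero, Nat.sub_zero, Nat.sub_self, one_mul, mul_one] at h
  rw [pairDet, mul_pow, mul_pow]
  linarith

/-- In the new coordinates `lowArg`, `highArg` the integrand is a product, and each kernel has
integral `1`. -/
theorem integral_kernel_pair (hK : IsKernelOf K k) (hq : pairDet e n l ≠ 0) :
    ∫ ω, K (lowArg e n l ω) * K (highArg e n l ω) ∂haarTorus = 1 := by
  have h := integral_comp_torusHom (det_ne_zero hq) (g := fun p => K p.1 * K p.2)
    ((hK.continuous.comp continuous_fst).mul (hK.continuous.comp continuous_snd)).measurable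
  refine h.trans ?_
  rw [integral_prod_mul K K, hK.integral_eq_one, one_mul]

theorem integral_indicator_low (hK : IsKernelOf K k) (hq : pairDet e n l ≠ 0) (δ : ℝ) :
    ∫ ω, Set.indicator {ω | δ < ‖lowArg e n l ω‖}
      (fun ω => K (lowArg e n l ω) * K (highArg e n l ω)) ω ∂haarTorus = tailMass K δ := by
  have hm : Measurable fun p : Circ × Circ => Set.indicator {α | δ < ‖α‖} K p.1 * K p.2 :=
    ((hK.continuous.measurable.indicator (measurableSet_norm_lt δ)).comp measurable_fst).mul
      (hK.continuous.measurable.comp measurable_snd)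
  have h := integral_comp_torusHom (det_ne_zero hq) hm
  rw [integral_prod_mul (Set.indicator {α | δ < ‖α‖} K) K, hK.integral_eq_one, mul_one] at h
  rw [tailMass, ← h]
  refine integral_congr_ae (Eventually.of_forall fun ω => ?_)
  simp only [Set.indicator_apply, Set.mem_ofPred_eq, lowArg, highArg, ite_mul, zero_mul]

theorem integral_indicator_high (hK : IsKernelOf K k) (hq : pairDet e n l ≠ 0) (δ : ℝ) :
    ∫ ω, Set.indicator {ω | δ < ‖highArg e n l ω‖}
      (fun ω => K (lowArg e n l ω) * K (highArg e n l ω)) ω ∂haarTorus = tailMass K δ := by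
  have hm : Measurable fun p : Circ × Circ => K p.1 * Set.indicator {α | δ < ‖α‖} K p.2 :=
    (hK.continuous.measurable.comp measurable_fst).mul
      ((hK.continuous.measurable.indicator (measurableSet_norm_lt δ)).comp measurable_snd)
  have h := integral_comp_torusHom (det_ne_zero hq) hm
  rw [integral_prod_mul K (Set.indicator {α | δ < ‖α‖} K), hK.integral_eq_one, one_mul] at h
  rw [tailMass, ← h]
  refine integral_congr_ae (Eventually.of_forall fun ω => ?_)
  simp only [Set.indicator_apply, Set.mem_ofPred_eq, lowArg, highArg, mul_ite, mul_zero]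

/-- For `e ≥ 1` the first and last coefficients are distinct; the `e - 1` kernels between them are
bounded by `P`. -/
theorem prod_kernel_le (hK : ∀ α, 0 ≤ K α) {P : ℝ} (hP : ∀ α, K α ≤ P) (he : 1 ≤ e)
    (ω : Circ × Circ) :
    ∏ i : Fin (e + 1), K (linArg (monom e i n) (monom e i l) ω)
      ≤ P ^ (e - 1) * (K (lowArg e n l ω) * K (highArg e n l ω)) := by
  obtain ⟨e, rfl⟩ : ∃ e', e = e' + 1 := ⟨e - 1, by omega⟩
  rw [Fin.prod_univ_succ, Fin.prod_univ_castSucc]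
  have h1 : ∏ i : Fin e, K (linArg (monom (e + 1) (i.castSucc.succ : Fin (e + 1 + 1)) n)
      (monom (e + 1) (i.castSucc.succ : Fin (e + 1 + 1)) l) ω) ≤ P ^ e := by
    calc _ ≤ ∏ _i : Fin e, P := Finset.prod_le_prod (fun i _ => hK _) fun i _ => hP _
      _ = P ^ e := by simp
  calc _ = (∏ i : Fin e, K (linArg (monom (e + 1) (i.castSucc.succ : Fin (e + 1 + 1)) n)
      (monom (e + 1) (i.castSucc.succ : Fin (e + 1 + 1)) l) ω)) *
        (K (lowArg (e + 1) n l ω) * K (highArg (e + 1) n l ω)) := by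
        simp only [lowArg, highArg, Fin.val_zero, Fin.succ_last, Fin.val_last]
        ring
    _ ≤ _ := mul_le_mul_of_nonneg_right h1 (mul_nonneg (hK _) (hK _))

end pair

/-- Either all `2m` arguments are at most `δ`, and `M1` applies, or some argument exceeds `δ`. In
the latter case a union bound leaves `2m` integrals, each equal to one tail mass by independence,
and the trivial bound `M0` is used. -/
theorem norm_pair_integral_le {K : Circ → ℝ} {k : ℤ → ℝ} (hK : IsKernelOf K k)
    {d : Fin m → ℕ} (hd : ∀ j, 1 ≤ d j) (f : (Fin m → ℤ) → ℂ) (X : Fin m → ℝ) {n l : ℤ × ℤ}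
    (hq : ∀ j, pairDet (d j) n l ≠ 0) {P δ M0 M1 : ℝ} (hP : ∀ α, K α ≤ P) (hM1 : 0 ≤ M1)
    (hS0 : ∀ θ, ‖expPoly f X θ‖ ≤ M0)
    (hS1 : ∀ ω : Fin m → Circ × Circ,
      (∀ j, ‖lowArg (d j) n l (ω j)‖ ≤ δ ∧ ‖highArg (d j) n l (ω j)‖ ≤ δ) →
      ‖expPoly f X fun j => (ω j).1‖ ≤ M1 ∧ ‖expPoly f X fun j => (ω j).2‖ ≤ M1) :
    ‖∫ ω : Fin m → Circ × Circ, expPoly f X (fun j => (ω j).1) *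
          (starRingEnd ℂ) (expPoly f X fun j => (ω j).2) *
          ((∏ j, ∏ i : Fin (d j + 1),
            K (linArg (monom (d j) i n) (monom (d j) i l) (ω j)) : ℝ) : ℂ)
          ∂Measure.pi fun _ => haarTorus‖
      ≤ (∏ j, P ^ (d j - 1)) * (M1 ^ 2 + M0 ^ 2 * (2 * m * tailMass K δ)) := by
  classical
  set V : Fin m → Circ × Circ → ℝ := fun j ω => K (lowArg (d j) n l ω) * K (highArg (d j) n l ω)
  -- For the union bound over `j`, only the `j`-th factor carries the tail condition; the other
  -- factors integrate to `1`.
  set Lo : Fin m → Fin m → Circ × Circ → ℝ := fun j i =>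
    if i = j then Set.indicator {ω | δ < ‖lowArg (d i) n l ω‖} (V i) else V i
  set Hi : Fin m → Fin m → Circ × Circ → ℝ := fun j i =>
    if i = j then Set.indicator {ω | δ < ‖highArg (d i) n l ω‖} (V i) else V i
  have hP0 : 0 ≤ P := (hK.nonneg 0).trans (hP 0)
  have hM0 : 0 ≤ M0 := (norm_nonneg _).trans (hS0 0)
  have hV0 : ∀ j ω, 0 ≤ V j ω := fun j ω => mul_nonneg (hK.nonneg _) (hK.nonneg _)
  have hVint : ∀ j, Integrable (V j) haarTorus := by
    intro j
    refine Continuous.integrable_of_hasCompactSupport ?_ (HasCompactSupport.of_compactSpace _)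
    exact (hK.continuous.comp (continuous_lowArg _ _ _)).mul
      (hK.continuous.comp (continuous_highArg _ _ _))
  have hLoset : ∀ i, MeasurableSet {ω | δ < ‖lowArg (d i) n l ω‖} := fun i =>
    measurableSet_norm_lt δ |>.preimage (continuous_lowArg _ _ _).measurable
  have hHiset : ∀ i, MeasurableSet {ω | δ < ‖highArg (d i) n l ω‖} := fun i =>
    measurableSet_norm_lt δ |>.preimage (continuous_highArg _ _ _).measurable
  have hLoint : ∀ j i, Integrable (Lo j i) haarTorus := by
    intro j i; simp only [Lo]; split_ifs
    exacts [(hVint i).indicator (hLoset i), hVint i]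
  have hHiint : ∀ j i, Integrable (Hi j i) haarTorus := by
    intro j i; simp only [Hi]; split_ifs
    exacts [(hVint i).indicator (hHiset i), hVint i]
  have hLo0 : ∀ j i ω, 0 ≤ Lo j i ω := by
    intro j i ω; simp only [Lo]; split_ifs
    exacts [Set.indicator_nonneg (fun _ _ => hV0 i _) _, hV0 i _]
  have hHi0 : ∀ j i ω, 0 ≤ Hi j i ω := by
    intro j i ω; simp only [Hi]; split_ifs
    exacts [Set.indicator_nonneg (fun _ _ => hV0 i _) _, hV0 i _]
  have hVprod : Integrable (fun ω : Fin m → Circ × Circ => ∏ i, V i (ω i))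
      (Measure.pi fun _ => haarTorus) := Integrable.fintype_prod hVint
  have hLoprod : ∀ j, Integrable (fun ω : Fin m → Circ × Circ => ∏ i, Lo j i (ω i))
      (Measure.pi fun _ => haarTorus) := fun j => Integrable.fintype_prod (hLoint j)
  have hHiprod : ∀ j, Integrable (fun ω : Fin m → Circ × Circ => ∏ i, Hi j i (ω i))
      (Measure.pi fun _ => haarTorus) := fun j => Integrable.fintype_prod (hHiint j)
  have hVval : ∫ ω : Fin m → Circ × Circ, ∏ i, V i (ω i) ∂(Measure.pi fun _ => haarTorus) = 1 := by
    rw [integral_fintype_prod_eq_prod V]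
    exact Finset.prod_eq_one fun i _ => integral_kernel_pair hK (hq i)
  have hLoval : ∀ j, ∫ ω : Fin m → Circ × Circ, ∏ i, Lo j i (ω i)
      ∂(Measure.pi fun _ => haarTorus) = tailMass K δ := by
    intro j
    rw [integral_fintype_prod_eq_prod (Lo j), Finset.prod_eq_single j]
    · simp only [Lo, if_true]; exact integral_indicator_low hK (hq j) δ
    · intro i _ hij; simp only [Lo, if_neg hij]; exact integral_kernel_pair hK (hq i)
    · simp
  have hHival : ∀ j, ∫ ω : Fin m → Circ × Circ, ∏ i, Hi j i (ω i)
      ∂(Measure.pi fun _ => haarTorus) = tailMass K δ := by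
    intro j
    rw [integral_fintype_prod_eq_prod (Hi j), Finset.prod_eq_single j]
    · simp only [Hi, if_true]; exact integral_indicator_high hK (hq j) δ
    · intro i _ hij; simp only [Hi, if_neg hij]; exact integral_kernel_pair hK (hq i)
    · simp
  set G : (Fin m → Circ × Circ) → ℝ := fun ω => (∏ j, P ^ (d j - 1)) *
    (M1 ^ 2 * ∏ i, V i (ω i) + M0 ^ 2 * ∑ j, (∏ i, Lo j i (ω i) + ∏ i, Hi j i (ω i)))
  have hadd : ∀ j, Integrable (fun ω : Fin m → Circ × Circ =>
      ∏ i, Lo j i (ω i) + ∏ i, Hi j i (ω i)) (Measure.pi fun _ => haarTorus) :=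
    fun j => (hLoprod j).add (hHiprod j)
  have hsumint : Integrable (fun ω : Fin m → Circ × Circ =>
      ∑ j, (∏ i, Lo j i (ω i) + ∏ i, Hi j i (ω i))) (Measure.pi fun _ => haarTorus) :=
    integrable_finsetSum _ fun j _ => hadd j
  have hGint : Integrable G (Measure.pi fun _ => haarTorus) :=
    ((hVprod.const_mul _).add (hsumint.const_mul _)).const_mul _
  have hGval : ∫ ω, G ω ∂(Measure.pi fun _ => haarTorus)
      = (∏ j, P ^ (d j - 1)) * (M1 ^ 2 + M0 ^ 2 * (2 * m * tailMass K δ)) := by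
    simp only [G]
    rw [integral_const_mul, integral_add (hVprod.const_mul _) (hsumint.const_mul _),
      integral_const_mul, integral_const_mul, hVval,
      integral_finsetSum _ fun j _ => hadd j]
    simp_rw [integral_add (hLoprod _) (hHiprod _), hLoval, hHival]
    rw [Finset.sum_const, Finset.card_univ, Fintype.card_fin, nsmul_eq_mul]
    ring
  rw [← hGval]
  refine norm_integral_le_of_norm_le hGint (Eventually.of_forall fun ω => ?_)
  have hW : ∏ j, ∏ i : Fin (d j + 1), K (linArg (monom (d j) i n) (monom (d j) i l) (ω j))
      ≤ (∏ j, P ^ (d j - 1)) * ∏ j, V j (ω j) := by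
    rw [← Finset.prod_mul_distrib]
    exact Finset.prod_le_prod (fun j _ => Finset.prod_nonneg fun i _ => hK.nonneg _)
      fun j _ => prod_kernel_le hK.nonneg hP (hd j) _
  have hW0 : 0 ≤ ∏ j, ∏ i : Fin (d j + 1),
      K (linArg (monom (d j) i n) (monom (d j) i l) (ω j)) :=
    Finset.prod_nonneg fun j _ => Finset.prod_nonneg fun i _ => hK.nonneg _
  have hPP : 0 ≤ ∏ j, P ^ (d j - 1) := Finset.prod_nonneg fun j _ => by positivity
  have hVV : 0 ≤ ∏ j, V j (ω j) := Finset.prod_nonneg fun j _ => hV0 _ _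
  have hLL : ∀ j, 0 ≤ ∏ i, Lo j i (ω i) := fun j => Finset.prod_nonneg fun i _ => hLo0 _ _ _
  have hHH : ∀ j, 0 ≤ ∏ i, Hi j i (ω i) := fun j => Finset.prod_nonneg fun i _ => hHi0 _ _ _
  have hSum : 0 ≤ ∑ j, (∏ i, Lo j i (ω i) + ∏ i, Hi j i (ω i)) :=
    Finset.sum_nonneg fun j _ => add_nonneg (hLL j) (hHH j)
  rw [norm_mul, norm_mul, RCLike.norm_conj, Complex.norm_real, Real.norm_of_nonneg hW0]
  simp only [G]
  have key : ‖expPoly f X fun j => (ω j).1‖ * ‖expPoly f X fun j => (ω j).2‖ * ∏ j, V j (ω j)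
      ≤ M1 ^ 2 * ∏ i, V i (ω i) + M0 ^ 2 * ∑ j, (∏ i, Lo j i (ω i) + ∏ i, Hi j i (ω i)) := by
    by_cases hall : ∀ j, ‖lowArg (d j) n l (ω j)‖ ≤ δ ∧ ‖highArg (d j) n l (ω j)‖ ≤ δ
    · obtain ⟨h1, h2⟩ := hS1 ω hall
      have : ‖expPoly f X fun j => (ω j).1‖ * ‖expPoly f X fun j => (ω j).2‖ ≤ M1 ^ 2 := by
        rw [sq]; gcongr
      have h3 := mul_le_mul_of_nonneg_right this hVV
      have h4 : 0 ≤ M0 ^ 2 * ∑ j, (∏ i, Lo j i (ω i) + ∏ i, Hi j i (ω i)) :=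
        mul_nonneg (by positivity) hSum
      linarith
    · have hbig : ∏ j, V j (ω j) ≤ ∑ j, (∏ i, Lo j i (ω i) + ∏ i, Hi j i (ω i)) := by
        push Not at hall
        obtain ⟨j, hj⟩ := hall
        refine le_trans ?_ (Finset.single_le_sum (fun j _ => add_nonneg (hLL j) (hHH j))
          (Finset.mem_univ j))
        rcases le_or_gt ‖lowArg (d j) n l (ω j)‖ δ with hle | hlt
        · have hj' := hj hle
          have : ∏ i, Hi j i (ω i) = ∏ i, V i (ω i) := by
            refine Finset.prod_congr rfl fun i _ => ?_
            simp only [Hi]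
            split_ifs with hij
            · subst hij
              exact Set.indicator_of_mem (show ω i ∈ {ω | δ < ‖highArg (d i) n l ω‖} from hj') _
            · rfl
          linarith [hLL j]
        · have : ∏ i, Lo j i (ω i) = ∏ i, V i (ω i) := by
            refine Finset.prod_congr rfl fun i _ => ?_
            simp only [Lo]
            split_ifs with hij
            · subst hij
              exact Set.indicator_of_mem (show ω i ∈ {ω | δ < ‖lowArg (d i) n l ω‖} from hlt) _
            · rfl
          linarith [hHH j]
      have : ‖expPoly f X fun j => (ω j).1‖ * ‖expPoly f X fun j => (ω j).2‖ ≤ M0 ^ 2 := by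
        rw [sq]; exact mul_le_mul (hS0 _) (hS0 _) (norm_nonneg _) hM0
      have h3 : ‖expPoly f X fun j => (ω j).1‖ * ‖expPoly f X fun j => (ω j).2‖ *
          ∏ j, V j (ω j) ≤ M0 ^ 2 * ∑ j, (∏ i, Lo j i (ω i) + ∏ i, Hi j i (ω i)) :=
        mul_le_mul this hbig hVV (by positivity)
      have h4 : 0 ≤ M1 ^ 2 * ∏ i, V i (ω i) := mul_nonneg (by positivity) hVV
      linarith
  calc _ ≤ ‖expPoly f X fun j => (ω j).1‖ * ‖expPoly f X fun j => (ω j).2‖ *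
        ((∏ j, P ^ (d j - 1)) * ∏ j, V j (ω j)) := by gcongr
    _ = (∏ j, P ^ (d j - 1)) * (‖expPoly f X fun j => (ω j).1‖ *
        ‖expPoly f X fun j => (ω j).2‖ * ∏ j, V j (ω j)) := by ring
    _ ≤ _ := mul_le_mul_of_nonneg_left key hPP

theorem sum_Icc_sub_succ (h : ℤ → ℂ) {t B : ℤ} (htB : t ≤ B) :
    ∑ v ∈ Finset.Icc t B, (h v - h (v + 1)) = h t - h (B + 1) := by
  induction B, htB using Int.leInduction with
  | base => simp
  | succ B hB ih =>
    rw [← Finset.insert_Icc_right_eq_Icc_add_one (by omega), Finset.sum_insert (by simp), ih]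
    ring

/-- Abel summation in every coordinate at once: each `z j` is a combination of step functions, the
differences `g` being the coefficients, and the steps cut out the partial sums bounded by `E`. -/
theorem norm_sum_mul_prod_le (F : (Fin m → ℤ) → ℂ) (A B : Fin m → ℤ) (hAB : ∀ j, A j ≤ B j)
    (z : Fin m → ℤ → ℂ) {E : ℝ} (R : Fin m → ℝ)
    (hE : ∀ v : Fin m → ℤ, (∀ j, A j ≤ v j ∧ v j ≤ B j) →
      ‖∑ u ∈ Fintype.piFinset fun j => Finset.Icc (A j) (v j), F u‖ ≤ E)
    (hR : ∀ j, ‖z j (B j)‖ + ∑ v ∈ Finset.Ico (A j) (B j), ‖z j v - z j (v + 1)‖ ≤ R j) :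
    ‖∑ u ∈ Fintype.piFinset fun j => Finset.Icc (A j) (B j), F u * ∏ j, z j (u j)‖
      ≤ (∏ j, R j) * E := by
  classical
  -- Setting `z j` to `0` beyond `B j` makes the last difference equal to `z j (B j)`, so boundary
  -- terms need no separate treatment.
  set h : Fin m → ℤ → ℂ := fun j v => if v ≤ B j then z j v else 0
  set g : Fin m → ℤ → ℂ := fun j v => h j v - h j (v + 1)
  have hE0 : 0 ≤ E := (norm_nonneg _).trans (hE B fun j => ⟨hAB j, le_rfl⟩)
  have hz : ∀ j t, A j ≤ t → t ≤ B j →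
      z j t = ∑ v ∈ Finset.Icc (A j) (B j), if t ≤ v then g j v else 0 := by
    intro j t hA hB
    rw [← Finset.sum_filter]
    have : (Finset.Icc (A j) (B j)).filter (fun v => t ≤ v) = Finset.Icc t (B j) := by
      ext v; simp only [Finset.mem_filter, Finset.mem_Icc]; omega
    rw [this, sum_Icc_sub_succ _ hB]
    simp [h, hB]
  have hg : ∀ j, ∑ v ∈ Finset.Icc (A j) (B j), ‖g j v‖ ≤ R j := by
    intro j
    refine le_trans (le_of_eq ?_) (hR j)
    rw [← Finset.Ico_insert_right (hAB j), Finset.sum_insert (by simp)]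
    congr 1
    · simp [g, h]
    · refine Finset.sum_congr rfl fun v hv => ?_
      have := Finset.mem_Ico.1 hv
      simp only [g, h, if_pos this.2.le, if_pos (show v + 1 ≤ B j by omega)]
  have hsplit : ∑ u ∈ Fintype.piFinset (fun j => Finset.Icc (A j) (B j)), F u * ∏ j, z j (u j)
      = ∑ v ∈ Fintype.piFinset (fun j => Finset.Icc (A j) (B j)), (∏ j, g j (v j)) *
          ∑ u ∈ Fintype.piFinset (fun j => Finset.Icc (A j) (v j)), F u := by
    calc _ = ∑ u ∈ Fintype.piFinset (fun j => Finset.Icc (A j) (B j)),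
          ∑ v ∈ Fintype.piFinset (fun j => Finset.Icc (A j) (B j)),
            if ∀ j, u j ≤ v j then (∏ j, g j (v j)) * F u else 0 := by
          refine Finset.sum_congr rfl fun u hu => ?_
          have hu' : ∀ j, A j ≤ u j ∧ u j ≤ B j := by
            simpa [Fintype.mem_piFinset] using hu
          rw [Finset.prod_congr rfl fun j _ => hz j (u j) (hu' j).1 (hu' j).2,
            Finset.prod_univ_sum, Finset.mul_sum]
          refine Finset.sum_congr rfl fun v _ => ?_
          rw [Finset.prod_ite_zero]
          simp [mul_comm]
      _ = _ := by
          rw [Finset.sum_comm]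
          refine Finset.sum_congr rfl fun v hv => ?_
          have hv' : ∀ j, A j ≤ v j ∧ v j ≤ B j := by
            simpa [Fintype.mem_piFinset] using hv
          rw [← Finset.sum_filter, Finset.mul_sum]
          refine Finset.sum_congr ?_ fun _ _ => rfl
          ext u
          simp only [Finset.mem_filter, Fintype.mem_piFinset, Finset.mem_Icc]
          constructor
          · rintro ⟨h1, h2⟩ j; exact ⟨(h1 j).1, h2 j⟩
          · intro h1; exact ⟨fun j => ⟨(h1 j).1, (h1 j).2.trans (hv' j).2⟩, fun j => (h1 j).2⟩
  rw [hsplit]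
  calc _ ≤ ∑ v ∈ Fintype.piFinset (fun j => Finset.Icc (A j) (B j)), (∏ j, ‖g j (v j)‖) * E := by
        refine norm_sum_le_of_le _ fun v hv => ?_
        rw [norm_mul, norm_prod]
        refine mul_le_mul_of_nonneg_left (hE v ?_) (Finset.prod_nonneg fun _ _ => norm_nonneg _)
        simpa [Fintype.mem_piFinset] using hv
    _ = (∏ j, ∑ v ∈ Finset.Icc (A j) (B j), ‖g j v‖) * E := by
        rw [← Finset.sum_mul, Finset.prod_univ_sum]
    _ ≤ _ := by
        refine mul_le_mul_of_nonneg_right (Finset.prod_le_prod (fun j _ => ?_) fun j _ => hg j) hE0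
        exact Finset.sum_nonneg fun _ _ => norm_nonneg _

theorem exists_rational_approx {θ : Circ} {q : ℤ} (hq : q ≠ 0) {ε : ℝ} (h : ‖q • θ‖ ≤ ε) :
    ∃ (b : ℤ) (η : ℝ), |η| ≤ ε / |(q : ℝ)| ∧ θ = ((2 * Real.pi * b / q + η : ℝ) : Circ) := by
  induction θ using QuotientAddGroup.induction_on with
  | H t =>
    have hq' : (q : ℝ) ≠ 0 := by exact_mod_cast hq
    have h' : ‖((q * t : ℝ) : Circ)‖ ≤ ε := by
      rw [← zsmul_eq_mul, AddCircle.coe_zsmul]; exact h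
    rw [AddCircle.norm_eq] at h'
    set b := round ((2 * Real.pi)⁻¹ * (q * t))
    refine ⟨b, t - 2 * Real.pi * b / q, ?_, ?_⟩
    · rw [le_div_iff₀ (abs_pos.2 hq'), ← abs_mul]
      refine le_trans (le_of_eq ?_) h'
      congr 1
      field_simp
    · congr 1; ring

theorem expSumSup_bddAbove (f : (Fin m → ℤ) → ℂ) (X : Fin m → ℝ) (q : Fin m → ℤ) :
    BddAbove {s : ℝ | ∃ (b : Fin m → ℤ) (v : Fin m → ℝ), (∀ k, |v k| ≤ X k) ∧
      s = ‖∑ t ∈ Fintype.piFinset (fun k => Finset.Icc ⌈-X k⌉ ⌊v k⌋),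
        f t * Complex.exp
          (2 * Real.pi * Complex.I * ∑ k, (b k : ℂ) * (t k : ℂ) / (q k : ℂ))‖} := by
  refine ⟨∑ t ∈ symmBox X, ‖f t‖, ?_⟩
  rintro s ⟨b, v, hv, rfl⟩
  refine (norm_sum_le _ _).trans ?_
  calc _ = ∑ t ∈ Fintype.piFinset (fun k => Finset.Icc ⌈-X k⌉ ⌊v k⌋), ‖f t‖ := by
        refine Finset.sum_congr rfl fun t _ => ?_
        have : 2 * (Real.pi : ℂ) * Complex.I * ∑ k, (b k : ℂ) * (t k : ℂ) / (q k : ℂ)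
            = ((2 * Real.pi * ∑ k, (b k : ℝ) * (t k : ℝ) / (q k : ℝ) : ℝ) : ℂ) * Complex.I := by
          push_cast; ring
        rw [norm_mul, this, Complex.norm_exp_ofReal_mul_I, mul_one]
    _ ≤ _ := by
        refine Finset.sum_le_sum_of_subset_of_nonneg ?_ fun _ _ _ => norm_nonneg _
        refine Fintype.piFinset_subset _ _ fun k => Finset.Icc_subset_Icc_right ?_
        exact Int.floor_le_floor ((le_abs_self _).trans (hv k))

/-- The rational part of `θ` goes into `F`, whose partial sums over boxes are bounded by
`expSumSup`. The remaining factor `exp(-i u η_j)` has total variation at most `2 X_j |η_j|` on the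
box. The numerators change sign because `expPoly` uses the characters of index `-u`. -/
theorem norm_expPoly_le_expSumSup (f : (Fin m → ℤ) → ℂ) {X : Fin m → ℝ} (hX : ∀ j, 0 ≤ X j)
    (q b : Fin m → ℤ) (η : Fin m → ℝ) {θ : Fin m → Circ}
    (hθ : ∀ j, θ j = ((2 * Real.pi * b j / q j + η j : ℝ) : Circ)) :
    ‖expPoly f X θ‖ ≤ (∏ j, (1 + 2 * X j * |η j|)) * expSumSup f X q := by
  set F : (Fin m → ℤ) → ℂ := fun u => f u * Complex.exp
    (2 * Real.pi * Complex.I * ∑ k, ((-b k : ℤ) : ℂ) * (u k : ℂ) / (q k : ℂ))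
  set z : Fin m → ℤ → ℂ := fun j u => Complex.exp (((-(u * η j) : ℝ) : ℂ) * Complex.I)
  have hAB : ∀ j, ⌈-X j⌉ ≤ ⌊X j⌋ := fun j =>
    (Int.ceil_le.2 (by simpa using hX j)).trans (Int.le_floor.2 (by simpa using hX j) : (0:ℤ) ≤ _)
  have heq : expPoly f X θ
      = ∑ u ∈ Fintype.piFinset fun j => Finset.Icc ⌈-X j⌉ ⌊X j⌋, F u * ∏ j, z j (u j) := by
    rw [expPoly, symmBox]
    refine Finset.sum_congr rfl fun u _ => ?_
    simp only [F, z]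
    rw [mul_assoc]
    congr 1
    rw [Finset.mul_sum, Complex.exp_sum, ← Finset.prod_mul_distrib]
    refine Finset.prod_congr rfl fun j _ => ?_
    rw [hθ j, fourier_coe_apply, ← Complex.exp_add]
    congr 1
    have : (Real.pi : ℂ) ≠ 0 := by exact_mod_cast Real.pi_ne_zero
    push_cast
    field_simp
    ring
  rw [heq]
  refine norm_sum_mul_prod_le F _ _ hAB z _ ?_ ?_
  · intro v hv
    refine le_csSup (expSumSup_bddAbove f X q) ⟨fun k => -b k, fun k => v k, fun k => ?_, ?_⟩
    · have h1 := Int.ceil_le.1 (hv k).1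
      have h2 := Int.le_floor.1 (hv k).2
      exact abs_le.2 ⟨h1, h2⟩
    · simp only [Int.floor_intCast, F]
  · intro j
    have h1 : ‖z j ⌊X j⌋‖ = 1 := Complex.norm_exp_ofReal_mul_I _
    have h2 : ∀ v : ℤ, ‖z j v - z j (v + 1)‖ ≤ |η j| := by
      intro v
      have : z j v - z j (v + 1) = -(z j v * (Complex.exp (Complex.I * ((-η j : ℝ) : ℂ)) - 1)) := by
        simp only [z]
        rw [mul_sub, ← Complex.exp_add]
        push_cast
        ring_nf
      rw [this, norm_neg, norm_mul, Complex.norm_exp_ofReal_mul_I, one_mul]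
      refine (Real.norm_exp_I_mul_ofReal_sub_one_le).trans (by simp)
    rw [h1]
    gcongr
    calc _ ≤ ∑ v ∈ Finset.Ico ⌈-X j⌉ ⌊X j⌋, |η j| := Finset.sum_le_sum fun v _ => h2 v
      _ = ((⌊X j⌋ - ⌈-X j⌉ : ℤ) : ℝ) * |η j| := by
          rw [Finset.sum_const, Int.card_Ico, nsmul_eq_mul]
          congr 1
          have := hAB j
          exact_mod_cast Int.toNat_of_nonneg (by omega)
      _ ≤ _ := by
          gcongr
          push_cast
          linarith [Int.floor_le (X j), Int.le_ceil (-X j)]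

theorem expSumSup_nonneg (f : (Fin m → ℤ) → ℂ) (X : Fin m → ℝ) (q : Fin m → ℤ) :
    0 ≤ expSumSup f X q := by
  refine Real.sSup_nonneg ?_
  rintro s ⟨b, v, -, rfl⟩
  exact norm_nonneg _

/-- Cramer's rule: the determinant times `ω.1` is `l₁^e · low - l₂^e · high`, and times `ω.2` it is
`n₁^e · low - n₂^e · high`. -/
theorem norm_pairDet_smul_le {e : ℕ} {n l : ℤ × ℤ} {x δ : ℝ}
    (hn1 : |(n.1 : ℝ)| ≤ x) (hn2 : |(n.2 : ℝ)| ≤ x) (hl1 : |(l.1 : ℝ)| ≤ x) (hl2 : |(l.2 : ℝ)| ≤ x)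
    {ω : Circ × Circ} (hlow : ‖lowArg e n l ω‖ ≤ δ) (hhigh : ‖highArg e n l ω‖ ≤ δ) :
    ‖pairDet e n l • ω.1‖ ≤ 2 * x ^ e * δ ∧ ‖pairDet e n l • ω.2‖ ≤ 2 * x ^ e * δ := by
  have hx : 0 ≤ x := (abs_nonneg _).trans hn1
  have hb : ∀ a b : ℤ, |(a : ℝ)| ≤ x → |(b : ℝ)| ≤ x →
      ‖(a ^ e) • lowArg e n l ω - (b ^ e) • highArg e n l ω‖ ≤ 2 * x ^ e * δ := by
    intro a b ha hb
    have h1 : ∀ (a : ℤ) (α : Circ), |(a : ℝ)| ≤ x → ‖α‖ ≤ δ → ‖(a ^ e) • α‖ ≤ x ^ e * δ := by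
      intro a α ha hα
      refine (norm_zsmul_le (a ^ e) α).trans ?_
      have : ‖a ^ e‖ ≤ x ^ e := by
        rw [Int.norm_eq_abs]; push_cast; rw [abs_pow]; gcongr
      gcongr
    refine (norm_sub_le _ _).trans ?_
    linarith [h1 a _ ha hlow, h1 b _ hb hhigh]
  constructor
  · convert hb l.1 l.2 hl1 hl2 using 2
    simp only [lowArg, highArg, linArg, monom, pairDet, pow_zero, Nat.sub_zero, Nat.sub_self,
      one_mul, mul_one, smul_sub, smul_smul, sub_smul, mul_pow]
    rw [mul_comm (n.2 ^ e) (l.1 ^ e), mul_comm (n.1 ^ e) (l.2 ^ e), mul_comm (l.1 ^ e) (l.2 ^ e)]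
    abel
  · convert hb n.1 n.2 hn1 hn2 using 2
    simp only [lowArg, highArg, linArg, monom, pairDet, pow_zero, Nat.sub_zero, Nat.sub_self,
      one_mul, mul_one, smul_sub, smul_smul, sub_smul, mul_pow]
    rw [mul_comm (n.1 ^ e) (n.2 ^ e)]
    abel

end

/-! ### From the box of forms to the kernel measure -/

noncomputable section

variable {m : ℕ}

section family

variable {K : ℝ → Circ → ℝ} {c₀ β₀ β H : ℝ}

/-- The Fourier coefficients of `K_H` as real numbers. -/
def realCoeff (K : ℝ → Circ → ℝ) (H : ℝ) (n : ℤ) : ℝ := (kernelCoeff K H n).re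

theorem integral_haarCirc_eq_one (hK : IsPositiveSummabilityKernel K) (hH : 1 ≤ H) :
    ∫ α, K H α ∂haarCirc = 1 := by
  rw [AddCircle.integral_haarAddCircle, smul_eq_mul, ← hK.normalised H hH, one_div]

theorem realCoeff_le_one (hK : IsPositiveSummabilityKernel K) (hH : 1 ≤ H) (n : ℤ) :
    realCoeff K H n ≤ 1 := by
  refine (Complex.re_le_norm _).trans ?_
  rw [kernelCoeff, fourierCoeff]
  refine (norm_integral_le_integral_norm _).trans (le_of_eq ?_)
  rw [← integral_haarCirc_eq_one hK hH]
  refine integral_congr_ae (Eventually.of_forall fun α => ?_)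
  simp only [norm_smul]
  rw [norm_fourier_apply, one_mul, Complex.norm_real, Real.norm_of_nonneg (hK.nonneg H hH α)]

theorem isWeight_realCoeff (hK : IsPositiveSummabilityKernel K) (hlow : CoeffLowerBound K c₀)
    (hdec : CoeffDecay K β₀ β) (hH : 1 ≤ H) : IsWeight (realCoeff K H) H β₀ β where
  nonneg n := (hlow H hH n).2.1
  le_one n := realCoeff_le_one hK hH n
  decay n := hdec H hH n

theorem kernelCoeff_eq (hlow : CoeffLowerBound K c₀) (hH : 1 ≤ H) (n : ℤ) :
    kernelCoeff K H n = realCoeff K H n :=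
  Complex.ext (by simp [realCoeff]) (by simpa using (hlow H hH n).1)

/-- Inversion at `α = 0` says that the non-negative coefficients are summable. Hence the Fourier
series converges uniformly, and `K_H` is continuous. -/
theorem isKernelOf_realCoeff (hK : IsPositiveSummabilityKernel K) (hlow : CoeffLowerBound K c₀)
    (hinv : FourierInversion K) (hH : 1 ≤ H) [IsFiniteMeasure (wMeasure (realCoeff K H))] :
    IsKernelOf (K H) (realCoeff K H) := by
  have hk0 : ∀ n, 0 ≤ realCoeff K H n := fun n => (hlow H hH n).2.1
  have hsum : Summable (realCoeff K H) := by
    have := (hinv H hH 0).summable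
    simp only [fourier_eval_zero, mul_one, kernelCoeff_eq hlow hH] at this
    exact_mod_cast this
  have hKeq : ∀ α, (K H α : ℂ) = ∑' n : ℤ, (realCoeff K H n : ℂ) * fourier n α := by
    intro α
    rw [← (hinv H hH α).tsum_eq]
    simp_rw [kernelCoeff_eq hlow hH]
  refine ⟨hK.nonneg H hH, ?_, integral_haarCirc_eq_one hK hH, fun α => ?_⟩
  · have hc : Continuous fun α : Circ => ∑' n : ℤ, (realCoeff K H n : ℂ) * (fourier n α : ℂ) := by
      refine continuous_tsum (u := realCoeff K H) (fun n => by fun_prop) hsum fun n α => ?_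
      rw [norm_mul, norm_fourier_apply, mul_one, Complex.norm_real, Real.norm_of_nonneg (hk0 n)]
    have : K H = fun α : Circ => (∑' n : ℤ, (realCoeff K H n : ℂ) * (fourier n α : ℂ)).re := by
      funext α; rw [← hKeq, Complex.ofReal_re]
    rw [this]
    exact Complex.continuous_re.comp hc
  · have hint : Integrable (fun n : ℤ => (fourier n α : ℂ)) (wMeasure (realCoeff K H)) :=
      Integrable.of_bound (C := 1) Measurable.of_discrete.aestronglyMeasurable
        (Eventually.of_forall fun n => (norm_fourier_apply n α).le)
    rw [integral_countable hint, hKeq]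
    refine tsum_congr fun n => ?_
    rw [measureReal_def, wMeasure_singleton, ENNReal.toReal_ofReal (hk0 n), Complex.real_smul]

theorem tailMass_eq (K : ℝ → Circ → ℝ) (H δ : ℝ) :
    tailMass (K H) δ = (2 * Real.pi)⁻¹ * kernelTail K H δ := by
  rw [tailMass, AddCircle.integral_haarAddCircle, smul_eq_mul,
    integral_indicator (measurableSet_norm_lt δ), kernelTail]

end family

theorem norm_truncate_le (f : (Fin m → ℤ) → ℂ) (X : Fin m → ℝ) (u : Fin m → ℤ) :
    ‖truncate f X u‖ ≤ ∑ u ∈ symmBox X, ‖f u‖ := by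
  rw [truncate]
  split_ifs with h
  · exact Finset.single_le_sum (f := fun u => ‖f u‖) (fun _ _ => norm_nonneg _) h
  · rw [norm_zero]; exact Finset.sum_nonneg fun _ _ => norm_nonneg _

/-- The correlation of the truncations at two points. -/
def correlation (k : ℤ → ℝ) (d : Fin m → ℕ) (f : (Fin m → ℤ) → ℂ) (X : Fin m → ℝ)
    (n l : ℤ × ℤ) : ℂ :=
  ∫ F, truncate f X (evalTuple F n) * (starRingEnd ℂ) (truncate f X (evalTuple F l))
    ∂tupleMeasure k d

/-- The second moment of the truncation at a point. -/
def squareMean (k : ℤ → ℝ) (d : Fin m → ℕ) (f : (Fin m → ℤ) → ℂ) (X : Fin m → ℝ)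
    (n : ℤ × ℤ) : ℝ :=
  ∫ F, ‖truncate f X (evalTuple F n)‖ ^ 2 ∂tupleMeasure k d

section moments

variable {k : ℤ → ℝ} [IsFiniteMeasure (wMeasure k)] (d : Fin m → ℕ) (f : (Fin m → ℤ) → ℂ)
  (X : Fin m → ℝ)

theorem integrable_correlation (n l : ℤ × ℤ) :
    Integrable (fun F => truncate f X (evalTuple F n) *
      (starRingEnd ℂ) (truncate f X (evalTuple F l))) (tupleMeasure k d) := by
  refine Integrable.of_bound (C := (∑ u ∈ symmBox X, ‖f u‖) * ∑ u ∈ symmBox X, ‖f u‖)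
    Measurable.of_discrete.aestronglyMeasurable (Eventually.of_forall fun F => ?_)
  rw [norm_mul, RCLike.norm_conj]
  exact mul_le_mul (norm_truncate_le _ _ _) (norm_truncate_le _ _ _) (norm_nonneg _)
    (Finset.sum_nonneg fun _ _ => norm_nonneg _)

theorem integrable_squareMean (n : ℤ × ℤ) :
    Integrable (fun F => ‖truncate f X (evalTuple F n)‖ ^ 2) (tupleMeasure k d) := by
  refine Integrable.of_bound (C := (∑ u ∈ symmBox X, ‖f u‖) ^ 2)
    Measurable.of_discrete.aestronglyMeasurable (Eventually.of_forall fun F => ?_)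
  rw [Real.norm_of_nonneg (by positivity)]
  exact pow_le_pow_left₀ (norm_nonneg _) (norm_truncate_le _ _ _) 2

theorem norm_correlation_le (n l : ℤ × ℤ) :
    ‖correlation k d f X n l‖ ≤ (squareMean k d f X n + squareMean k d f X l) / 2 := by
  rw [squareMean, squareMean,
    ← integral_add (integrable_squareMean d f X n) (integrable_squareMean d f X l),
    ← integral_div]
  refine norm_integral_le_of_norm_le
    (((integrable_squareMean d f X n).add (integrable_squareMean d f X l)).div_const 2)
    (Eventually.of_forall fun F => ?_)
  rw [norm_mul, RCLike.norm_conj]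
  nlinarith [sq_nonneg (‖truncate f X (evalTuple F n)‖ - ‖truncate f X (evalTuple F l)‖)]

theorem integral_norm_sq_le (s : Finset (ℤ × ℤ)) (a : ℤ × ℤ → ℂ) (ha : ∀ n, ‖a n‖ ≤ 1) :
    ∫ F, ‖∑ n ∈ s, a n * truncate f X (evalTuple F n)‖ ^ 2 ∂tupleMeasure k d
      ≤ ∑ p ∈ s ×ˢ s, ‖correlation k d f X p.1 p.2‖ := by
  have h1 : ((∫ F, ‖∑ n ∈ s, a n * truncate f X (evalTuple F n)‖ ^ 2 ∂tupleMeasure k d : ℝ) : ℂ)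
      = ∑ p ∈ s ×ˢ s, a p.1 * (starRingEnd ℂ) (a p.2) * correlation k d f X p.1 p.2 := by
    rw [← integral_complex_ofReal]
    simp_rw [correlation, ← integral_const_mul]
    rw [← integral_finsetSum _ fun p _ => (integrable_correlation d f X p.1 p.2).const_mul _]
    refine integral_congr_ae (Eventually.of_forall fun F => ?_)
    simp only
    rw [Complex.ofReal_pow, ← Complex.mul_conj', map_sum, Finset.sum_mul_sum, Finset.sum_product]
    refine Finset.sum_congr rfl fun n _ => Finset.sum_congr rfl fun l _ => ?_
    rw [map_mul]; ring
  have h2 : ‖((∫ F, ‖∑ n ∈ s, a n * truncate f X (evalTuple F n)‖ ^ 2 ∂tupleMeasure k d : ℝ) : ℂ)‖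
      ≤ ∑ p ∈ s ×ˢ s, ‖correlation k d f X p.1 p.2‖ := by
    rw [h1]
    refine norm_sum_le_of_le _ fun p _ => ?_
    rw [norm_mul, norm_mul, RCLike.norm_conj]
    calc _ ≤ 1 * 1 * ‖correlation k d f X p.1 p.2‖ := by gcongr <;> exact ha _
      _ = _ := by ring
  rw [Complex.norm_real] at h2
  exact (le_abs_self _).trans h2

end moments

/-- The truncation parameters. -/
def sizeBound (d : Fin m → ℕ) (x H : ℝ) (j : Fin m) : ℝ := (1 + (d j : ℝ)) * x ^ d j * H

theorem mem_intBox {x : ℝ} {n : ℤ × ℤ} :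
    n ∈ intBox x ↔ |(n.1 : ℝ)| ≤ x ∧ |(n.2 : ℝ)| ≤ x := by
  have h : ∀ a : ℤ, (-⌊x⌋ ≤ a ∧ a ≤ ⌊x⌋) ↔ |(a : ℝ)| ≤ x := by
    intro a
    rw [abs_le, Int.le_floor, neg_le, Int.le_floor]
    push_cast
    constructor <;> rintro ⟨h1, h2⟩ <;> exact ⟨by linarith, h2⟩
  rw [intBox, Finset.mem_product, Finset.mem_Icc, Finset.mem_Icc, h, h]

theorem abs_evalForm_le {e : ℕ} {c : Fin (e + 1) → ℤ} {H x : ℝ} (hx : 0 ≤ x)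
    (hc : ∀ i, |(c i : ℝ)| ≤ H) {n : ℤ × ℤ} (hn : n ∈ intBox x) :
    |(evalForm c n : ℝ)| ≤ (1 + (e : ℝ)) * x ^ e * H := by
  obtain ⟨h1, h2⟩ := mem_intBox.1 hn
  rw [evalForm]
  push_cast
  refine (Finset.abs_sum_le_sum_abs _ _).trans ?_
  calc _ ≤ ∑ i : Fin (e + 1), H * x ^ e := by
        refine Finset.sum_le_sum fun i _ => ?_
        have : x ^ e = x ^ (i : ℕ) * x ^ (e - (i : ℕ)) := by
          rw [← pow_add]; congr 1; have := i.2; omega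
        have hH : 0 ≤ H := (abs_nonneg _).trans (hc i)
        rw [this, abs_mul, abs_mul, abs_pow, abs_pow, mul_assoc]
        gcongr
        exact hc i
    _ = _ := by
        rw [Finset.sum_const, Finset.card_univ, Fintype.card_fin, nsmul_eq_mul]
        push_cast; ring

theorem evalTuple_mem_symmBox {d : Fin m → ℕ} {F : (j : Fin m) → Fin (d j + 1) → ℤ} {x H : ℝ}
    (hx : 0 ≤ x) (hF : F ∈ formBox d H) {n : ℤ × ℤ} (hn : n ∈ intBox x) :
    evalTuple F n ∈ symmBox (sizeBound d x H) := by
  rw [mem_symmBox]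
  intro j
  refine abs_evalForm_le hx (fun i => ?_) hn
  simp only [formBox, Fintype.mem_piFinset, Finset.mem_Icc] at hF
  obtain ⟨h1, h2⟩ := hF j i
  rw [Int.le_floor] at h2
  rw [neg_le, Int.le_floor] at h1
  push_cast at h1
  exact abs_le.2 ⟨by linarith, h2⟩

theorem le_card_formBox (d : Fin m → ℕ) {H : ℝ} (hH : 1 ≤ H) :
    ∏ j, H ^ (d j + 1) ≤ ((formBox d H).card : ℝ) := by
  have hfl : H ≤ ((⌊H⌋ + 1 - -⌊H⌋).toNat : ℝ) := by
    have h1 : 1 ≤ ⌊H⌋ := Int.le_floor.2 (by simpa using hH)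
    have h2 : ((⌊H⌋ + 1 - -⌊H⌋).toNat : ℤ) = ⌊H⌋ + 1 - -⌊H⌋ := Int.toNat_of_nonneg (by omega)
    have h3 : ((⌊H⌋ + 1 - -⌊H⌋).toNat : ℝ) = ((⌊H⌋ + 1 - -⌊H⌋ : ℤ) : ℝ) := by exact_mod_cast h2
    rw [h3]
    push_cast
    have : (1 : ℝ) ≤ (⌊H⌋ : ℝ) := by exact_mod_cast h1
    linarith [Int.lt_floor_add_one H]
  rw [formBox, Fintype.card_piFinset]
  simp_rw [Fintype.card_piFinset, Int.card_Icc]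
  push_cast
  refine Finset.prod_le_prod (fun j _ => by positivity) fun j _ => ?_
  rw [Finset.prod_const, Finset.card_univ, Fintype.card_fin]
  gcongr

/-- Each form of the box has mass at least the product of the `c₀^(d_j+1)`, and on the box the
truncation does not change `f`. By positivity the sum over the box extends to the full integral, in
which the square is expanded. -/
theorem secondMoment_le_sum_correlation {k : ℤ → ℝ} [IsFiniteMeasure (wMeasure k)] {c₀ x H : ℝ}
    (hc₀ : 0 < c₀) (hx : 0 ≤ x) (hH : 1 ≤ H) (hk : ∀ n : ℤ, |(n : ℝ)| ≤ H → c₀ ≤ k n)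
    (d : Fin m → ℕ) (f : (Fin m → ℤ) → ℂ) (a : ℤ × ℤ → ℂ) (ha : ∀ n, ‖a n‖ ≤ 1) :
    secondMoment d f a x H ≤ (∏ j, H ^ (d j + 1))⁻¹ * (∏ j, c₀ ^ (d j + 1))⁻¹ *
      ∑ p ∈ intBox x ×ˢ intBox x, ‖correlation k d f (sizeBound d x H) p.1 p.2‖ := by
  have hHp : 0 < ∏ j, H ^ (d j + 1) := Finset.prod_pos fun j _ => by positivity
  have hcp : 0 < ∏ j, c₀ ^ (d j + 1) := Finset.prod_pos fun j _ => by positivity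
  set g : ((j : Fin m) → Fin (d j + 1) → ℤ) → ℝ := fun F =>
    ‖∑ n ∈ intBox x, a n * truncate f (sizeBound d x H) (evalTuple F n)‖ ^ 2
  have hg0 : ∀ F, 0 ≤ g F := fun F => by positivity
  have hgint : Integrable g (tupleMeasure k d) := by
    refine Integrable.of_bound
      (C := (∑ n ∈ intBox x, ∑ u ∈ symmBox (sizeBound d x H), ‖f u‖) ^ 2)
      Measurable.of_discrete.aestronglyMeasurable (Eventually.of_forall fun F => ?_)
    rw [Real.norm_of_nonneg (hg0 F)]
    refine pow_le_pow_left₀ (norm_nonneg _) (norm_sum_le_of_le _ fun n _ => ?_) 2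
    rw [norm_mul]
    calc _ ≤ 1 * ∑ u ∈ symmBox (sizeBound d x H), ‖f u‖ :=
          mul_le_mul (ha n) (norm_truncate_le _ _ _) (norm_nonneg _) zero_le_one
      _ = _ := one_mul _
  have hval : ∀ F ∈ formBox d H,
      ‖∑ n ∈ intBox x, a n * f (fun j => evalForm (F j) n)‖ ^ 2 = g F := by
    intro F hF
    simp only [g]
    congr 2
    refine Finset.sum_congr rfl fun n hn => ?_
    rw [truncate, if_pos (evalTuple_mem_symmBox hx hF hn)]
    rfl
  have hmass : ∀ F ∈ formBox d H, ∏ j, c₀ ^ (d j + 1) ≤ (tupleMeasure k d).real {F} := by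
    intro F hF
    have hF' : ∀ j i, c₀ ≤ k (F j i) := by
      intro j i
      refine hk _ ?_
      simp only [formBox, Fintype.mem_piFinset, Finset.mem_Icc] at hF
      obtain ⟨h1, h2⟩ := hF j i
      rw [Int.le_floor] at h2
      rw [neg_le, Int.le_floor] at h1
      push_cast at h1
      exact abs_le.2 ⟨by linarith, h2⟩
    rw [measureReal_def, tupleMeasure, Measure.pi_singleton, ENNReal.toReal_prod]
    refine Finset.prod_le_prod (fun j _ => by positivity) fun j _ => ?_
    rw [coeffMeasure, Measure.pi_singleton, ENNReal.toReal_prod]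
    calc c₀ ^ (d j + 1) = ∏ _i : Fin (d j + 1), c₀ := by simp
      _ ≤ _ := by
        refine Finset.prod_le_prod (fun i _ => hc₀.le) fun i _ => ?_
        rw [wMeasure_singleton, ENNReal.toReal_ofReal (hc₀.le.trans (hF' j i))]
        exact hF' j i
  have hsum : (∏ j, c₀ ^ (d j + 1)) * ∑ F ∈ formBox d H, g F ≤ ∫ F, g F ∂tupleMeasure k d := by
    calc _ ≤ ∑ F ∈ formBox d H, (tupleMeasure k d).real {F} * g F := by
          rw [Finset.mul_sum]
          exact Finset.sum_le_sum fun F hF => mul_le_mul_of_nonneg_right (hmass F hF) (hg0 F)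
      _ = ∫ F in (formBox d H : Set ((j : Fin m) → Fin (d j + 1) → ℤ)), g F ∂tupleMeasure k d := by
          rw [setIntegral_finset _ hgint.integrableOn]
          rfl
      _ ≤ _ := setIntegral_le_integral hgint (Eventually.of_forall hg0)
  rw [secondMoment, Finset.sum_congr rfl hval]
  calc _ ≤ (∏ j, H ^ (d j + 1))⁻¹ * ∑ F ∈ formBox d H, g F := by
        rw [one_div]
        refine mul_le_mul_of_nonneg_right (inv_anti₀ hHp (le_card_formBox d hH))
          (Finset.sum_nonneg fun F _ => hg0 F)
    _ ≤ (∏ j, H ^ (d j + 1))⁻¹ * ((∏ j, c₀ ^ (d j + 1))⁻¹ * ∫ F, g F ∂tupleMeasure k d) := by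
        gcongr
        rw [inv_mul_eq_div, le_div_iff₀ hcp, mul_comm]
        exact hsum
    _ ≤ _ := by
        rw [mul_assoc]
        gcongr
        exact integral_norm_sq_le d f _ _ a ha

end

/-! ### Counting exceptional pairs, weighted by common divisors -/

noncomputable section

variable {m : ℕ}

/-- A divisor weight of the common divisors of the coordinates of `n`. -/
def gcdWeight (M : ℕ) (x : ℝ) (n : ℤ × ℤ) : ℝ :=
  ∑ g ∈ Finset.Ioc 0 ⌊x⌋₊, if (g : ℤ) ∣ n.1 ∧ (g : ℤ) ∣ n.2 then (kDiv M g : ℝ) else 0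

theorem gcdWeight_nonneg (M : ℕ) (x : ℝ) (n : ℤ × ℤ) : 0 ≤ gcdWeight M x n :=
  Finset.sum_nonneg fun g _ => by split_ifs <;> positivity

theorem kDiv_le_gcdWeight (M : ℕ) {x : ℝ} {n : ℤ × ℤ} {g : ℕ} (hg : g ≠ 0) (hgx : (g : ℝ) ≤ x)
    (h1 : (g : ℤ) ∣ n.1) (h2 : (g : ℤ) ∣ n.2) : (kDiv M g : ℝ) ≤ gcdWeight M x n := by
  refine le_trans (le_of_eq ?_) (Finset.single_le_sum
    (f := fun g : ℕ => if (g : ℤ) ∣ n.1 ∧ (g : ℤ) ∣ n.2 then (kDiv M g : ℝ) else 0)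
    (fun g _ => by split_ifs <;> positivity)
    (Finset.mem_Ioc.2 ⟨Nat.pos_of_ne_zero hg, Nat.le_floor hgx⟩))
  simp [h1, h2]

/-- The integers of absolute value at most `x`. -/
def intSeg (x : ℝ) : Finset ℤ := Finset.Icc (-⌊x⌋) ⌊x⌋

theorem mem_intSeg {x : ℝ} {a : ℤ} : a ∈ intSeg x ↔ |(a : ℝ)| ≤ x := by
  rw [intSeg, Finset.mem_Icc, abs_le, Int.le_floor, neg_le, Int.le_floor]
  push_cast
  constructor <;> rintro ⟨h1, h2⟩ <;> exact ⟨by linarith, h2⟩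

theorem card_real_interval_le {u v : ℝ} (huv : u ≤ v) (s : Finset ℤ)
    (hs : ∀ a ∈ s, u ≤ (a : ℝ) ∧ (a : ℝ) ≤ v) : (s.card : ℝ) ≤ v - u + 2 := by
  have h := card_modEq_le one_pos huv 0
  simp only [Nat.cast_one, div_one] at h
  refine le_trans ?_ h
  refine Nat.cast_le.2 (Finset.card_le_card fun a ha => ?_)
  simp [Int.ceil_le, Int.le_floor, hs a ha, Int.modEq_one]

theorem card_dvd_le {z : ℝ} (hz : 0 ≤ z) {g : ℕ} (hg : 0 < g) (s : Finset ℤ)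
    (hs : ∀ a ∈ s, |(a : ℝ)| ≤ z ∧ (g : ℤ) ∣ a) : (s.card : ℝ) ≤ 2 * z / g + 2 := by
  have h := card_modEq_le hg (show -z ≤ z by linarith) 0
  refine le_trans ?_ (h.trans (le_of_eq (by ring)))
  refine Nat.cast_le.2 (Finset.card_le_card fun a ha => ?_)
  obtain ⟨h1, h2⟩ := hs a ha
  rw [abs_le] at h1
  simp only [Finset.mem_filter, Finset.mem_Icc, Int.ceil_le, Int.le_floor]
  exact ⟨h1, Int.modEq_zero_iff_dvd.2 h2⟩

theorem sum_mul_gcdWeight (M : ℕ) (x : ℝ) (φ ψ : ℤ → ℝ) :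
    ∑ n ∈ intBox x, φ n.1 * ψ n.2 * gcdWeight M x n
      = ∑ g ∈ Finset.Ioc 0 ⌊x⌋₊, (kDiv M g : ℝ) *
          ((∑ a ∈ (intSeg x).filter fun a => (g : ℤ) ∣ a, φ a) *
            ∑ b ∈ (intSeg x).filter fun b => (g : ℤ) ∣ b, ψ b) := by
  simp only [gcdWeight]
  rw [Finset.sum_congr rfl fun n _ => Finset.mul_sum _ _ _, Finset.sum_comm]
  refine Finset.sum_congr rfl fun g _ => ?_
  rw [Finset.sum_mul_sum, Finset.sum_filter]
  simp_rw [Finset.sum_filter]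
  rw [intBox, Finset.sum_product, Finset.mul_sum]
  refine Finset.sum_congr rfl fun a _ => ?_
  split_ifs with ha
  · rw [Finset.mul_sum]
    refine Finset.sum_congr rfl fun b _ => ?_
    by_cases hb : (g : ℤ) ∣ b
    · simp only [ha, hb, and_self, if_true]; ring
    · simp [hb]
  · simp [ha]

/-- The sum over `n` factors once the common divisor `g` is fixed. A single saving `1/g` is enough
for the sum over `g` to cost only logarithms. -/
theorem sum_mul_gcdWeight_le (M : ℕ) {x W : ℝ} (hx : 1 ≤ x) (hW : 0 ≤ W) (φ ψ : ℤ → ℝ)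
    (h : ∀ g : ℕ, 0 < g → (g : ℝ) ≤ x →
      (∑ a ∈ (intSeg x).filter fun a => (g : ℤ) ∣ a, φ a) *
        ∑ b ∈ (intSeg x).filter fun b => (g : ℤ) ∣ b, ψ b ≤ W / g) :
    ∑ n ∈ intBox x, φ n.1 * ψ n.2 * gcdWeight M x n ≤ W * (1 + Real.log x) ^ M := by
  rw [sum_mul_gcdWeight]
  have hfl : (⌊x⌋₊ : ℝ) ≤ x := Nat.floor_le (by linarith)
  have hfl1 : 1 ≤ ⌊x⌋₊ := Nat.le_floor (by simpa using hx)
  calc _ ≤ ∑ g ∈ Finset.Ioc 0 ⌊x⌋₊, W * ((kDiv M g : ℝ) / g) := by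
        refine Finset.sum_le_sum fun g hg => ?_
        obtain ⟨h1, h2⟩ := Finset.mem_Ioc.1 hg
        have := h g h1 (le_trans (by exact_mod_cast h2) hfl)
        calc _ ≤ (kDiv M g : ℝ) * (W / g) := by gcongr
          _ = _ := by ring
    _ ≤ W * (1 + Real.log ⌊x⌋₊) ^ M := by
        rw [← Finset.mul_sum]; gcongr; exact sum_kDiv_div_le M _
    _ ≤ _ := by
        have : (0 : ℝ) < ⌊x⌋₊ := by exact_mod_cast hfl1
        have := one_le_one_add_log ⌊x⌋₊
        gcongr

theorem sum_indicator_dvd_le {x z : ℝ} (hz : 0 ≤ z) {g : ℕ} (hg : 0 < g) :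
    ∑ a ∈ (intSeg x).filter (fun a => (g : ℤ) ∣ a), (if |(a : ℝ)| ≤ z then (1 : ℝ) else 0)
      ≤ 2 * z / g + 2 := by
  rw [← Finset.sum_filter, Finset.sum_const, nsmul_eq_mul, mul_one]
  refine card_dvd_le hz hg _ fun a ha => ?_
  simp only [Finset.mem_filter] at ha
  exact ⟨ha.2, ha.1.2⟩

theorem sum_one_dvd_le {x : ℝ} {g : ℕ} (hg : 0 < g) (hgx : (g : ℝ) ≤ x) :
    ∑ _a ∈ (intSeg x).filter (fun a => (g : ℤ) ∣ a), (1 : ℝ) ≤ 4 * x / g := by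
  have hg' : (0 : ℝ) < g := by exact_mod_cast hg
  have hx : 0 ≤ x := hg'.le.trans hgx
  rw [Finset.sum_const, nsmul_eq_mul, mul_one]
  refine (card_dvd_le hx hg _ fun a ha => ?_).trans ?_
  · simp only [Finset.mem_filter] at ha
    exact ⟨mem_intSeg.1 ha.1, ha.2⟩
  · have : 1 ≤ x / g := (one_le_div hg').2 hgx
    have h2 : 4 * x / g = 2 * x / g + 2 * (x / g) := by ring
    linarith

theorem sum_intSeg_natAbs_le (φ : ℕ → ℝ) (hφ : ∀ n, 0 ≤ φ n) (x : ℝ) :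
    ∑ a ∈ intSeg x, φ a.natAbs ≤ φ 0 + 2 * ∑ n ∈ Finset.Ioc 0 ⌊x⌋₊, φ n := by
  have hsub : intSeg x ⊆ insert 0 ((Finset.Ioc 0 ⌊x⌋₊).image (fun n : ℕ => (n : ℤ)) ∪
      (Finset.Ioc 0 ⌊x⌋₊).image (fun n : ℕ => -(n : ℤ))) := by
    intro a ha
    have ha' := mem_intSeg.1 ha
    rcases eq_or_ne a 0 with rfl | h0
    · simp
    · have hn : a.natAbs ∈ Finset.Ioc 0 ⌊x⌋₊ :=
        Finset.mem_Ioc.2 ⟨Int.natAbs_pos.2 h0, Nat.le_floor (by rwa [Nat.cast_natAbs, Int.cast_abs])⟩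
      refine Finset.mem_insert_of_mem ?_
      rcases Int.natAbs_eq a with h | h
      · exact Finset.mem_union_left _ (Finset.mem_image.2 ⟨_, hn, h.symm⟩)
      · exact Finset.mem_union_right _ (Finset.mem_image.2 ⟨_, hn, h.symm⟩)
  calc _ ≤ _ := Finset.sum_le_sum_of_subset_of_nonneg hsub fun _ _ _ => hφ _
    _ = φ 0 + ∑ a ∈ (Finset.Ioc 0 ⌊x⌋₊).image (fun n : ℕ => (n : ℤ)) ∪
          (Finset.Ioc 0 ⌊x⌋₊).image (fun n : ℕ => -(n : ℤ)), φ a.natAbs := by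
        rw [Finset.sum_insert (by simp), Int.natAbs_zero]
    _ ≤ φ 0 + (∑ a ∈ (Finset.Ioc 0 ⌊x⌋₊).image (fun n : ℕ => (n : ℤ)), φ a.natAbs +
          ∑ a ∈ (Finset.Ioc 0 ⌊x⌋₊).image (fun n : ℕ => -(n : ℤ)), φ a.natAbs) := by
        rw [← Finset.sum_union_inter]
        gcongr
        exact le_add_of_nonneg_right (Finset.sum_nonneg fun _ _ => hφ _)
    _ = _ := by
        rw [Finset.sum_image (by intro a _ b _ h; simpa using h),
          Finset.sum_image (by intro a _ b _ h; simpa using h), two_mul]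
        simp

theorem sum_inv_abs_le {x : ℝ} (hx : 1 ≤ x) {g : ℕ} :
    ∑ a ∈ (intSeg x).filter (fun a => (g : ℤ) ∣ a), |(a : ℝ)|⁻¹ ≤ 2 * (1 + Real.log x) := by
  have hfl : (⌊x⌋₊ : ℝ) ≤ x := Nat.floor_le (by linarith)
  have hfl1 : 1 ≤ ⌊x⌋₊ := Nat.le_floor (by simpa using hx)
  have hlog : 1 + Real.log ⌊x⌋₊ ≤ 1 + Real.log x := by
    have : (0 : ℝ) < ⌊x⌋₊ := by exact_mod_cast hfl1
    gcongr
  have h := sum_intSeg_natAbs_le (fun n => (n : ℝ)⁻¹) (fun n => by positivity) x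
  simp only [Nat.cast_zero, inv_zero, zero_add, Nat.cast_natAbs, Int.cast_abs] at h
  calc _ ≤ ∑ a ∈ intSeg x, |(a : ℝ)|⁻¹ :=
        Finset.sum_le_sum_of_subset_of_nonneg (Finset.filter_subset _ _) fun _ _ _ => by positivity
    _ ≤ 2 * ∑ n ∈ Finset.Ioc 0 ⌊x⌋₊, (n : ℝ)⁻¹ := h
    _ ≤ _ := by
        gcongr
        exact (sum_inv_le_log _).trans hlog

theorem card_intBox_restrict_le {x z : ℝ} (hx : 1 ≤ x) (hz : 1 ≤ z) (s : Finset (ℤ × ℤ))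
    (hs : ∀ n ∈ s, (|(n.1 : ℝ)| ≤ x ∧ |(n.2 : ℝ)| ≤ z) ∨ |(n.1 : ℝ)| ≤ z ∧ |(n.2 : ℝ)| ≤ x) :
    (s.card : ℝ) ≤ 32 * (x * z) := by
  have hsub : s ⊆ (intSeg x ×ˢ intSeg z) ∪ (intSeg z ×ˢ intSeg x) := by
    intro n hn
    simpa [Finset.mem_union, Finset.mem_product, mem_intSeg] using hs n hn
  have hc : ∀ y : ℝ, 1 ≤ y → ((intSeg y).card : ℝ) ≤ 4 * y := by
    intro y hy
    refine (card_real_interval_le (u := -y) (v := y) (by linarith) _ fun a ha => ?_).trans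
      (by linarith)
    exact abs_le.1 (mem_intSeg.1 ha)
  calc (s.card : ℝ) ≤ (((intSeg x ×ˢ intSeg z) ∪ (intSeg z ×ˢ intSeg x)).card : ℝ) := by
        exact_mod_cast Finset.card_le_card hsub
    _ ≤ ((intSeg x ×ˢ intSeg z).card : ℝ) + ((intSeg z ×ˢ intSeg x).card : ℝ) := by
        exact_mod_cast Finset.card_union_le _ _
    _ = 2 * (((intSeg x).card : ℝ) * ((intSeg z).card : ℝ)) := by
        rw [Finset.card_product, Finset.card_product]; push_cast; ring
    _ ≤ 2 * ((4 * x) * (4 * z)) := by gcongr <;> exact hc _ ‹_›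
    _ = _ := by ring

/-- For each sign of `a` the condition describes an interval of length `2Y/|n₂|`. -/
theorem card_near_le {n : ℤ × ℤ} (hn : n.2 ≠ 0) (b : ℤ) {Y : ℝ} (hY : 0 ≤ Y) (s : Finset ℤ)
    (hs : ∀ a ∈ s, |(|((n.2 * a : ℤ) : ℝ)| - |((n.1 * b : ℤ) : ℝ)|)| ≤ Y) :
    (s.card : ℝ) ≤ 4 * (Y * |(n.2 : ℝ)|⁻¹ + 1) := by
  set t := |(n.2 : ℝ)|
  have ht : 0 < t := abs_pos.2 (by exact_mod_cast hn)
  set c := |((n.1 * b : ℤ) : ℝ)|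
  have h1 : ∀ a ∈ s, c - Y ≤ t * |(a : ℝ)| ∧ t * |(a : ℝ)| ≤ c + Y := by
    intro a ha
    have := hs a ha
    rw [Int.cast_mul, abs_mul, abs_le] at this
    exact ⟨by linarith [this.1], by linarith [this.2]⟩
  have huv : (c - Y) / t ≤ (c + Y) / t := by gcongr; linarith
  have h2 := card_real_interval_le huv (s.filter fun a => 0 ≤ a) (by
    intro a ha
    obtain ⟨ha1, ha2⟩ := Finset.mem_filter.1 ha
    have h := h1 a ha1
    rw [abs_of_nonneg (by exact_mod_cast ha2)] at h
    rw [div_le_iff₀ ht, le_div_iff₀ ht]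
    constructor <;> linarith [h.1, h.2])
  have h3 := card_real_interval_le (u := -((c + Y) / t)) (v := -((c - Y) / t)) (by linarith)
    (s.filter fun a => ¬ 0 ≤ a) (by
    intro a ha
    obtain ⟨ha1, ha2⟩ := Finset.mem_filter.1 ha
    have h := h1 a ha1
    rw [abs_of_nonpos (by exact_mod_cast (not_le.1 ha2).le)] at h
    rw [neg_le, le_neg, div_le_iff₀ ht, le_div_iff₀ ht]
    constructor <;> linarith [h.1, h.2])
  have h4 : (s.card : ℝ) = ((s.filter fun a => 0 ≤ a).card : ℝ) +
      ((s.filter fun a => ¬ 0 ≤ a).card : ℝ) := by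
    exact_mod_cast (Finset.card_filter_add_card_filter_not _).symm
  have h5 : (c + Y) / t - (c - Y) / t = 2 * (Y * t⁻¹) := by ring
  rw [h4]
  linarith

/-- The exceptional pairs: a small coordinate, or a small determinant. -/
def IsExceptional (z Y : ℝ) (n l : ℤ × ℤ) : Prop :=
  |(n.1 : ℝ)| ≤ z ∨ |(n.2 : ℝ)| ≤ z ∨ |(l.1 : ℝ)| ≤ z ∨ |(l.2 : ℝ)| ≤ z ∨
    |(|((n.2 * l.1 : ℤ) : ℝ)| - |((n.1 * l.2 : ℤ) : ℝ)|)| ≤ Y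

theorem IsExceptional.symm {z Y : ℝ} {n l : ℤ × ℤ} (h : IsExceptional z Y n l) :
    IsExceptional z Y l n := by
  rcases h with h | h | h | h | h
  · exact Or.inr (Or.inr (Or.inl h))
  · exact Or.inr (Or.inr (Or.inr (Or.inl h)))
  · exact Or.inl h
  · exact Or.inr (Or.inl h)
  · refine Or.inr (Or.inr (Or.inr (Or.inr ?_)))
    rw [abs_sub_comm, mul_comm l.1, mul_comm l.2]; exact h

-- For each `n` the admissible `l` are counted, and the count is averaged against `gcdWeight`. The
-- counts for a small determinant contain `Y/|n₂|`; summing `1/|n₂|` costs the extra logarithm in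
-- the exponent `M + 1`.
open Classical in
theorem sum_exceptional_gcdWeight_le (M : ℕ) {x z Y : ℝ} (hx : 1 ≤ x) (hz : 1 ≤ z)
    (hY : x ≤ Y) :
    ∑ p ∈ (intBox x ×ˢ intBox x).filter (fun p => IsExceptional z Y p.1 p.2), gcdWeight M x p.1
      ≤ 2048 * (x ^ 3 * z + x ^ 2 * Y) * (1 + Real.log x) ^ (M + 1) := by
  set L := 1 + Real.log x
  have hL : 1 ≤ L := by simp only [L]; linarith [Real.log_nonneg hx]
  have hx0 : 0 < x := by linarith
  have hw := gcdWeight_nonneg M x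
  have hall : ∑ n ∈ intBox x, gcdWeight M x n ≤ 16 * x ^ 2 * L ^ M := by
    have := sum_mul_gcdWeight_le M hx (W := 16 * x ^ 2) (by positivity) (fun _ => 1) (fun _ => 1)
      (by
        intro g hg hgx
        have hg' : (1 : ℝ) ≤ g := by exact_mod_cast hg
        have h1 := sum_one_dvd_le hg hgx
        calc _ ≤ (4 * x / g) * (4 * x / g) := by gcongr
          _ = (16 * x ^ 2 / g) / g := by ring
          _ ≤ 16 * x ^ 2 / g := div_le_self (by positivity) hg')
    simpa using this
  have hsmall : ∀ g : ℕ, 0 < g → 2 * z / g + 2 ≤ 4 * z := by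
    intro g hg
    have hg' : (1 : ℝ) ≤ g := by exact_mod_cast hg
    have : 2 * z / g ≤ 2 * z := div_le_self (by positivity) hg'
    linarith
  have h1 : ∑ n ∈ intBox x, (if |(n.1 : ℝ)| ≤ z then 1 else 0) * 1 * gcdWeight M x n
      ≤ 16 * (x * z) * L ^ M := by
    refine sum_mul_gcdWeight_le M hx (by positivity) (fun a => if |(a : ℝ)| ≤ z then 1 else 0)
      (fun _ => 1) fun g hg hgx => ?_
    have ha := (sum_indicator_dvd_le (x := x) (by linarith : (0 : ℝ) ≤ z) hg).trans (hsmall g hg)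
    have hb := sum_one_dvd_le hg hgx
    calc _ ≤ (4 * z) * (4 * x / g) := by
          refine mul_le_mul ha hb (Finset.sum_nonneg fun _ _ => zero_le_one) (by positivity)
      _ = _ := by ring
  have h2 : ∑ n ∈ intBox x, 1 * (if |(n.2 : ℝ)| ≤ z then 1 else 0) * gcdWeight M x n
      ≤ 16 * (x * z) * L ^ M := by
    refine sum_mul_gcdWeight_le M hx (by positivity) (fun _ => 1)
      (fun a => if |(a : ℝ)| ≤ z then 1 else 0) fun g hg hgx => ?_
    have ha := (sum_indicator_dvd_le (x := x) (by linarith : (0 : ℝ) ≤ z) hg).trans (hsmall g hg)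
    have hb := sum_one_dvd_le hg hgx
    calc _ ≤ (4 * x / g) * (4 * z) := by
          refine mul_le_mul hb ha (Finset.sum_nonneg fun _ _ => ?_) (by positivity)
          split_ifs <;> norm_num
      _ = _ := by ring
  have h3 : ∑ n ∈ intBox x, 1 * |(n.2 : ℝ)|⁻¹ * gcdWeight M x n ≤ 8 * x * L * L ^ M := by
    refine sum_mul_gcdWeight_le M hx (by positivity) (fun _ => 1) (fun a => |(a : ℝ)|⁻¹)
      fun g hg hgx => ?_
    have ha := sum_inv_abs_le hx (g := g)
    have hb := sum_one_dvd_le hg hgx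
    calc _ ≤ (4 * x / g) * (2 * L) := by
          refine mul_le_mul hb ha (Finset.sum_nonneg fun _ _ => by positivity) (by positivity)
      _ = _ := by ring
  have hbox : ((intBox x).card : ℝ) ≤ 32 * (x * x) :=
    card_intBox_restrict_le hx hx _ fun n hn => Or.inl (mem_intBox.1 hn)
  have hlcard : (((intBox x).filter fun l => |(l.1 : ℝ)| ≤ z ∨ |(l.2 : ℝ)| ≤ z).card : ℝ)
      ≤ 32 * (x * z) := by
    refine card_intBox_restrict_le hx hz _ fun l hl => ?_
    obtain ⟨hl1, hl2⟩ := Finset.mem_filter.1 hl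
    obtain ⟨ha, hb⟩ := mem_intBox.1 hl1
    rcases hl2 with h | h
    exacts [Or.inr ⟨h, hb⟩, Or.inl ⟨ha, h⟩]
  have hseg : ((intSeg x).card : ℝ) ≤ 4 * x := by
    refine (card_real_interval_le (u := -x) (v := x) (by linarith) _ fun a ha => ?_).trans
      (by linarith)
    exact abs_le.1 (mem_intSeg.1 ha)
  have hdet : ∀ n : ℤ × ℤ, n.2 ≠ 0 →
      (((intBox x).filter fun l =>
        |(|((n.2 * l.1 : ℤ) : ℝ)| - |((n.1 * l.2 : ℤ) : ℝ)|)| ≤ Y).card : ℝ)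
      ≤ 16 * x * (Y * |(n.2 : ℝ)|⁻¹ + 1) := by
    intro n hn
    have : ((intBox x).filter fun l =>
        |(|((n.2 * l.1 : ℤ) : ℝ)| - |((n.1 * l.2 : ℤ) : ℝ)|)| ≤ Y).card
        = ∑ b ∈ intSeg x, ((intSeg x).filter fun a =>
          |(|((n.2 * a : ℤ) : ℝ)| - |((n.1 * b : ℤ) : ℝ)|)| ≤ Y).card := by
      simp only [Finset.card_filter]
      rw [intBox, Finset.sum_product_right]
      rfl
    rw [this]
    push_cast
    calc _ ≤ ∑ b ∈ intSeg x, 4 * (Y * |(n.2 : ℝ)|⁻¹ + 1) := by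
          refine Finset.sum_le_sum fun b _ => ?_
          refine card_near_le hn b (by linarith) _ fun a ha => ?_
          push_cast
          exact (Finset.mem_filter.1 ha).2
      _ = ((intSeg x).card : ℝ) * (4 * (Y * |(n.2 : ℝ)|⁻¹ + 1)) := by
          rw [Finset.sum_const, nsmul_eq_mul]
      _ ≤ (4 * x) * (4 * (Y * |(n.2 : ℝ)|⁻¹ + 1)) := by
          have : 0 ≤ Y := by linarith
          gcongr
      _ = _ := by ring
  -- If `n` has a small coordinate, all `l` are admitted. Otherwise `n₂ ≠ 0`, since `z ≥ 1`, and `l`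
  -- either has a small coordinate or is counted by `hdet`.
  have hcount : ∀ n ∈ intBox x, (((intBox x).filter fun l => IsExceptional z Y n l).card : ℝ) ≤
      32 * x ^ 2 * ((if |(n.1 : ℝ)| ≤ z then 1 else 0) * 1) +
      32 * x ^ 2 * (1 * (if |(n.2 : ℝ)| ≤ z then 1 else 0)) +
      (32 * (x * z) + 16 * x) + 16 * x * Y * (1 * |(n.2 : ℝ)|⁻¹) := by
    intro n _
    have hY0 : 0 ≤ Y := by linarith
    have hp : 0 ≤ 16 * x * Y * (1 * |(n.2 : ℝ)|⁻¹) := by positivity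
    have hp' : 0 ≤ 32 * (x * z) + 16 * x := by positivity
    have hfull : (((intBox x).filter fun l => IsExceptional z Y n l).card : ℝ) ≤ 32 * x ^ 2 := by
      refine le_trans (by exact_mod_cast Finset.card_filter_le _ _) (hbox.trans (le_of_eq (by ring)))
    by_cases c1 : |(n.1 : ℝ)| ≤ z
    · have : (0 : ℝ) ≤ 32 * x ^ 2 * (1 * (if |(n.2 : ℝ)| ≤ z then 1 else 0)) := by
        split_ifs <;> positivity
      rw [if_pos c1]; linarith
    · by_cases c2 : |(n.2 : ℝ)| ≤ z
      · rw [if_neg c1, if_pos c2]; linarith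
      · rw [if_neg c1, if_neg c2]
        have hn2 : n.2 ≠ 0 := by rintro h; apply c2; simp [h]; linarith
        have hsub : ((intBox x).filter fun l => IsExceptional z Y n l) ⊆
            ((intBox x).filter fun l => |(l.1 : ℝ)| ≤ z ∨ |(l.2 : ℝ)| ≤ z) ∪
            ((intBox x).filter fun l =>
              |(|((n.2 * l.1 : ℤ) : ℝ)| - |((n.1 * l.2 : ℤ) : ℝ)|)| ≤ Y) := by
          intro l hl
          obtain ⟨hl1, hl2⟩ := Finset.mem_filter.1 hl
          rcases hl2 with h | h | h | h | h
          · exact absurd h c1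
          · exact absurd h c2
          · exact Finset.mem_union_left _ (Finset.mem_filter.2 ⟨hl1, Or.inl h⟩)
          · exact Finset.mem_union_left _ (Finset.mem_filter.2 ⟨hl1, Or.inr h⟩)
          · exact Finset.mem_union_right _ (Finset.mem_filter.2 ⟨hl1, h⟩)
        have h4 := (Nat.cast_le (α := ℝ)).2
          ((Finset.card_le_card hsub).trans (Finset.card_union_le _ _))
        push_cast at h4
        have h5 := hdet n hn2
        push_cast at h5
        calc _ ≤ _ := h4
          _ ≤ 32 * (x * z) + 16 * x * (Y * |(n.2 : ℝ)|⁻¹ + 1) := add_le_add hlcard h5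
          _ = _ := by ring
  have hLM : L ^ M ≤ L ^ (M + 1) := pow_le_pow_right₀ hL (Nat.le_succ M)
  calc _ = ∑ n ∈ intBox x, (((intBox x).filter fun l => IsExceptional z Y n l).card : ℝ) *
          gcdWeight M x n := by
        rw [Finset.sum_filter, Finset.sum_product]
        refine Finset.sum_congr rfl fun n _ => ?_
        rw [← Finset.sum_filter]
        change ∑ _l ∈ (intBox x).filter (fun l => IsExceptional z Y n l), gcdWeight M x n = _
        rw [Finset.sum_const, nsmul_eq_mul]
    _ ≤ ∑ n ∈ intBox x, (32 * x ^ 2 * ((if |(n.1 : ℝ)| ≤ z then 1 else 0) * 1) +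
      32 * x ^ 2 * (1 * (if |(n.2 : ℝ)| ≤ z then 1 else 0)) +
      (32 * (x * z) + 16 * x) + 16 * x * Y * (1 * |(n.2 : ℝ)|⁻¹)) * gcdWeight M x n :=
        Finset.sum_le_sum fun n hn => mul_le_mul_of_nonneg_right (hcount n hn) (hw n)
    _ = 32 * x ^ 2 * (∑ n ∈ intBox x, (if |(n.1 : ℝ)| ≤ z then 1 else 0) * 1 * gcdWeight M x n)
        + 32 * x ^ 2 *
          (∑ n ∈ intBox x, 1 * (if |(n.2 : ℝ)| ≤ z then 1 else 0) * gcdWeight M x n)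
        + (32 * (x * z) + 16 * x) * (∑ n ∈ intBox x, gcdWeight M x n)
        + 16 * x * Y * (∑ n ∈ intBox x, 1 * |(n.2 : ℝ)|⁻¹ * gcdWeight M x n) := by
        simp only [Finset.mul_sum, ← Finset.sum_add_distrib]
        refine Finset.sum_congr rfl fun n _ => by ring
    _ ≤ 32 * x ^ 2 * (16 * (x * z) * L ^ M) + 32 * x ^ 2 * (16 * (x * z) * L ^ M)
        + (32 * (x * z) + 16 * x) * (16 * x ^ 2 * L ^ M)
        + 16 * x * Y * (8 * x * L * L ^ M) := by
        have : 0 ≤ Y := by linarith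
        gcongr
    _ = (1536 * (x ^ 3 * z) + 256 * (x ^ 2 * x)) * L ^ M + 128 * (x ^ 2 * Y) * L ^ (M + 1) := by
        ring
    _ ≤ (1536 * (x ^ 3 * z) + 256 * (x ^ 2 * Y)) * L ^ (M + 1)
        + 128 * (x ^ 2 * Y) * L ^ (M + 1) := by
        have : 0 ≤ Y := by linarith
        gcongr
    _ ≤ _ := by
        have : 0 ≤ Y := by linarith
        have h5 : 0 ≤ L ^ (M + 1) := by positivity
        have h6 : 0 ≤ x ^ 3 * z := by positivity
        have h7 : 0 ≤ x ^ 2 * Y := by positivity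
        rw [← add_mul]
        refine mul_le_mul_of_nonneg_right ?_ h5
        linarith

end

/-! ### Uniform bounds for the mean squares and the correlations -/

noncomputable section

variable {m : ℕ}

theorem isFiniteMeasure_of_isWeight {k : ℤ → ℝ} {H β₀ β : ℝ} (hβ₀ : 0 < β₀) (hβ : 1 < β)
    (hH : 1 ≤ H) (hk : IsWeight k H β₀ β) : IsFiniteMeasure (wMeasure k) := by
  obtain ⟨L, hL, hLk⟩ := exists_wMeasure_modEq_le β₀ β 1 hβ₀ hβ le_rfl
  have h1 := hLk k H hH hk 1 0 one_pos (by simpa using hH)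
  rw [setOf_modEq_one] at h1
  exact ⟨h1.trans_lt ENNReal.ofReal_lt_top⟩

theorem exists_total_mass_le (β₀ β : ℝ) (hβ₀ : 0 < β₀) (hβ : 1 < β) :
    ∃ L : ℝ, 1 ≤ L ∧ ∀ (k : ℤ → ℝ) (H : ℝ), 1 ≤ H → IsWeight k H β₀ β →
      (wMeasure k).real Set.univ ≤ L * H := by
  obtain ⟨L, hL, hLk⟩ := exists_wMeasure_modEq_le β₀ β 1 hβ₀ hβ le_rfl
  refine ⟨L, hL, fun k H hH hk => ?_⟩
  have h1 := hLk k H hH hk 1 0 one_pos (by simpa using hH)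
  rw [setOf_modEq_one, Nat.cast_one, div_one] at h1
  exact ENNReal.toReal_le_of_le_ofReal (by positivity) h1

theorem DivisorBounded.norm_le {B C : ℝ} {f : (Fin m → ℤ) → ℂ} (hf : DivisorBounded B C f)
    (u : Fin m → ℤ) : ‖f u‖ ≤ B * ∏ j, divWeight C (u j) := by
  refine (hf u).trans (le_of_eq ?_)
  congr 1
  rw [Finset.prod_filter]
  refine Finset.prod_congr rfl fun j _ => ?_
  by_cases h : u j = 0 <;> simp [divWeight, h]

theorem truncSq_le_sum (C X : ℝ) (v : ℤ) :
    truncSq C X v ≤ ∑ u ∈ Finset.Icc ⌈-X⌉ ⌊X⌋, divWeight C u ^ 2 := by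
  rw [truncSq]
  split_ifs with h
  · refine Finset.single_le_sum (f := fun u => divWeight C u ^ 2) (fun _ _ => sq_nonneg _) ?_
    rw [abs_le] at h
    exact Finset.mem_Icc.2 ⟨Int.ceil_le.2 h.1, Int.le_floor.2 h.2⟩
  · exact Finset.sum_nonneg fun _ _ => sq_nonneg _

theorem squareMean_le_prod {k : ℤ → ℝ} [IsFiniteMeasure (wMeasure k)] {B C : ℝ}
    (d : Fin m → ℕ) {f : (Fin m → ℤ) → ℂ} (hf : DivisorBounded B C f) (X : Fin m → ℝ)
    (n : ℤ × ℤ) :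
    squareMean k d f X n ≤ B ^ 2 *
      ∏ j, ∫ c, truncSq C (X j) (evalForm c n) ∂coeffMeasure k (d j) := by
  have hint : ∀ j, Integrable (fun c : Fin (d j + 1) → ℤ => truncSq C (X j) (evalForm c n))
      (coeffMeasure k (d j)) := by
    intro j
    refine Integrable.of_bound (C := ∑ u ∈ Finset.Icc ⌈-X j⌉ ⌊X j⌋, divWeight C u ^ 2)
      Measurable.of_discrete.aestronglyMeasurable (Eventually.of_forall fun c => ?_)
    rw [Real.norm_of_nonneg (truncSq_nonneg _ _ _)]
    exact truncSq_le_sum _ _ _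
  rw [← integral_fintype_prod_eq_prod
    (fun j (c : Fin (d j + 1) → ℤ) => truncSq C (X j) (evalForm c n)), ← integral_const_mul,
    squareMean]
  refine integral_mono_of_nonneg (Eventually.of_forall fun F => sq_nonneg _)
    ((Integrable.fintype_prod_dep hint).const_mul _) (Eventually.of_forall fun F => ?_)
  simp only
  by_cases hmem : evalTuple F n ∈ symmBox X
  · rw [truncate, if_pos hmem]
    have h1 : ∏ j, truncSq C (X j) (evalForm (F j) n)
        = (∏ j, divWeight C (evalTuple F n j)) ^ 2 := by
      rw [← Finset.prod_pow]
      refine Finset.prod_congr rfl fun j _ => ?_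
      have h2 : |(evalForm (F j) n : ℝ)| ≤ X j := mem_symmBox.1 hmem j
      rw [truncSq, if_pos h2]
      rfl
    rw [h1, ← mul_pow]
    exact pow_le_pow_left₀ (norm_nonneg _) (hf.norm_le _) 2
  · rw [truncate, if_neg hmem, norm_zero]
    have := Finset.prod_nonneg fun j (_ : j ∈ Finset.univ) =>
      truncSq_nonneg C (X j) (evalForm (F j) n)
    simpa using mul_nonneg (sq_nonneg B) this

theorem exists_primitive_decomposition {x : ℝ} (hx : 1 ≤ x) {n : ℤ × ℤ} (hn : n ∈ intBox x) :
    ∃ (g : ℕ) (a b : ℤ), g ≠ 0 ∧ (g : ℝ) ≤ x ∧ n = (g * a, g * b) ∧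
      (IsCoprime a b ∨ a = 0 ∧ b = 0) := by
  obtain ⟨h1, h2⟩ := mem_intBox.1 hn
  by_cases h0 : n = 0
  · exact ⟨1, 0, 0, one_ne_zero, by simpa using hx, by simp [h0]; rfl, Or.inr ⟨rfl, rfl⟩⟩
  · have hg : 0 < Int.gcd n.1 n.2 := by
      rw [Int.gcd_pos_iff]
      by_contra hcon
      push Not at hcon
      exact h0 (Prod.ext hcon.1 hcon.2)
    obtain ⟨a, b, hab, ha, hb⟩ := Int.exists_gcd_one hg
    refine ⟨Int.gcd n.1 n.2, a, b, hg.ne', ?_, ?_, Or.inl (Int.isCoprime_iff_gcd_eq_one.2 hab)⟩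
    · have key : ∀ c : ℤ, c ≠ 0 → |(c : ℝ)| ≤ x → (Int.gcd n.1 n.2 : ℤ) ∣ c →
          (Int.gcd n.1 n.2 : ℝ) ≤ x := by
        intro c hc hcx hdvd
        refine le_trans ?_ hcx
        have := Int.le_of_dvd (abs_pos.2 hc) ((dvd_abs _ _).2 hdvd)
        exact_mod_cast this
      by_cases hn1 : n.1 = 0
      · exact key n.2 (fun hn2 => h0 (Prod.ext hn1 hn2)) h2 (Int.gcd_dvd_right ..)
      · exact key n.1 hn1 h1 (Int.gcd_dvd_left ..)
    · refine Prod.ext ?_ ?_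
      · simpa [mul_comm] using ha
      · simpa [mul_comm] using hb

/-- Write `n = g · (a, b)` with `(a, b)` primitive or zero. The divisor weights of the `m` forms are
independent, so the mean square is bounded by a product over `j`; the powers of `τ(g)` multiply up
and are absorbed in `gcdWeight`. -/
theorem exists_squareMean_le (d : Fin m → ℕ) (hd : ∀ j, 1 ≤ d j) (B C β₀ β : ℝ) (hB : 0 < B)
    (hC : 0 ≤ C) (hβ₀ : 0 < β₀) (hβ : 1 < β) :
    ∃ A : ℝ, 0 < A ∧ ∀ (k : ℤ → ℝ) (x H : ℝ), 1 ≤ x → x ≤ H → 2 ≤ H → IsWeight k H β₀ β →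
      ∀ f : (Fin m → ℤ) → ℂ, DivisorBounded B C f → ∀ n ∈ intBox x,
        squareMean k d f (sizeBound d x H) n ≤ A * ((∏ j, H ^ (d j + 1)) *
          Real.log H ^ gammaOne d C * gcdWeight ⌈(2 : ℝ) ^ (2 * C * totalDeg d)⌉₊ x n) := by
  choose A hA hAk using fun j => exists_integral_truncSq_le β₀ β C hβ₀ hβ hC (d j) (hd j)
  have hAp : 0 < ∏ j, A j := Finset.prod_pos fun j _ => hA j
  refine ⟨B ^ 2 * ∏ j, A j, by positivity, ?_⟩
  intro k x H hx hxH hH hk f hf n hn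
  have hfin := isFiniteMeasure_of_isWeight hβ₀ hβ (by linarith) hk
  obtain ⟨g, a, b, hg, hgx, rfl, hab⟩ := exists_primitive_decomposition hx hn
  have hlog : 0 < Real.log H := Real.log_pos (by linarith)
  have hτ0 : (0 : ℝ) < (g.divisors.card : ℝ) := by exact_mod_cast one_le_card_divisors hg
  have hτ : ∏ j, (g.divisors.card : ℝ) ^ (2 * C * (d j : ℝ))
      ≤ gcdWeight ⌈(2 : ℝ) ^ (2 * C * totalDeg d)⌉₊ x ((g : ℤ) * a, (g : ℤ) * b) := by
    rw [← Real.rpow_sum_of_pos hτ0, ← Finset.mul_sum, ← Nat.cast_sum]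
    refine le_trans ?_ (kDiv_le_gcdWeight _ hg hgx (Dvd.intro _ rfl) (Dvd.intro _ rfl))
    exact card_divisors_rpow_le (by positivity) (Nat.le_ceil _) hg
  calc _ ≤ B ^ 2 * ∏ j, ∫ c, truncSq C (sizeBound d x H j) (evalForm c ((g : ℤ) * a, (g : ℤ) * b))
          ∂coeffMeasure k (d j) := squareMean_le_prod d hf _ _
    _ ≤ B ^ 2 * ∏ j, (A j * (H ^ (d j + 1) *
          Real.log H ^ ((2 : ℝ) ^ (2 * C * ((d j : ℝ) + 2) + 1)) *
          (g.divisors.card : ℝ) ^ (2 * C * (d j : ℝ)))) := by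
        refine mul_le_mul_of_nonneg_left (Finset.prod_le_prod (fun j _ => ?_) fun j _ => ?_)
          (by positivity)
        · exact integral_nonneg fun c => truncSq_nonneg _ _ _
        · exact hAk j k x H hx hxH hH hk g a b hg hab
    _ = (B ^ 2 * ∏ j, A j) * ((∏ j, H ^ (d j + 1)) * Real.log H ^ gammaOne d C *
          ∏ j, (g.divisors.card : ℝ) ^ (2 * C * (d j : ℝ))) := by
        rw [gammaOne, Real.rpow_sum_of_pos hlog]
        simp only [Finset.prod_mul_distrib]
        ring
    _ ≤ _ := by
        have : 0 ≤ ∏ j, H ^ (d j + 1) := Finset.prod_nonneg fun j _ => by positivity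
        gcongr

/-- With `N + 1 = ⌈2^C⌉` the average of `kDiv (N + 1)` loses `N ≤ 2^C` logarithms, which explains
the exponent. As `x ≤ H`, the logarithm of the length is `≪ log H`. The final factor `3` covers both
signs and `u = 0`. -/
theorem exists_sum_divWeight_le (C : ℝ) (hC : 0 ≤ C) (e : ℕ) :
    ∃ A : ℝ, 0 < A ∧ ∀ x H : ℝ, 1 ≤ x → x ≤ H → 2 ≤ H →
      ∑ u ∈ intSeg ((1 + (e : ℝ)) * x ^ e * H), divWeight C u
        ≤ A * (x ^ e * H * Real.log H ^ ((2 : ℝ) ^ C)) := by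
  obtain ⟨N, hN⟩ : ∃ N, ⌈(2 : ℝ) ^ C⌉₊ = N + 1 :=
    ⟨⌈(2 : ℝ) ^ C⌉₊ - 1, by
      have : 0 < ⌈(2 : ℝ) ^ C⌉₊ := Nat.ceil_pos.2 (by positivity)
      omega⟩
  have hNC : (N : ℝ) ≤ (2 : ℝ) ^ C := by
    have := (Nat.ceil_lt_add_one (show 0 ≤ (2 : ℝ) ^ C by positivity)).le
    rw [hN] at this
    push_cast at this
    linarith
  have he0 : (0 : ℝ) ≤ e := Nat.cast_nonneg e
  obtain ⟨K, hK, hKH⟩ := exists_one_add_log_pow_le (1 + e) (by linarith) N _ hNC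
  refine ⟨3 * (1 + e) * ((e + 1) ^ N * K), by positivity, fun x H hx hxH hH => ?_⟩
  set X := (1 + (e : ℝ)) * x ^ e * H
  have hxe : 1 ≤ x ^ e := one_le_pow₀ hx
  have hX1 : 1 ≤ X := by
    have h1 : 1 ≤ (1 + (e : ℝ)) * x ^ e := one_le_mul_of_one_le_of_one_le (by linarith) hxe
    exact one_le_mul_of_one_le_of_one_le h1 (by linarith)
  have hX0 : 0 < X := by linarith
  have hfl : (⌊X⌋₊ : ℝ) ≤ X := Nat.floor_le (by linarith)
  have hfl1 : 1 ≤ ⌊X⌋₊ := Nat.le_floor (by simpa using hX1)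
  have hlogX : 1 + Real.log X ≤ (e + 1) * (1 + Real.log ((1 + e) * H)) := by
    have h1 : X ≤ ((1 + e) * H) ^ (e + 1) := by
      calc X ≤ (1 + (e : ℝ)) * ((1 + e) * H) ^ e * H := by
            simp only [X]; gcongr; nlinarith
        _ = _ := by ring
    have h2 := Real.log_le_log hX0 h1
    rw [Real.log_pow] at h2
    push_cast at h2
    linarith
  have hlog1 : 1 ≤ 1 + Real.log X := by linarith [Real.log_nonneg hX1]
  have hsum := sum_intSeg_natAbs_le
    (fun n => if n = 0 then (1 : ℝ) else ((n.divisors.card : ℕ) : ℝ) ^ C)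
    (fun n => by split_ifs <;> positivity) X
  simp only [if_true, Int.natAbs_eq_zero] at hsum
  have hdiv : ∑ n ∈ Finset.Ioc 0 ⌊X⌋₊,
      (if n = 0 then (1 : ℝ) else ((n.divisors.card : ℕ) : ℝ) ^ C) ≤ X * (1 + Real.log X) ^ N := by
    calc _ ≤ ∑ n ∈ Finset.Ioc 0 ⌊X⌋₊, (kDiv (N + 1) n : ℝ) := by
          refine Finset.sum_le_sum fun n hn => ?_
          have hn0 : n ≠ 0 := (Finset.mem_Ioc.1 hn).1.ne'
          rw [if_neg hn0]
          exact card_divisors_rpow_le hC (by rw [← hN]; exact Nat.le_ceil _) hn0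
      _ ≤ ⌊X⌋₊ * (1 + Real.log ⌊X⌋₊) ^ N := sum_kDiv_le N _
      _ ≤ _ := by
          have : (0 : ℝ) < ⌊X⌋₊ := by exact_mod_cast hfl1
          have := one_le_one_add_log ⌊X⌋₊
          gcongr
  have hlogN : (1 + Real.log X) ^ N ≤ (e + 1) ^ N * (K * Real.log H ^ ((2 : ℝ) ^ C)) := by
    calc _ ≤ (((e : ℝ) + 1) * (1 + Real.log ((1 + e) * H))) ^ N := by gcongr
      _ = ((e : ℝ) + 1) ^ N * (1 + Real.log ((1 + e) * H)) ^ N := mul_pow _ _ _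
      _ ≤ _ := by gcongr; exact hKH H hH
  have hone : 1 ≤ X * (1 + Real.log X) ^ N :=
    one_le_mul_of_one_le_of_one_le hX1 (one_le_pow₀ hlog1)
  calc ∑ u ∈ intSeg X, divWeight C u ≤ 3 * (X * (1 + Real.log X) ^ N) := by
        have : ∑ u ∈ intSeg X, divWeight C u = ∑ u ∈ intSeg X,
            if u = 0 then (1 : ℝ) else ((u.natAbs.divisors.card : ℕ) : ℝ) ^ C := rfl
        rw [this]
        linarith
    _ ≤ 3 * (X * ((e + 1) ^ N * (K * Real.log H ^ ((2 : ℝ) ^ C)))) := by gcongr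
    _ = _ := by simp only [X]; ring

theorem exists_sum_norm_le (d : Fin m → ℕ) (B C : ℝ) (hB : 0 < B) (hC : 0 ≤ C) :
    ∃ A : ℝ, 0 < A ∧ ∀ x H : ℝ, 1 ≤ x → x ≤ H → 2 ≤ H →
      ∀ f : (Fin m → ℤ) → ℂ, DivisorBounded B C f →
        ∑ u ∈ symmBox (sizeBound d x H), ‖f u‖
          ≤ A * (x ^ totalDeg d * H ^ m * Real.log H ^ ((m : ℝ) * (2 : ℝ) ^ C)) := by
  choose A hA hAx using fun j => exists_sum_divWeight_le C hC (d j)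
  have hAp : 0 < ∏ j, A j := Finset.prod_pos fun j _ => hA j
  refine ⟨B * ∏ j, A j, by positivity, fun x H hx hxH hH f hf => ?_⟩
  have hlog : 0 < Real.log H := Real.log_pos (by linarith)
  calc _ ≤ ∑ u ∈ symmBox (sizeBound d x H), B * ∏ j, divWeight C (u j) :=
        Finset.sum_le_sum fun u _ => hf.norm_le u
    _ = B * ∏ j, ∑ u ∈ intSeg (sizeBound d x H j), divWeight C u := by
        rw [← Finset.mul_sum, Finset.prod_univ_sum, symmBox]
        simp_rw [Int.ceil_neg]
        rfl
    _ ≤ B * ∏ j, (A j * (x ^ d j * H * Real.log H ^ ((2 : ℝ) ^ C))) := by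
        refine mul_le_mul_of_nonneg_left (Finset.prod_le_prod (fun j _ => ?_) fun j _ => ?_) hB.le
        · exact Finset.sum_nonneg fun u _ => zero_le_one.trans (one_le_divWeight hC u)
        · exact hAx j x H hx hxH hH
    _ = _ := by
        simp only [Finset.prod_mul_distrib, Finset.prod_const, Finset.card_univ, Fintype.card_fin]
        rw [Finset.prod_pow_eq_pow_sum, ← Real.rpow_natCast (Real.log H ^ ((2 : ℝ) ^ C)) m,
          ← Real.rpow_mul hlog.le, mul_comm ((2 : ℝ) ^ C), totalDeg]
        ring

/-- For `b ≤ a` this is superadditivity of the `e`-th power: `(a - b)^e + b^e ≤ a^e`. -/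
theorem abs_sub_pow_le {a b : ℝ} (ha : 0 ≤ a) (hb : 0 ≤ b) {e : ℕ} (he : e ≠ 0) :
    |a - b| ^ e ≤ |a ^ e - b ^ e| := by
  wlog h : b ≤ a generalizing a b
  · rw [abs_sub_comm a b, abs_sub_comm (a ^ e)]
    exact this hb ha (le_of_not_ge h)
  · rw [abs_of_nonneg (sub_nonneg.2 h)]
    have := pow_add_pow_le (sub_nonneg.2 h) hb he
    rw [sub_add_cancel] at this
    exact le_trans (by linarith) (le_abs_self _)

theorem le_abs_pairDet {e : ℕ} (he : e ≠ 0) {n l : ℤ × ℤ} {Y : ℝ} (hY : 0 ≤ Y)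
    (h : Y ≤ |(|((n.2 * l.1 : ℤ) : ℝ)| - |((n.1 * l.2 : ℤ) : ℝ)|)|) :
    Y ^ e ≤ |(pairDet e n l : ℝ)| := by
  refine (pow_le_pow_left₀ hY h e).trans ((abs_sub_pow_le (abs_nonneg _) (abs_nonneg _) he).trans ?_)
  rw [← abs_pow, ← abs_pow]
  refine (abs_abs_sub_abs_le _ _).trans (le_of_eq ?_)
  rw [pairDet]
  push_cast
  rfl

/-- By Cramer's rule and the lower bound for the determinant, each torus variable lies within
`2δξ/x^{d_j}` of a rational multiple of `2π`. Multiplied by twice the box size this gives `4(1 +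
d_j)δξH`, hence the factor `5 + 4 d_j` against `max 1 (δξH)`. -/
theorem norm_correlation_le_of_det {K : Circ → ℝ} {k : ℤ → ℝ} (hK : IsKernelOf K k)
    [IsFiniteMeasure (wMeasure k)] {d : Fin m → ℕ} (hd : ∀ j, 1 ≤ d j) (f : (Fin m → ℤ) → ℂ)
    {P x H ξ δ M0 : ℝ} (hx : 1 ≤ x) (hH : 1 ≤ H) (hξ : 1 ≤ ξ) (hδ : 0 < δ)
    (hP : ∀ α, K α ≤ P) (hM0 : ∑ u ∈ symmBox (sizeBound d x H), ‖f u‖ ≤ M0)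
    {n l : ℤ × ℤ} (hn : n ∈ intBox x) (hl : l ∈ intBox x)
    (hdet : ∀ j, x ^ (2 * d j) / ξ ≤ |(pairDet (d j) n l : ℝ)|) :
    ‖correlation k d f (sizeBound d x H) n l‖ ≤ (∏ j, P ^ (d j - 1)) *
      (((∏ j, (5 + 4 * (d j : ℝ))) * max 1 (δ * ξ * H) ^ m *
        expSumSup f (sizeBound d x H) (fun j => pairDet (d j) n l)) ^ 2 +
        M0 ^ 2 * (2 * m * tailMass K δ)) := by
  have hx0 : 0 < x := by linarith
  have hξ0 : 0 < ξ := by linarith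
  have hq0 : ∀ j, 0 < |(pairDet (d j) n l : ℝ)| := fun j => lt_of_lt_of_le (by positivity) (hdet j)
  have hq : ∀ j, pairDet (d j) n l ≠ 0 := fun j => by exact_mod_cast abs_pos.1 (hq0 j)
  have hX : ∀ j, 0 ≤ sizeBound d x H j := fun j => by rw [sizeBound]; positivity
  set mx := max 1 (δ * ξ * H)
  have hmx1 : 1 ≤ mx := le_max_left _ _
  have hE := expSumSup_nonneg f (sizeBound d x H) (fun j => pairDet (d j) n l)
  obtain ⟨hn1, hn2⟩ := mem_intBox.1 hn
  obtain ⟨hl1, hl2⟩ := mem_intBox.1 hl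
  rw [correlation, integral_truncate_mul_conj hK]
  have hc0 : 0 ≤ ∏ j, (5 + 4 * (d j : ℝ)) := Finset.prod_nonneg fun j _ => by positivity
  refine norm_pair_integral_le hK hd f _ hq hP (by positivity)
    (fun θ => (norm_expPoly_le _ _ _).trans hM0) ?_
  have key : ∀ θ : Fin m → Circ,
      (∀ j, ‖pairDet (d j) n l • θ j‖ ≤ 2 * x ^ d j * δ) →
      ‖expPoly f (sizeBound d x H) θ‖ ≤ (∏ j, (5 + 4 * (d j : ℝ))) * mx ^ m *
        expSumSup f (sizeBound d x H) (fun j => pairDet (d j) n l) := by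
    intro θ hθ
    choose b η hη hθη using fun j => exists_rational_approx (hq j) (hθ j)
    refine (norm_expPoly_le_expSumSup f hX (fun j => pairDet (d j) n l) b η hθη).trans ?_
    refine mul_le_mul_of_nonneg_right ?_ hE
    have hmm : mx ^ m = ∏ _j : Fin m, mx := by simp
    rw [hmm, ← Finset.prod_mul_distrib]
    refine Finset.prod_le_prod (fun j _ => ?_) fun j _ => ?_
    · have := hX j; positivity
    · have h1 : |η j| ≤ 2 * δ * ξ / x ^ d j := by
        refine (hη j).trans ?_
        rw [div_le_div_iff₀ (hq0 j) (by positivity)]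
        have h2 := hdet j
        rw [div_le_iff₀ hξ0] at h2
        calc 2 * x ^ d j * δ * x ^ d j = 2 * δ * x ^ (2 * d j) := by rw [two_mul (d j), pow_add]; ring
          _ ≤ 2 * δ * (|(pairDet (d j) n l : ℝ)| * ξ) := by gcongr
          _ = _ := by ring
      calc 1 + 2 * sizeBound d x H j * |η j|
          ≤ 1 + 2 * sizeBound d x H j * (2 * δ * ξ / x ^ d j) := by
            have := hX j; gcongr
        _ = 1 + 4 * (1 + (d j : ℝ)) * (δ * ξ * H) := by
            rw [sizeBound]; field_simp; ring
        _ ≤ mx + 4 * (1 + (d j : ℝ)) * mx := by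
            gcongr; exact le_max_right _ _
        _ = _ := by ring
  intro ω hω
  have h := fun j => norm_pairDet_smul_le (δ := δ) hn1 hn2 hl1 hl2 (hω j).1 (hω j).2
  exact ⟨key _ fun j => (h j).1, key _ fun j => (h j).2⟩

end

/-! ### Summation over all pairs and the final estimate -/

noncomputable section

variable {m : ℕ}

theorem mul_totalDeg_le_gammaZero {C : ℝ} (hC : 0 ≤ C) (d : Fin m → ℕ) :
    C * totalDeg d ≤ gammaZero d C := by
  rw [totalDeg, gammaZero, Nat.cast_sum, Finset.mul_sum]
  refine Finset.sum_le_sum fun j _ => ?_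
  have hd : (0 : ℝ) ≤ d j := Nat.cast_nonneg _
  have h1 : 0 ≤ C * (d j : ℝ) := by positivity
  nlinarith [mul_nonneg h1 hd]

/-- The left side is at most `2^(2Cd) + 2 ≤ 2^(2Cd+2)`, and `Cd ≤ γ₀`. -/
theorem ceil_add_one_le {C : ℝ} (hC : 0 ≤ C) (d : Fin m → ℕ) :
    ((⌈(2 : ℝ) ^ (2 * C * totalDeg d)⌉₊ + 1 : ℕ) : ℝ)
      ≤ (2 : ℝ) ^ (2 * (1 + 2 * gammaZero d C)) := by
  have h0 := mul_totalDeg_le_gammaZero hC d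
  have ht : 0 ≤ C * totalDeg d := by positivity
  have h1 : (1 : ℝ) ≤ (2 : ℝ) ^ (2 * C * totalDeg d) :=
    Real.one_le_rpow one_le_two (by linarith)
  have h2 := (Nat.ceil_lt_add_one (zero_le_one.trans h1)).le
  have h3 : (2 : ℝ) ^ (2 + 2 * C * totalDeg d) ≤ (2 : ℝ) ^ (2 * (1 + 2 * gammaZero d C)) :=
    Real.rpow_le_rpow_of_exponent_le one_le_two (by linarith)
  rw [Real.rpow_add two_pos] at h3
  norm_num at h3
  push_cast
  linarith

theorem exceptional_size_le {D : ℕ} (hD : 1 ≤ D) {x ξ : ℝ} (hξ : 1 ≤ ξ) :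
    x ^ 3 * (x / ξ ^ (1 / 2 : ℝ)) + x ^ 2 * (x ^ 2 / ξ ^ (1 / (D : ℝ)))
      ≤ 2 * (x ^ 4 / ξ ^ (1 / (2 * (D : ℝ)))) := by
  have hD' : (1 : ℝ) ≤ D := by exact_mod_cast hD
  have hpos : 0 < ξ ^ (1 / (2 * (D : ℝ))) := Real.rpow_pos_of_pos (by linarith) _
  have h1 : ξ ^ (1 / (2 * (D : ℝ))) ≤ ξ ^ (1 / 2 : ℝ) :=
    Real.rpow_le_rpow_of_exponent_le hξ (one_div_le_one_div_of_le two_pos (by linarith))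
  have h2 : ξ ^ (1 / (2 * (D : ℝ))) ≤ ξ ^ (1 / (D : ℝ)) :=
    Real.rpow_le_rpow_of_exponent_le hξ (one_div_le_one_div_of_le (by linarith) (by linarith))
  calc _ = x ^ 4 / ξ ^ (1 / 2 : ℝ) + x ^ 4 / ξ ^ (1 / (D : ℝ)) := by ring
    _ ≤ x ^ 4 / ξ ^ (1 / (2 * (D : ℝ))) + x ^ 4 / ξ ^ (1 / (2 * (D : ℝ))) := by gcongr
    _ = _ := by ring

theorem one_le_maxDeg (hm : 1 ≤ m) {d : Fin m → ℕ} (hd : ∀ j, 1 ≤ d j) : 1 ≤ maxDeg d :=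
  (hd ⟨0, hm⟩).trans (Finset.le_sup (f := d) (Finset.mem_univ _))

theorem rpow_inv_le_self {D : ℕ} (hD : 1 ≤ D) {ξ : ℝ} (hξ : 1 ≤ ξ) : ξ ^ (1 / (D : ℝ)) ≤ ξ := by
  have hD' : (1 : ℝ) ≤ D := by exact_mod_cast hD
  calc _ ≤ ξ ^ (1 : ℝ) := Real.rpow_le_rpow_of_exponent_le hξ (by
        rw [div_le_one (by linarith)]; exact hD')
    _ = ξ := Real.rpow_one _

/-- The cutoff `x²/ξ^(1/D)` for `||n₂l₁| - |n₁l₂||` is chosen so that every degree `e ≤ D` loses at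
most one factor `ξ` in its determinant. -/
theorem pow_le_of_rpow_inv {D e : ℕ} (hD : 1 ≤ D) (he : e ≤ D) {x ξ : ℝ} (hx : 0 ≤ x)
    (hξ : 1 ≤ ξ) : x ^ (2 * e) / ξ ≤ (x ^ 2 / ξ ^ (1 / (D : ℝ))) ^ e := by
  have hξ0 : 0 < ξ := by linarith
  have hD' : (0 : ℝ) < D := by exact_mod_cast hD
  rw [div_pow, ← pow_mul, ← Real.rpow_natCast (ξ ^ (1 / (D : ℝ))), ← Real.rpow_mul hξ0.le]
  have h1 : ξ ^ (1 / (D : ℝ) * e) ≤ ξ ^ (1 : ℝ) := Real.rpow_le_rpow_of_exponent_le hξ (by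
    rw [one_div_mul_eq_div, div_le_one hD']; exact_mod_cast he)
  rw [Real.rpow_one] at h1
  have : 0 < ξ ^ (1 / (D : ℝ) * e) := Real.rpow_pos_of_pos hξ0 _
  gcongr

theorem mem_majorPairs_of_not_isExceptional {x ξ Y : ℝ} (hY : 0 ≤ Y) {p : (ℤ × ℤ) × (ℤ × ℤ)}
    (hp : p ∈ intBox x ×ˢ intBox x)
    (h : ¬ IsExceptional (x / ξ ^ (1 / 2 : ℝ)) Y p.1 p.2) : p ∈ majorPairs x ξ := by
  simp only [IsExceptional, not_or, not_le] at h
  obtain ⟨h1, h2, h3, h4, h5⟩ := h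
  refine Finset.mem_filter.2 ⟨hp, fun hcon => ?_, fun hcon => ?_, h1, h2, h3, h4⟩
  · rw [hcon, sub_self, abs_zero] at h5
    linarith
  · rw [hcon, Int.cast_neg, abs_neg, sub_self, abs_zero] at h5
    linarith

-- Cauchy's inequality replaces the correlation by mean squares at `n` and `l`. The two cutoffs give
-- `x⁴/ξ^(1/2)` and `x⁴/ξ^(1/D)`, both at most `x⁴/ξ^(1/(2D))`.
open Classical in
theorem exists_sum_exceptional_le (hm : 1 ≤ m) (d : Fin m → ℕ) (hd : ∀ j, 1 ≤ d j)
    (B C β₀ β : ℝ) (hB : 0 < B) (hC : 0 ≤ C) (hβ₀ : 0 < β₀) (hβ : 1 < β) :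
    ∃ A : ℝ, 0 < A ∧ ∀ (k : ℤ → ℝ) (x H ξ : ℝ), 2 ≤ x → x ≤ H → 1 ≤ ξ → ξ ≤ x →
      IsWeight k H β₀ β → ∀ f : (Fin m → ℤ) → ℂ, DivisorBounded B C f →
      ∑ p ∈ (intBox x ×ˢ intBox x).filter (fun p => IsExceptional (x / ξ ^ (1 / 2 : ℝ))
        (x ^ 2 / ξ ^ (1 / (maxDeg d : ℝ))) p.1 p.2), ‖correlation k d f (sizeBound d x H) p.1 p.2‖
        ≤ A * ((∏ j, H ^ (d j + 1)) * (Real.log H ^ gammaOne d C *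
          Real.log x ^ ((2 : ℝ) ^ (2 * (1 + 2 * gammaZero d C))) /
            ξ ^ (1 / (2 * (maxDeg d : ℝ))) * x ^ 4)) := by
  obtain ⟨A, hA, hAk⟩ := exists_squareMean_le d hd B C β₀ β hB hC hβ₀ hβ
  set M := ⌈(2 : ℝ) ^ (2 * C * totalDeg d)⌉₊
  obtain ⟨K, hK, hKx⟩ := exists_one_add_log_pow_le 1 le_rfl (M + 1) _ (ceil_add_one_le hC d)
  refine ⟨A * (4096 * K), by positivity, fun k x H ξ hx hxH hξ hξx hk f hf => ?_⟩
  have hD := one_le_maxDeg hm hd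
  have hlogH : 0 < Real.log H := Real.log_pos (by linarith)
  have hHp : 0 < ∏ j, H ^ (d j + 1) := Finset.prod_pos fun j _ => pow_pos (by linarith) _
  have hξ0 : 0 < ξ := by linarith
  set z := x / ξ ^ (1 / 2 : ℝ)
  set Y := x ^ 2 / ξ ^ (1 / (maxDeg d : ℝ))
  set S := (intBox x ×ˢ intBox x).filter (fun p => IsExceptional z Y p.1 p.2)
  have hz : 1 ≤ z := by
    rw [one_le_div (Real.rpow_pos_of_pos hξ0 _)]
    have := rpow_inv_le_self (D := 2) (by norm_num) hξ
    push_cast at this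
    linarith
  have hY : x ≤ Y := by
    rw [le_div_iff₀ (Real.rpow_pos_of_pos hξ0 _), sq]
    have := rpow_inv_le_self hD hξ
    gcongr
    linarith
  -- The exceptional condition is symmetric in the pair, so it suffices to treat the mean square at
  -- the first point.
  have hswap : ∑ p ∈ S, squareMean k d f (sizeBound d x H) p.2
      = ∑ p ∈ S, squareMean k d f (sizeBound d x H) p.1 := by
    refine Finset.sum_nbij' Prod.swap Prod.swap ?_ ?_ (fun _ _ => rfl) (fun _ _ => rfl)
      (fun _ _ => rfl) <;>
    · intro p hp
      obtain ⟨hp1, hp2⟩ := Finset.mem_filter.1 hp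
      exact Finset.mem_filter.2 ⟨Finset.mem_product.2 (Finset.mem_product.1 hp1).symm, hp2.symm⟩
  have hfin := isFiniteMeasure_of_isWeight hβ₀ hβ (by linarith) hk
  have hgcd := sum_exceptional_gcdWeight_le M (by linarith) hz hY
  have hKx' := hKx x hx
  rw [one_mul] at hKx'
  have hsize := exceptional_size_le (x := x) hD hξ
  have hlogx : 0 < Real.log x := Real.log_pos (by linarith)
  have hx4 : 0 ≤ x ^ 4 / ξ ^ (1 / (2 * (maxDeg d : ℝ))) :=
    div_nonneg (by positivity) (Real.rpow_nonneg hξ0.le _)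
  calc _ ≤ ∑ p ∈ S, (squareMean k d f (sizeBound d x H) p.1
          + squareMean k d f (sizeBound d x H) p.2) / 2 :=
        Finset.sum_le_sum fun p _ => norm_correlation_le d f _ p.1 p.2
    _ = ∑ p ∈ S, squareMean k d f (sizeBound d x H) p.1 := by
        rw [← Finset.sum_div, Finset.sum_add_distrib, hswap]
        ring
    _ ≤ ∑ p ∈ S, A * ((∏ j, H ^ (d j + 1)) * Real.log H ^ gammaOne d C * gcdWeight M x p.1) :=
        Finset.sum_le_sum fun p hp => hAk k x H (by linarith) hxH (by linarith) hk f hf p.1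
          (Finset.mem_product.1 (Finset.mem_filter.1 hp).1).1
    _ = A * ((∏ j, H ^ (d j + 1)) * Real.log H ^ gammaOne d C) * ∑ p ∈ S, gcdWeight M x p.1 := by
        rw [Finset.mul_sum]
        exact Finset.sum_congr rfl fun p _ => by ring
    _ ≤ A * ((∏ j, H ^ (d j + 1)) * Real.log H ^ gammaOne d C) *
          (2048 * (2 * (x ^ 4 / ξ ^ (1 / (2 * (maxDeg d : ℝ))))) *
            (K * Real.log x ^ ((2 : ℝ) ^ (2 * (1 + 2 * gammaZero d C))))) := by
        refine mul_le_mul_of_nonneg_left (hgcd.trans ?_) (by positivity)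
        have h1 : 0 ≤ (1 + Real.log x) ^ (M + 1) := by positivity
        refine mul_le_mul (by linarith) hKx' h1 (by positivity)
    _ = _ := by ring

-- Non-exceptional pairs have large determinants for all `j`, so `norm_correlation_le_of_det`
-- applies; they all lie in `majorPairs`. The tail term is summed over at most `≪ x⁴` pairs.
open Classical in
theorem exists_sum_not_exceptional_le (hm : 1 ≤ m) (d : Fin m → ℕ) (hd : ∀ j, 1 ≤ d j)
    (B C β₀ β : ℝ) (hB : 0 < B) (hC : 0 ≤ C) (hβ₀ : 0 < β₀) (hβ : 1 < β) :
    ∃ A : ℝ, 0 < A ∧ ∀ (κ : Circ → ℝ) (k : ℤ → ℝ) (x H ξ δ : ℝ), 2 ≤ x → x ≤ H → 1 ≤ ξ →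
      0 < δ → (∀ α, 0 ≤ κ α) → IsKernelOf κ k →
      IsWeight k H β₀ β → ∀ f : (Fin m → ℤ) → ℂ, DivisorBounded B C f →
      ∑ p ∈ (intBox x ×ˢ intBox x).filter (fun p => ¬ IsExceptional (x / ξ ^ (1 / 2 : ℝ))
        (x ^ 2 / ξ ^ (1 / (maxDeg d : ℝ))) p.1 p.2), ‖correlation k d f (sizeBound d x H) p.1 p.2‖
        ≤ A * ((∏ j, H ^ (d j + 1)) * (x ^ (2 * totalDeg d) *
            Real.log H ^ ((m : ℝ) * (2 : ℝ) ^ (C + 1)) * tailMass κ δ * x ^ 4 +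
            (max 1 (δ * ξ * H) / H) ^ (2 * m) * majorSum d f x ξ H)) := by
  obtain ⟨L, hL, hLk⟩ := exists_total_mass_le β₀ β hβ₀ hβ
  obtain ⟨A, hA, hAf⟩ := exists_sum_norm_le d B C hB hC
  set c := ∏ j, (5 + 4 * (d j : ℝ))
  set ℓ := ∏ j, L ^ (d j - 1)
  have hc : 0 < c := Finset.prod_pos fun j _ => by positivity
  have hℓ : 0 < ℓ := Finset.prod_pos fun j _ => by positivity
  refine ⟨ℓ * (c ^ 2 + 1024 * A ^ 2 * (2 * m)), by positivity, ?_⟩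
  intro κ k x H ξ δ hx hxH hξ hδ hκ0 hκ hk f hf
  have hH0 : 0 < H := by linarith
  have hlogH : 0 < Real.log H := Real.log_pos (by linarith)
  have hfin := isFiniteMeasure_of_isWeight hβ₀ hβ (by linarith) hk
  have hP : ∀ α, κ α ≤ L * H := fun α => (hκ.le α).trans (hLk k H (by linarith) hk)
  have hT := tailMass_nonneg hκ0 δ
  set Y := x ^ 2 / ξ ^ (1 / (maxDeg d : ℝ))
  set G := (intBox x ×ˢ intBox x).filter
    (fun p => ¬ IsExceptional (x / ξ ^ (1 / 2 : ℝ)) Y p.1 p.2)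
  set mx := max 1 (δ * ξ * H)
  have hmx : 1 ≤ mx := le_max_left _ _
  set M0 := A * (x ^ totalDeg d * H ^ m * Real.log H ^ ((m : ℝ) * (2 : ℝ) ^ C))
  have hY : 0 ≤ Y := by
    have : 0 < ξ := by linarith
    positivity
  -- Bounding `d_j - 1` kernels by `LH` falls short of the normalisation `H^(d_j+1)` by `H²` for
  -- each `j`. This gap is the source of `H^(-2m)` in front of the main sum, and it cancels the
  -- `H^(2m)` in `M0²`.
  have hPP : ∏ j, (L * H) ^ (d j - 1) * H ^ 2 = ℓ * ∏ j, H ^ (d j + 1) := by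
    rw [← Finset.prod_mul_distrib]
    refine Finset.prod_congr rfl fun j _ => ?_
    rw [mul_pow, mul_assoc, ← pow_add]
    congr 2
    have := hd j
    omega
  rw [Finset.prod_mul_distrib, Finset.prod_const, Finset.card_univ, Fintype.card_fin,
    ← pow_mul] at hPP
  set Q := ∏ j, (L * H) ^ (d j - 1)
  have hQ : 0 < Q := Finset.prod_pos fun j _ => by positivity
  have hM0 : M0 ^ 2 = A ^ 2 * (x ^ (2 * totalDeg d) * H ^ (2 * m) *
      Real.log H ^ ((m : ℝ) * (2 : ℝ) ^ (C + 1))) := by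
    have h1 : (Real.log H ^ ((m : ℝ) * (2 : ℝ) ^ C)) ^ 2
        = Real.log H ^ ((m : ℝ) * (2 : ℝ) ^ (C + 1)) := by
      rw [← Real.rpow_natCast, ← Real.rpow_mul hlogH.le, Real.rpow_add two_pos, Real.rpow_one]
      congr 1
      push_cast
      ring
    rw [← h1]
    simp only [M0, mul_pow, ← pow_mul, mul_comm 2]
  have hcard : (G.card : ℝ) ≤ 1024 * x ^ 4 := by
    have h1 := card_intBox_restrict_le (x := x) (z := x) (by linarith) (by linarith) (intBox x)
      (fun n hn => Or.inl (mem_intBox.1 hn))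
    have h2 : (G.card : ℝ) ≤ (intBox x).card * (intBox x).card := by
      rw [← Nat.cast_mul, ← Finset.card_product]
      exact_mod_cast Finset.card_filter_le _ _
    refine h2.trans ((mul_le_mul h1 h1 (by positivity) (by positivity)).trans (le_of_eq (by ring)))
  have hterm : ∀ p ∈ G, ‖correlation k d f (sizeBound d x H) p.1 p.2‖ ≤
      Q * ((c * mx ^ m * expSumSup f (sizeBound d x H) (fun j => pairDet (d j) p.1 p.2)) ^ 2
        + M0 ^ 2 * (2 * m * tailMass κ δ)) := by
    intro p hp
    obtain ⟨hp1, hp2⟩ := Finset.mem_filter.1 hp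
    obtain ⟨hn, hl⟩ := Finset.mem_product.1 hp1
    refine norm_correlation_le_of_det hκ hd f (by linarith) (by linarith) hξ hδ hP
      (hAf x H (by linarith) hxH (by linarith) f hf) hn hl fun j => ?_
    refine (pow_le_of_rpow_inv (one_le_maxDeg hm hd) (Finset.le_sup (Finset.mem_univ j))
      (by linarith) hξ).trans (le_abs_pairDet (Nat.one_le_iff_ne_zero.1 (hd j)) hY ?_)
    by_contra hcon
    exact hp2 (Or.inr (Or.inr (Or.inr (Or.inr (not_le.1 hcon).le))))
  have hmajor : ∑ p ∈ G, expSumSup f (sizeBound d x H) (fun j => pairDet (d j) p.1 p.2) ^ 2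
      ≤ majorSum d f x ξ H := by
    refine Finset.sum_le_sum_of_subset_of_nonneg (fun p hp => ?_) fun _ _ _ => sq_nonneg _
    exact mem_majorPairs_of_not_isExceptional hY (Finset.mem_filter.1 hp).1
      (Finset.mem_filter.1 hp).2
  have hMS : 0 ≤ majorSum d f x ξ H := Finset.sum_nonneg fun _ _ => sq_nonneg _
  set U := x ^ (2 * totalDeg d) * Real.log H ^ ((m : ℝ) * (2 : ℝ) ^ (C + 1)) * tailMass κ δ * x ^ 4
  have hU : 0 ≤ U := by positivity
  set W := (mx / H) ^ (2 * m) * majorSum d f x ξ H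
  have hW : 0 ≤ W := by positivity
  have hHp : 0 < ∏ j, H ^ (d j + 1) := Finset.prod_pos fun j _ => by positivity
  calc _ ≤ ∑ p ∈ G, Q * ((c * mx ^ m *
          expSumSup f (sizeBound d x H) (fun j => pairDet (d j) p.1 p.2)) ^ 2
        + M0 ^ 2 * (2 * m * tailMass κ δ)) := Finset.sum_le_sum hterm
    _ = Q * (c ^ 2 * mx ^ (2 * m) *
          (∑ p ∈ G, expSumSup f (sizeBound d x H) (fun j => pairDet (d j) p.1 p.2) ^ 2) +
          G.card * (M0 ^ 2 * (2 * m * tailMass κ δ))) := by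
        rw [← Finset.mul_sum, Finset.sum_add_distrib, Finset.sum_const, nsmul_eq_mul,
          Finset.mul_sum]
        congr 2
        refine Finset.sum_congr rfl fun p _ => ?_
        rw [mul_pow, mul_pow, ← pow_mul, mul_comm m]
    _ ≤ Q * (c ^ 2 * mx ^ (2 * m) * majorSum d f x ξ H +
          1024 * x ^ 4 * (M0 ^ 2 * (2 * m * tailMass κ δ))) := by
        gcongr
    _ = (Q * H ^ (2 * m)) * (c ^ 2 * W + 1024 * A ^ 2 * (2 * m) * U) := by
        rw [hM0]
        simp only [W, U]
        rw [div_pow]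
        field_simp
    _ ≤ (Q * H ^ (2 * m)) * ((c ^ 2 + 1024 * A ^ 2 * (2 * m)) * (U + W)) := by
        refine mul_le_mul_of_nonneg_left ?_ (by positivity)
        have h1 : 0 ≤ c ^ 2 * U := by positivity
        have h2 : 0 ≤ 1024 * A ^ 2 * (2 * m) * W := by positivity
        linarith
    _ = _ := by rw [hPP]; ring

end

end RandomForms

open RandomForms in
theorem mainTheorem8 (m : ℕ) (hm : 1 ≤ m) (d : Fin m → ℕ) (hd : ∀ j, 1 ≤ d j)
    (B C c₀ β₀ β : ℝ) (hB : 0 < B) (hC : 0 ≤ C) (hc₀ : 0 < c₀) (hβ₀ : 0 < β₀) (hβ : 1 < β) :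
    ∃ A : ℝ, 0 < A ∧
      ∀ K : ℝ → RandomForms.Circ → ℝ,
        RandomForms.IsPositiveSummabilityKernel K →
        RandomForms.CoeffLowerBound K c₀ →
        RandomForms.CoeffDecay K β₀ β →
        RandomForms.FourierInversion K →
      ∀ f : (Fin m → ℤ) → ℂ, RandomForms.DivisorBounded B C f →
      ∀ δ : ℝ, 0 < δ → δ < 1 →
      ∀ ξ₀ x H : ℝ, 1 ≤ ξ₀ → ξ₀ ≤ x → 2 ≤ x → x ≤ H →
      ∀ a : ℤ × ℤ → ℂ, (∀ n, ‖a n‖ ≤ 1) →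
        RandomForms.secondMoment d f a x H ≤
          A * ((x ^ (2 * RandomForms.totalDeg d) *
                  Real.log H ^ ((m : ℝ) * (2 : ℝ) ^ (C + 1)) * RandomForms.kernelTail K H δ
                + Real.log H ^ RandomForms.gammaOne d C *
                    Real.log x ^ ((2 : ℝ) ^ (2 * (1 + 2 * RandomForms.gammaZero d C))) /
                  ξ₀ ^ (1 / (2 * (RandomForms.maxDeg d : ℝ)))) * x ^ 4
              + (max 1 (δ * ξ₀ * H) / H) ^ (2 * m) * RandomForms.majorSum d f x ξ₀ H) := by
  classical
  obtain ⟨A₁, hA₁, hexc⟩ := exists_sum_exceptional_le hm d hd B C β₀ β hB hC hβ₀ hβ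
  obtain ⟨A₂, hA₂, hmaj⟩ := exists_sum_not_exceptional_le hm d hd B C β₀ β hB hC hβ₀ hβ
  have hcp : 0 < ∏ j, c₀ ^ (d j + 1) := Finset.prod_pos fun j _ => by positivity
  refine ⟨(∏ j, c₀ ^ (d j + 1))⁻¹ * (A₁ + A₂), by positivity, ?_⟩
  intro K hK hlow hdec hinv f hf δ hδ _ ξ x H hξ hξx hx hxH a ha
  have hH1 : 1 ≤ H := by linarith
  have hw := isWeight_realCoeff hK hlow hdec hH1
  have hfin := isFiniteMeasure_of_isWeight hβ₀ hβ hH1 hw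
  have hker := isKernelOf_realCoeff hK hlow hinv hH1
  have h1 := secondMoment_le_sum_correlation hc₀ (show 0 ≤ x by linarith) hH1
    (fun n => (hlow H hH1 n).2.2) d f a ha (k := realCoeff K H)
  have h2 := hexc (realCoeff K H) x H ξ hx hxH hξ hξx hw f hf
  have h3 := hmaj (K H) (realCoeff K H) x H ξ δ hx hxH hξ hδ (hK.nonneg H hH1) hker hw f hf
  -- The normalised tail is `1/(2π)` times the one in the statement, hence no larger.
  have hT : tailMass (K H) δ ≤ kernelTail K H δ := by
    have h0 := tailMass_nonneg (hK.nonneg H hH1) δ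
    have h4 := tailMass_eq K H δ
    have hpi := Real.pi_gt_three
    rw [eq_inv_mul_iff_mul_eq₀ (by positivity)] at h4
    nlinarith
  have hT0 := tailMass_nonneg (hK.nonneg H hH1) δ
  have hHp : 0 < ∏ j, H ^ (d j + 1) := Finset.prod_pos fun j _ => by positivity
  have hlogH : 0 < Real.log H := Real.log_pos (by linarith)
  have hlogx : 0 < Real.log x := Real.log_pos (by linarith)
  have hξ0 : 0 < ξ := by linarith
  have hMS : 0 ≤ majorSum d f x ξ H := Finset.sum_nonneg fun _ _ => sq_nonneg _
  set V := x ^ (2 * totalDeg d) * Real.log H ^ ((m : ℝ) * (2 : ℝ) ^ (C + 1))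
  have hV : 0 ≤ V := by positivity
  set R := Real.log H ^ gammaOne d C * Real.log x ^ ((2 : ℝ) ^ (2 * (1 + 2 * gammaZero d C))) /
    ξ ^ (1 / (2 * (maxDeg d : ℝ)))
  have hR : 0 ≤ R := by positivity
  set W := (max 1 (δ * ξ * H) / H) ^ (2 * m) * majorSum d f x ξ H
  have hW : 0 ≤ W := by positivity
  have h3' : A₂ * ((∏ j, H ^ (d j + 1)) * (V * tailMass (K H) δ * x ^ 4 + W))
      ≤ A₂ * ((∏ j, H ^ (d j + 1)) * (V * kernelTail K H δ * x ^ 4 + W)) := by gcongr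
  have hVT : 0 ≤ V * kernelTail K H δ * x ^ 4 := by
    have : 0 ≤ kernelTail K H δ := hT0.trans hT
    positivity
  have hRx : 0 ≤ R * x ^ 4 := by positivity
  refine h1.trans ?_
  rw [← Finset.sum_filter_add_sum_filter_not _
    (fun p => IsExceptional (x / ξ ^ (1 / 2 : ℝ)) (x ^ 2 / ξ ^ (1 / (maxDeg d : ℝ))) p.1 p.2)]
  calc _ ≤ (∏ j, H ^ (d j + 1))⁻¹ * (∏ j, c₀ ^ (d j + 1))⁻¹ *
        (A₁ * ((∏ j, H ^ (d j + 1)) * (R * x ^ 4)) +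
          A₂ * ((∏ j, H ^ (d j + 1)) * (V * kernelTail K H δ * x ^ 4 + W))) := by
        refine mul_le_mul_of_nonneg_left (add_le_add h2 (h3.trans h3')) (by positivity)
    _ = (∏ j, c₀ ^ (d j + 1))⁻¹ *
        (A₁ * (R * x ^ 4) + A₂ * (V * kernelTail K H δ * x ^ 4 + W)) := by
        field_simp
    _ ≤ (∏ j, c₀ ^ (d j + 1))⁻¹ *
        ((A₁ + A₂) * ((V * kernelTail K H δ + R) * x ^ 4 + W)) := by
        refine mul_le_mul_of_nonneg_left ?_ (by positivity)
        have e1 : 0 ≤ A₁ * (V * kernelTail K H δ * x ^ 4) := by positivity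
        have e2 : 0 ≤ A₁ * W := by positivity
        have e3 : 0 ≤ A₂ * (R * x ^ 4) := by positivity
        linarith
    _ = _ := by ring
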